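/- Let $k$ be a field, $H$ a Hopf algebra over $k$ with antipode $S$, and $C$ a right $H$-module coalgebra, i.e. a coalgebra with a right action $\triangleleft : C\otimes H\to C$ that is a morphism of coalgebras. Let $I\subseteq C$ be the span of all $c\triangleleft h-\varepsilon(h)c$, let $D=C/I$ be the quotient coalgebra, $\pi:C\to D$ the projection, and regard $C$ as a $D$-bicomodule by $c\mapsto \pi(c^{(1)})\otimes c^{(2)}$ and $c\mapsto c^{(1)}\otimes\pi(c^{(2)})$. Assume that $\pi$ is a Hopf Galois coextension, i.e. that $$\beta:C\otimes H\to C\,\square_D\, C,\qquad c\otimes h\mapsto c^{(1)}\otimes c^{(2)}\triangleleft h$$ is bijective, and put $\kappa=(\varepsilon\otimes\mathrm{id}_H)\circ\beta^{-1}:C\,\square_D\,C\to H$. For a $D$-bicomodule $M$ let $M^D=\{m: m_{\langle0\rangle}\varphi(m_{\langle1\rangle})=m_{\langle0\rangle}\varphi(m_{\langle-1\rangle})\ \forall\varphi\in D^*\}$. Then the following hold. 1. $C^D$ is a right-left stable anti-Yetter-Drinfeld module over $H$, by the restriction of $\triangleleft$ and the (well-defined) coaction $c\mapsto c_{\langle-1\rangle}\otimes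 c_{\langle0\rangle}=\kappa(c^{(3)}\,\square_D\, c^{(1)})\otimes c^{(2)}$. This means that $C^D$ is a right $H$-module and a left $H$-comodule with $(m\triangleleft h)_{\langle-1\rangle}\otimes(m\triangleleft h)_{\langle0\rangle}=S(h^{(3)})m_{\langle-1\rangle}h^{(1)}\otimes m_{\langle0\rangle}\triangleleft h^{(2)}$ and $m_{\langle0\rangle}\triangleleft m_{\langle-1\rangle}=m$. 2. The spaces $C^n(H,C^D)=H^{\otimes n}\otimes C^D$ ($n\ge 0$) form a cocyclic module with the operators (on $h_1\otimes\cdots\otimes h_n\otimes m$) - $\delta_i$, $0\le i\le n$: insert $1_H$ between $h_i$ and $h_{i+1}$; - $\delta_{n+1}= h_1^{(1)}\otimes\cdots\otimes h_n^{(1)}\otimes S(h_1^{(2)}\cdots h_n^{(2)})m_{\langle-1\rangle}\otimes m_{\langle0\rangle}$; - $\sigma_i$, $0\le i\le n-2$: multiply $h_{i+1}$ and $h_{i+2}$; $\sigma_{n-1}$: apply $\varepsilon$ to $h_n$; - $\tau_n= h_2^{(1)}\otimes\cdots\otimes h_n^{(1)}\otimes S(h_1^{(2)}\cdots h_n^{(2)})m_{\langle-1\rangle}\otimes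 m_{\langle0\rangle}\triangleleft h_1^{(1)}$ for $n\ge1$, and $\tau_0=\mathrm{id}$. 3. The cyclic cotensor products $C^n(C(D),C)=(C\,\square_D\cdots\square_D\, C)^D$ ($n+1$ factors) form a cocyclic module with the operators (on $c_0\otimes\cdots\otimes c_n$) - $d_i$, $0\le i\le n$: apply $\Delta$ to $c_i$; $d_{n+1}=c_0^{(2)}\otimes c_1\otimes\cdots\otimes c_n\otimes c_0^{(1)}$; - $s_i$, $0\le i\le n-1$: apply $\varepsilon$ to $c_{i+1}$; - $t_n=c_1\otimes\cdots\otimes c_n\otimes c_0$. 4. The maps $\psi:C^n(H,C^D)\to C^n(C(D),C)$ obtained by iterating $\beta$, $$\psi(h_1\otimes\cdots\otimes h_n\otimes c)= c^{(1)}\otimes c^{(2)}\triangleleft h_1^{(1)}\otimes c^{(3)}\triangleleft h_1^{(2)}h_2^{(1)}\otimes\cdots\otimes c^{(n+1)}\triangleleft h_1^{(n)}\cdots h_{n-1}^{(2)}h_n,$$ are well defined and form an isomorphism of cocyclic modules. 5. Consequently $\psi$ induces, for every $n\ge0$, an isomorphism of cyclic cohomology (the cohomology of the total complex of the cyclic bicomplex)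 $HC^n(H,C^D)\cong HC^n(C(D),C)$. -/

import Mathlib

open scoped TensorProduct

universe u

noncomputable section

namespace HopfGalois

/-! ### Cocyclic modules and cyclic cohomology -/

/-- The operators of a cocyclic module with components `X n`: cofaces `δ n i : X n → X (n+1)`
(meaningful for `i ≤ n + 1`), codegeneracies `σ n i : X (n+1) → X n` (meaningful for `i ≤ n`) and
cyclic operators `τ n : X n → X n`. The relations are in `CocyclicOps.IsCocyclic`; the values at
indices out of range play no role anywhere. -/
structure CocyclicOps (k : Type*) [Field k] (X : ℕ → Type*)
    [∀ n, AddCommGroup (X n)] [∀ n, Module k (X n)] where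
  δ : ∀ n : ℕ, ℕ → (X n →ₗ[k] X (n + 1))
  σ : ∀ n : ℕ, ℕ → (X (n + 1) →ₗ[k] X n)
  τ : ∀ n : ℕ, X n →ₗ[k] X n

namespace CocyclicOps

section
variable {k : Type*} [Field k] {X : ℕ → Type*}
  [∀ n, AddCommGroup (X n)] [∀ n, Module k (X n)]

/-- The cosimplicial and cyclic relations: the operators form a cocyclic module. -/
structure IsCocyclic (A : CocyclicOps k X) : Prop where
  δ_δ : ∀ n i j, i < j → j ≤ n + 2 →
    A.δ (n + 1) j ∘ₗ A.δ n i = A.δ (n + 1) i ∘ₗ A.δ n (j - 1)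
  σ_σ : ∀ n i j, i ≤ j → j ≤ n →
    A.σ n j ∘ₗ A.σ (n + 1) i = A.σ n i ∘ₗ A.σ (n + 1) (j + 1)
  σ_δ_lt : ∀ n i j, i < j → j ≤ n + 1 →
    A.σ (n + 1) j ∘ₗ A.δ (n + 1) i = A.δ n i ∘ₗ A.σ n (j - 1)
  σ_δ_id : ∀ n j, j ≤ n →
    A.σ n j ∘ₗ A.δ n j = LinearMap.id ∧ A.σ n j ∘ₗ A.δ n (j + 1) = LinearMap.id
  σ_δ_gt : ∀ n i j, j + 1 < i → i ≤ n + 2 →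
    A.σ (n + 1) j ∘ₗ A.δ (n + 1) i = A.δ n (i - 1) ∘ₗ A.σ n j
  τ_δ : ∀ n i, 1 ≤ i → i ≤ n + 1 → A.τ (n + 1) ∘ₗ A.δ n i = A.δ n (i - 1) ∘ₗ A.τ n
  τ_δ_zero : ∀ n, A.τ (n + 1) ∘ₗ A.δ n 0 = A.δ n (n + 1)
  τ_σ : ∀ n i, 1 ≤ i → i ≤ n → A.τ n ∘ₗ A.σ n i = A.σ n (i - 1) ∘ₗ A.τ (n + 1)
  τ_σ_zero : ∀ n, A.τ n ∘ₗ A.σ n 0 = A.σ n n ∘ₗ A.τ (n + 1) ∘ₗ A.τ (n + 1)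
  τ_pow : ∀ n, A.τ n ^ (n + 1) = 1

variable (A : CocyclicOps k X)

/-- `b = ∑_{i=0}^{q+1} (-1)^i δ_i`. -/
def b (q : ℕ) : X q →ₗ[k] X (q + 1) := ∑ i ∈ Finset.range (q + 2), (-1 : k) ^ i • A.δ q i

/-- `b' = ∑_{i=0}^{q} (-1)^i δ_i`. -/
def b' (q : ℕ) : X q →ₗ[k] X (q + 1) := ∑ i ∈ Finset.range (q + 1), (-1 : k) ^ i • A.δ q i

/-- The signed cyclic operator `λ = (-1)^q τ`. -/
def lam (q : ℕ) : X q →ₗ[k] X q := (-1 : k) ^ q • A.τ q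

/-- The norm operator `N = 1 + λ + ⋯ + λ^q`. -/
def norm (q : ℕ) : X q →ₗ[k] X q := ∑ i ∈ Finset.range (q + 1), A.lam q ^ i

/-- Vertical differential, in column `p`, of the cyclic bicomplex:
`b` in even columns and `-b'` in odd columns. -/
def vert (p q : ℕ) : X q →ₗ[k] X (q + 1) := if Even p then A.b q else -A.b' q

/-- Horizontal differential, from column `p` to column `p + 1`, of the cyclic bicomplex:
`1 - λ` from even columns and `N` from odd columns. -/
def horiz (p q : ℕ) : X q →ₗ[k] X q := if Even p then 1 - A.lam q else A.norm q

/-- The differential of the total complex of the cyclic bicomplex. In total degree `n`, the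
component `q` of an element is the entry in row `q` and column `n - q`, an element of `X q`. -/
def totD (n : ℕ) : (∀ q : Fin (n + 1), X q) →ₗ[k] (∀ q : Fin (n + 2), X q) :=
  LinearMap.pi fun q =>
    Fin.cases (motive := fun q : Fin (n + 2) => (∀ q : Fin (n + 1), X q) →ₗ[k] X q)
      0 (fun j => A.vert (n - j) j ∘ₗ LinearMap.proj j) q
    + (if h : (q : ℕ) < n + 1 then A.horiz (n - q) q ∘ₗ LinearMap.proj (⟨q, h⟩ : Fin (n + 1))
        else 0)

/-- Cocycles of the total complex. -/
def cocycles (n : ℕ) : Submodule k (∀ q : Fin (n + 1), X q) := LinearMap.ker (A.totD n)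

/-- Coboundaries of the total complex. -/
def coboundaries : ∀ n : ℕ, Submodule k (∀ q : Fin (n + 1), X q)
  | 0 => ⊥
  | n + 1 => LinearMap.range (A.totD n)

/-- Cyclic cohomology `HC^n`: the cohomology of the total complex of the cyclic bicomplex
(over a field of characteristic zero it is also the cohomology of Connes' complex of
`λ`-invariant cochains). -/
abbrev HC (n : ℕ) : Type _ :=
  A.cocycles n ⧸ (A.coboundaries n).comap (A.cocycles n).subtype

end

/-- An isomorphism of cocyclic modules. -/
structure Iso {k : Type*} [Field k] {X Y : ℕ → Type*}
    [∀ n, AddCommGroup (X n)] [∀ n, Module k (X n)]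
    [∀ n, AddCommGroup (Y n)] [∀ n, Module k (Y n)]
    (A : CocyclicOps k X) (B : CocyclicOps k Y) where
  equiv : ∀ n, X n ≃ₗ[k] Y n
  comm_δ : ∀ n i, i ≤ n + 1 → ∀ x, equiv (n + 1) (A.δ n i x) = B.δ n i (equiv n x)
  comm_σ : ∀ n i, i ≤ n → ∀ x, equiv n (A.σ n i x) = B.σ n i (equiv (n + 1) x)
  comm_τ : ∀ n x, equiv n (A.τ n x) = B.τ n (equiv n x)

end CocyclicOps

/-! ### Iterated tensor products -/

/-- `iter k V M n` is `M ⊗ V ⊗ ⋯ ⊗ V` with `n` factors `V`, bracketed to the left. -/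
def iter (k : Type*) [Field k] (V : Type u) [AddCommGroup V] [Module k V]
    (M : Type u) [AddCommGroup M] [Module k M] : ℕ → ModuleCat.{u} k
  | 0 => ModuleCat.of k M
  | n + 1 => ModuleCat.of k (iter k V M n ⊗[k] V)

section
variable {k : Type*} [Field k] {V : Type u} [AddCommGroup V] [Module k V]
  {M : Type u} [AddCommGroup M] [Module k M]

/-- The identity map, which makes the equality `M ⊗ V^{⊗0} = M` visible. -/
def iterZero : iter k V M 0 ≃ₗ[k] M := LinearEquiv.refl k M

/-- The identity map, which makes the equality
`M ⊗ V^{⊗(n+1)} = (M ⊗ V^{⊗n}) ⊗ V` visible. -/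
def iterSucc (n : ℕ) : iter k V M (n + 1) ≃ₗ[k] (iter k V M n ⊗[k] V) :=
  LinearEquiv.refl k (iter k V M n ⊗[k] V)

end

/-! ### Right-left SAYD modules and the Hopf cocyclic module -/

/-- A right-left stable anti-Yetter-Drinfeld module structure on `M` over the Hopf algebra `H`:
a right action, a left coaction, the anti-Yetter-Drinfeld condition and stability. -/
structure SAYD (k : Type*) [Field k] (H : Type*) [Ring H] [HopfAlgebra k H]
    (M : Type*) [AddCommGroup M] [Module k M] where
  act : M ⊗[k] H →ₗ[k] M
  coact : M →ₗ[k] H ⊗[k] M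
  act_one : ∀ m, act (m ⊗ₜ 1) = m
  act_mul : ∀ m g h, act (act (m ⊗ₜ g) ⊗ₜ h) = act (m ⊗ₜ (g * h))
  coact_counit : ∀ m, TensorProduct.lid k M ((Coalgebra.counit (R := k)).rTensor M (coact m)) = m
  coact_coassoc : ∀ m, TensorProduct.assoc k H H M
      ((Coalgebra.comul (R := k)).rTensor M (coact m)) = coact.lTensor H (coact m)
  /-- `(m ◁ h)₍₋₁₎ ⊗ (m ◁ h)₍₀₎ = S(h⁽³⁾) m₍₋₁₎ h⁽¹⁾ ⊗ m₍₀₎ ◁ h⁽²⁾`, where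
  `h⁽¹⁾ ⊗ h⁽²⁾ ⊗ h⁽³⁾ = ∑ i, h₁ i ⊗ h₂ i ⊗ h₃ i` and `m₍₋₁₎ ⊗ m₍₀₎ = ∑ j, g j ⊗ m₀ j`. -/
  ayd : ∀ (m : M) (h : H) (r s : ℕ) (h₁ h₂ h₃ : Fin r → H) (g : Fin s → H) (m₀ : Fin s → M),
    (Coalgebra.comul (R := k)).lTensor H (Coalgebra.comul (R := k) h)
        = ∑ i, h₁ i ⊗ₜ[k] (h₂ i ⊗ₜ[k] h₃ i) →
    coact m = ∑ j, g j ⊗ₜ[k] m₀ j →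
    coact (act (m ⊗ₜ h)) =
      ∑ i, ∑ j, (HopfAlgebra.antipode k (h₃ i) * g j * h₁ i) ⊗ₜ[k] act (m₀ j ⊗ₜ h₂ i)
  /-- `m₍₀₎ ◁ m₍₋₁₎ = m`. -/
  stable : ∀ m, act (TensorProduct.comm k H M (coact m)) = m

namespace SAYD

variable {k : Type*} [Field k] {H : Type u} [Ring H] [HopfAlgebra k H]
  {M : Type u} [AddCommGroup M] [Module k M]

/-- `m ⊗ h₁ ⊗ ⋯ ⊗ hₙ ↦ m ⊗ h₁ ⊗ ⋯ ⊗ hᵢ ⊗ 1 ⊗ hᵢ₊₁ ⊗ ⋯ ⊗ hₙ`. -/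
def insertOne : ∀ n : ℕ, ℕ → (iter k H M n →ₗ[k] iter k H M (n + 1))
  | 0, _ => (iterSucc 0).symm.toLinearMap ∘ₗ (TensorProduct.mk k _ H).flip 1
  | n + 1, i =>
    if i ≤ n then
      (iterSucc (n + 1)).symm.toLinearMap ∘ₗ (insertOne n i).rTensor H ∘ₗ (iterSucc n).toLinearMap
    else (iterSucc (n + 1)).symm.toLinearMap ∘ₗ (TensorProduct.mk k _ H).flip 1

/-- Codegeneracy `σᵢ` on `n + 1` factors `h₁, …, hₙ₊₁`: it replaces `hᵢ₊₁ ⊗ hᵢ₊₂` by their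
product if `i < n`, and applies the counit to the last factor `hₙ₊₁` if `i = n`. -/
def codegen : ∀ n : ℕ, ℕ → (iter k H M (n + 1) →ₗ[k] iter k H M n)
  | 0, _ => (TensorProduct.rid k _).toLinearMap ∘ₗ (Coalgebra.counit (R := k)).lTensor _ ∘ₗ
      (iterSucc 0).toLinearMap
  | n + 1, i =>
    if i < n then
      (iterSucc n).symm.toLinearMap ∘ₗ (codegen n i).rTensor H ∘ₗ (iterSucc (n + 1)).toLinearMap
    else if i = n then
      (iterSucc n).symm.toLinearMap ∘ₗ (LinearMap.mul' k H).lTensor _ ∘ₗ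
        (TensorProduct.assoc k (iter k H M n) H H).toLinearMap ∘ₗ
        (iterSucc n).toLinearMap.rTensor H ∘ₗ (iterSucc (n + 1)).toLinearMap
    else
      (TensorProduct.rid k _).toLinearMap ∘ₗ (Coalgebra.counit (R := k)).lTensor _ ∘ₗ
        (iterSucc (n + 1)).toLinearMap

/-- `(x ⊗ g) ⊗ (h' ⊗ h'') ↦ (x ⊗ h') ⊗ S(h'') g`. -/
def twist (X : Type*) [AddCommGroup X] [Module k X] :
    (X ⊗[k] H) ⊗[k] (H ⊗[k] H) →ₗ[k] (X ⊗[k] H) ⊗[k] H :=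
  TensorProduct.map LinearMap.id
      (LinearMap.mul' k H ∘ₗ (HopfAlgebra.antipode k).rTensor H ∘ₗ
        (TensorProduct.comm k H H).toLinearMap) ∘ₗ
    (TensorProduct.tensorTensorTensorComm k X H H H).toLinearMap

/-- `m ⊗ h₁ ⊗ ⋯ ⊗ hₙ ↦ (m₍₀₎ ⊗ h₁⁽¹⁾ ⊗ ⋯ ⊗ hₙ⁽¹⁾) ⊗ S(h₁⁽²⁾ ⋯ hₙ⁽²⁾) m₍₋₁₎`, written with
`S(h₁⁽²⁾ ⋯ hₙ₊₁⁽²⁾) = S(hₙ₊₁⁽²⁾) S(h₁⁽²⁾ ⋯ hₙ⁽²⁾)`. -/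
def lastCoface (S : SAYD k H M) : ∀ n : ℕ, iter k H M n →ₗ[k] iter k H M (n + 1)
  | 0 => (iterSucc 0).symm.toLinearMap ∘ₗ (iterZero.symm.toLinearMap).rTensor H ∘ₗ
      (TensorProduct.comm k H M).toLinearMap ∘ₗ S.coact ∘ₗ iterZero.toLinearMap
  | n + 1 => (iterSucc (n + 1)).symm.toLinearMap ∘ₗ
      ((iterSucc n).symm.toLinearMap).rTensor H ∘ₗ twist (iter k H M n) ∘ₗ
      TensorProduct.map ((iterSucc n).toLinearMap ∘ₗ lastCoface S n) (Coalgebra.comul (R := k)) ∘ₗ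
      (iterSucc n).toLinearMap

/-- `m ⊗ h₁ ⊗ h₂ ⊗ ⋯ ⊗ hₙ₊₁ ↦ (m ◁ h₁) ⊗ h₂ ⊗ ⋯ ⊗ hₙ₊₁`. -/
def absorb (S : SAYD k H M) : ∀ n : ℕ, iter k H M (n + 1) →ₗ[k] iter k H M n
  | 0 => iterZero.symm.toLinearMap ∘ₗ S.act ∘ₗ (iterZero.toLinearMap).rTensor H ∘ₗ
      (iterSucc 0).toLinearMap
  | n + 1 => (iterSucc n).symm.toLinearMap ∘ₗ (absorb S n).rTensor H ∘ₗ
      (iterSucc (n + 1)).toLinearMap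

/-- The Hopf cocyclic module `C^n(H, M) = M ⊗ H^{⊗n}` with coefficients in the SAYD module `M`.
The cyclic operator is
`m ⊗ h₁ ⊗ ⋯ ⊗ hₙ ↦ m₍₀₎ ◁ h₁⁽¹⁾ ⊗ h₂⁽¹⁾ ⊗ ⋯ ⊗ hₙ⁽¹⁾ ⊗ S(h₁⁽²⁾ ⋯ hₙ⁽²⁾) m₍₋₁₎`
(for `n = 0` it is `m ↦ m₍₀₎ ◁ m₍₋₁₎ = m`). -/
def hopfCocyclic (S : SAYD k H M) : CocyclicOps k (fun n => iter k H M n) where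
  δ n i := if i ≤ n then insertOne n i else S.lastCoface n
  σ n i := codegen n i
  τ n := S.absorb n ∘ₗ S.lastCoface n

end SAYD

/-! ### Comodules -/

/-- The cotensor product `M □_D N` as a subspace of `M ⊗ N`, for a right coaction `ρ` of `D` on `M`
and a left coaction `l` of `D` on `N`. -/
def cotensor {k D M N : Type*} [Field k] [AddCommGroup D] [Module k D]
    [AddCommGroup M] [Module k M] [AddCommGroup N] [Module k N]
    (ρ : M →ₗ[k] M ⊗[k] D) (l : N →ₗ[k] D ⊗[k] N) : Submodule k (M ⊗[k] N) :=
  LinearMap.eqLocus ((TensorProduct.assoc k M D N).toLinearMap ∘ₗ ρ.rTensor N) (l.lTensor M)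

/-- The subspace `M^D = {m | m₍₀₎ φ(m₍₁₎) = m₍₀₎ φ(m₍₋₁₎) for all φ ∈ D^*}` of a `D`-bicomodule
with right coaction `ρ` and left coaction `l`. -/
def coinvariants {k D M : Type*} [Field k] [AddCommGroup D] [Module k D]
    [AddCommGroup M] [Module k M]
    (ρ : M →ₗ[k] M ⊗[k] D) (l : M →ₗ[k] D ⊗[k] M) : Submodule k M :=
  ⨅ φ : Module.Dual k D,
    LinearMap.eqLocus ((TensorProduct.rid k M).toLinearMap ∘ₗ φ.lTensor M ∘ₗ ρ)
      ((TensorProduct.lid k M).toLinearMap ∘ₗ φ.rTensor M ∘ₗ l)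

/-! ### Hopf Galois coextensions -/

/-- A right `H`-module coalgebra structure on the coalgebra `C`: a right `H`-action
`◁ : C ⊗ H → C` which is a morphism of coalgebras, i.e.
`Δ(c ◁ h) = c⁽¹⁾ ◁ h⁽¹⁾ ⊗ c⁽²⁾ ◁ h⁽²⁾` and `ε(c ◁ h) = ε(c) ε(h)`. -/
structure ModuleCoalgebra (k : Type*) [Field k] (H : Type*) [Ring H] [HopfAlgebra k H]
    (C : Type*) [AddCommGroup C] [Module k C] [Coalgebra k C] where
  act : C ⊗[k] H →ₗ[k] C
  act_one : ∀ c, act (c ⊗ₜ 1) = c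
  act_mul : ∀ c g h, act (act (c ⊗ₜ g) ⊗ₜ h) = act (c ⊗ₜ (g * h))
  comul_act : ∀ c h, Coalgebra.comul (R := k) (act (c ⊗ₜ h)) =
    TensorProduct.map act act (TensorProduct.tensorTensorTensorComm k C C H H
      (Coalgebra.comul (R := k) c ⊗ₜ Coalgebra.comul (R := k) h))
  counit_act : ∀ c h, Coalgebra.counit (R := k) (act (c ⊗ₜ h)) =
    Coalgebra.counit (R := k) c * Coalgebra.counit (R := k) h

namespace ModuleCoalgebra

variable {k : Type*} [Field k] {H : Type u} [Ring H] [HopfAlgebra k H]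
  {C : Type u} [AddCommGroup C] [Module k C] [Coalgebra k C] (A : ModuleCoalgebra k H C)

/-- The coideal `I` spanned by the elements `c ◁ h - ε(h) c`. -/
def coideal : Submodule k C :=
  Submodule.span k {x | ∃ (c : C) (h : H), x = A.act (c ⊗ₜ h) - Coalgebra.counit (R := k) h • c}

/-- The underlying space of the quotient coalgebra `D = C / I`. Cotensor products over `D` and
`D`-coinvariants of `D`-bicomodules induced along `π` involve only `π` and this space. -/
abbrev D : Type u := C ⧸ A.coideal

/-- The projection `π : C → D`. -/
abbrev π : C →ₗ[k] A.D := A.coideal.mkQ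

/-- The right `D`-coaction `c ↦ c⁽¹⁾ ⊗ π(c⁽²⁾)`. -/
def rightCoact : C →ₗ[k] C ⊗[k] A.D := A.π.lTensor C ∘ₗ Coalgebra.comul

/-- The left `D`-coaction `c ↦ π(c⁽¹⁾) ⊗ c⁽²⁾`. -/
def leftCoact : C →ₗ[k] A.D ⊗[k] C := A.π.rTensor C ∘ₗ Coalgebra.comul

/-- `C □_D C`, as a subspace of `C ⊗ C`. -/
def cotensorSq : Submodule k (C ⊗[k] C) := cotensor A.rightCoact A.leftCoact

/-- The space `C^D`. -/
def CD : Submodule k C := coinvariants A.rightCoact A.leftCoact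

/-- The Galois map `β : c ⊗ h ↦ c⁽¹⁾ ⊗ c⁽²⁾ ◁ h`, as a map to `C ⊗ C`. -/
def galoisMap : C ⊗[k] H →ₗ[k] C ⊗[k] C :=
  A.act.lTensor C ∘ₗ (TensorProduct.assoc k C C H).toLinearMap ∘ₗ
    (Coalgebra.comul (R := k)).rTensor H

/-- `π : C → D` is a Hopf Galois coextension: `β` is a bijection from `C ⊗ H` onto `C □_D C`. -/
def IsHopfGalois : Prop :=
  Set.BijOn A.galoisMap Set.univ (A.cotensorSq : Set (C ⊗[k] C))

/-- The inverse `β⁻¹ : C □_D C → C ⊗ H` of the Galois map. -/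
def galoisInv (hA : A.IsHopfGalois) : A.cotensorSq →ₗ[k] C ⊗[k] H :=
  (LinearEquiv.ofBijective
    (A.galoisMap.codRestrict A.cotensorSq fun x => hA.mapsTo (Set.mem_univ x))
    ⟨fun x y h => hA.injOn (Set.mem_univ x) (Set.mem_univ y) (congrArg Subtype.val h),
      fun y => by
        obtain ⟨x, -, hx⟩ := hA.surjOn y.2
        exact ⟨x, Subtype.ext hx⟩⟩).symm.toLinearMap

/-- The map `κ = (ε ⊗ id_H) ∘ β⁻¹ : C □_D C → H`. It is the composite of the projection
`C □_D C → (C □_D C)_D` with the map `(ε ⊗ id_H) ∘ β̄⁻¹` on the quotient, where `β̄` is the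
bijection induced by `β`. -/
def κ (hA : A.IsHopfGalois) : A.cotensorSq →ₗ[k] H :=
  (TensorProduct.lid k H).toLinearMap ∘ₗ (Coalgebra.counit (R := k)).rTensor H ∘ₗ A.galoisInv hA

/-- `c ↦ (c⁽³⁾ ⊗ c⁽¹⁾) ⊗ c⁽²⁾`. -/
def comulCyc : C →ₗ[k] (C ⊗[k] C) ⊗[k] C :=
  (TensorProduct.assoc k C C C).symm.toLinearMap ∘ₗ (TensorProduct.comm k (C ⊗[k] C) C).toLinearMap
    ∘ₗ (Coalgebra.comul (R := k)).rTensor C ∘ₗ Coalgebra.comul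

/-- The given SAYD structure on `C^D` is the canonical one: the action is the restriction of the
action on `C`, and the coaction is `c ↦ κ(c⁽³⁾ □_D c⁽¹⁾) ⊗ c⁽²⁾`. The second clause says that
`c⁽³⁾ ⊗ c⁽¹⁾ ⊗ c⁽²⁾` is (the image of) an element `w` of `(C □_D C) ⊗ C` for every `c ∈ C^D`, and
that `(κ ⊗ id) w` is (the image in `H ⊗ C` of) the coaction of `c`. Both clauses determine the
structure, as `C^D → C`, `H ⊗ C^D → H ⊗ C` and `(C □_D C) ⊗ C → (C ⊗ C) ⊗ C` are injective. -/
structure IsCanonical (hA : A.IsHopfGalois) (S : SAYD k H A.CD) : Prop where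
  act_eq : ∀ (c : A.CD) (h : H), (S.act (c ⊗ₜ h) : C) = A.act ((c : C) ⊗ₜ h)
  coact_eq : ∀ c : A.CD, ∃ w : A.cotensorSq ⊗[k] C,
    A.cotensorSq.subtype.rTensor C w = comulCyc (k := k) (c : C) ∧
    A.CD.subtype.lTensor H (S.coact c) = (A.κ hA).rTensor C w

/-! ### The relative cocyclic module of the coextension -/

/-- The right `D`-coaction on `C^{⊗(n+1)}` through the last factor. -/
def rightCoactPow : ∀ n : ℕ, iter k C C n →ₗ[k] iter k C C n ⊗[k] A.D
  | 0 => (iterZero.symm.toLinearMap).rTensor A.D ∘ₗ A.rightCoact ∘ₗ iterZero.toLinearMap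
  | n + 1 => ((iterSucc n).symm.toLinearMap).rTensor A.D ∘ₗ
      (TensorProduct.assoc k (iter k C C n) C A.D).symm.toLinearMap ∘ₗ
      A.rightCoact.lTensor (iter k C C n) ∘ₗ (iterSucc n).toLinearMap

/-- The left `D`-coaction on `C^{⊗(n+1)}` through the first factor. -/
def leftCoactPow : ∀ n : ℕ, iter k C C n →ₗ[k] A.D ⊗[k] iter k C C n
  | 0 => (iterZero.symm.toLinearMap).lTensor A.D ∘ₗ A.leftCoact ∘ₗ iterZero.toLinearMap
  | n + 1 => ((iterSucc n).symm.toLinearMap).lTensor A.D ∘ₗ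
      (TensorProduct.assoc k A.D (iter k C C n) C).toLinearMap ∘ₗ
      (leftCoactPow n).rTensor C ∘ₗ (iterSucc n).toLinearMap

/-- The iterated cotensor product `C □_D ⋯ □_D C` (`n + 1` factors) in `C^{⊗(n+1)}`, bracketed to
the left: `X □_D C`, for a subcomodule `X` of `C^{⊗(n+1)}`, consists of the elements of `X ⊗ C`
that satisfy the cotensor condition. -/
def cotensorPow : ∀ n : ℕ, Submodule k (iter k C C n)
  | 0 => ⊤
  | n + 1 => (LinearMap.range ((cotensorPow n).subtype.rTensor C) ⊓
      cotensor (A.rightCoactPow n) A.leftCoact).comap (iterSucc n).toLinearMap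

/-- The cyclic cotensor product `C^n(C(D), C) = (C □_D ⋯ □_D C)^D` with `n + 1` factors. -/
def cyclicCotensor (n : ℕ) : Submodule k (iter k C C n) :=
  A.cotensorPow n ⊓ coinvariants (A.rightCoactPow n) (A.leftCoactPow n)

/-- `c₀ ⊗ ⋯ ⊗ cₙ ↦ c₀ ⊗ ⋯ ⊗ Δ(cᵢ) ⊗ ⋯ ⊗ cₙ`. -/
def comulAt : ∀ n : ℕ, ℕ → (iter k C C n →ₗ[k] iter k C C (n + 1))
  | 0, _ => (iterSucc 0).symm.toLinearMap ∘ₗ (iterZero.symm.toLinearMap).rTensor C ∘ₗ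
      Coalgebra.comul ∘ₗ iterZero.toLinearMap
  | n + 1, i =>
    if i ≤ n then
      (iterSucc (n + 1)).symm.toLinearMap ∘ₗ (comulAt n i).rTensor C ∘ₗ (iterSucc n).toLinearMap
    else
      (iterSucc (n + 1)).symm.toLinearMap ∘ₗ ((iterSucc n).symm.toLinearMap).rTensor C ∘ₗ
        (TensorProduct.assoc k (iter k C C n) C C).symm.toLinearMap ∘ₗ
        (Coalgebra.comul (R := k)).lTensor (iter k C C n) ∘ₗ (iterSucc n).toLinearMap

/-- `c₀ ⊗ ⋯ ⊗ cₙ₊₁ ↦ c₀ ⊗ ⋯ ⊗ ε(cᵢ₊₁) ⊗ ⋯ ⊗ cₙ₊₁`, for `0 ≤ i ≤ n`. -/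
def counitAt : ∀ n : ℕ, ℕ → (iter k C C (n + 1) →ₗ[k] iter k C C n)
  | 0, _ => (TensorProduct.rid k _).toLinearMap ∘ₗ (Coalgebra.counit (R := k)).lTensor _ ∘ₗ
      (iterSucc 0).toLinearMap
  | n + 1, i =>
    if i ≤ n then
      (iterSucc n).symm.toLinearMap ∘ₗ (counitAt n i).rTensor C ∘ₗ (iterSucc (n + 1)).toLinearMap
    else
      (TensorProduct.rid k _).toLinearMap ∘ₗ (Coalgebra.counit (R := k)).lTensor _ ∘ₗ
        (iterSucc (n + 1)).toLinearMap

/-- `c₀ ⊗ c₁ ⊗ ⋯ ⊗ cₙ ↦ c₁ ⊗ ⋯ ⊗ cₙ ⊗ c₀`: rotate all the factors but the last, then exchange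
the last two. -/
def rotate : ∀ n : ℕ, iter k C C n →ₗ[k] iter k C C n
  | 0 => LinearMap.id
  | 1 => (iterSucc 0).symm.toLinearMap ∘ₗ (iterZero.symm.toLinearMap).rTensor C ∘ₗ
      (TensorProduct.comm k C C).toLinearMap ∘ₗ (iterZero.toLinearMap).rTensor C ∘ₗ
      (iterSucc 0).toLinearMap
  | n + 2 => (iterSucc (n + 1)).symm.toLinearMap ∘ₗ ((iterSucc n).symm.toLinearMap).rTensor C ∘ₗ
      (TensorProduct.rightComm k (iter k C C n) C C).toLinearMap ∘ₗ
      ((iterSucc n).toLinearMap).rTensor C ∘ₗ (rotate (n + 1)).rTensor C ∘ₗ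
      (iterSucc (n + 1)).toLinearMap

/-- The cofaces on `C^{⊗(n+1)}`: `Δ` on the factor `cᵢ` for `0 ≤ i ≤ n`, and
`c₀⁽²⁾ ⊗ c₁ ⊗ ⋯ ⊗ cₙ ⊗ c₀⁽¹⁾` for `i = n + 1`. -/
def coface (n i : ℕ) : iter k C C n →ₗ[k] iter k C C (n + 1) :=
  if i ≤ n then comulAt n i else rotate (n + 1) ∘ₗ comulAt n 0

/-- The operators `Y` on the spaces `C^n(C(D), C)` are the restrictions of the operators on
`C^{⊗(n+1)}`, i.e. `Y` is the relative cocyclic module of the coextension. -/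
structure IsRelative (Y : CocyclicOps k (fun n => A.cyclicCotensor n)) : Prop where
  δ_eq : ∀ n i, i ≤ n + 1 → ∀ x : A.cyclicCotensor n,
    (Y.δ n i x : iter k C C (n + 1)) = coface n i (x : iter k C C n)
  σ_eq : ∀ n i, i ≤ n → ∀ x : A.cyclicCotensor (n + 1),
    (Y.σ n i x : iter k C C n) = counitAt n i (x : iter k C C (n + 1))
  τ_eq : ∀ n, ∀ x : A.cyclicCotensor n,
    (Y.τ n x : iter k C C n) = rotate n (x : iter k C C n)

/-! ### The map `ψ` -/

/-- The Galois map applied to the last factor: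
`c₀ ⊗ ⋯ ⊗ cₙ ⊗ h ↦ c₀ ⊗ ⋯ ⊗ cₙ₋₁ ⊗ cₙ⁽¹⁾ ⊗ cₙ⁽²⁾ ◁ h`. -/
def galoisLast : ∀ n : ℕ, iter k C C n ⊗[k] H →ₗ[k] iter k C C (n + 1)
  | 0 => (iterSucc 0).symm.toLinearMap ∘ₗ (iterZero.symm.toLinearMap).rTensor C ∘ₗ
      A.galoisMap ∘ₗ (iterZero.toLinearMap).rTensor H
  | n + 1 => (iterSucc (n + 1)).symm.toLinearMap ∘ₗ ((iterSucc n).symm.toLinearMap).rTensor C ∘ₗ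
      (TensorProduct.assoc k (iter k C C n) C C).symm.toLinearMap ∘ₗ
      A.galoisMap.lTensor (iter k C C n) ∘ₗ (TensorProduct.assoc k (iter k C C n) C H).toLinearMap ∘ₗ
      ((iterSucc n).toLinearMap).rTensor H

/-- The map `ψ` on `C^D ⊗ H^{⊗n}`, with values in `C^{⊗(n+1)}`:
`c ⊗ h₁ ⊗ ⋯ ⊗ hₙ ↦
  c⁽¹⁾ ⊗ c⁽²⁾ ◁ h₁⁽¹⁾ ⊗ c⁽³⁾ ◁ h₁⁽²⁾ h₂⁽¹⁾ ⊗ ⋯ ⊗ c⁽ⁿ⁺¹⁾ ◁ h₁⁽ⁿ⁾ ⋯ hₙ₋₁⁽²⁾ hₙ`. -/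
def ψ : ∀ n : ℕ, iter k H A.CD n →ₗ[k] iter k C C n
  | 0 => iterZero.symm.toLinearMap ∘ₗ A.CD.subtype ∘ₗ iterZero.toLinearMap
  | n + 1 => A.galoisLast n ∘ₗ (ψ n).rTensor H ∘ₗ (iterSucc n).toLinearMap

end ModuleCoalgebra

end HopfGalois

end

/-!
The argument avoids the formulas for the cyclic operator on the Hopf side. On all of `C^{⊗(n+1)}`
the operators `coface`, `counitAt` and `rotate` form the cocyclic module of the coalgebra `C`
(`isCocyclic_coalgebraCocyclic`); the relations are checked on pure tensors, and those of the last
coface `t d₀` follow from the others. The maps `ψ` are injective with image the cyclic cotensor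
product and intertwine all operators. Hence `C^n(C(D), C)` is stable under the operators, and both
sides of the isomorphism inherit the relations from `C^{⊗(n+1)}`
(`CocyclicOps.IsCocyclic.of_injective`).

*Image of `ψ`.* Every right `C`-comodule `M` has a Galois map `M ⊗ H → M ⊗ C`,
`m ⊗ h ↦ m₍₀₎ ⊗ m₍₁₎ ◁ h` (`ModuleCoalgebra.gal`). It is injective because `M` embeds into `M ⊗ C`,
whose Galois map is `M ⊗ β`; for `M = C^{⊗(n+1)}` its image is `M □_D C`; it is colinear, and it
reflects membership in a subcomodule (`gal_mem_iff`). Since the Galois map on the last factor is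
compatible with both `D`-coactions, the cyclic cotensor product with `n + 2` factors is the image
of the one with `n + 1` factors tensored with `H`, and `ψ` is the iteration of these maps
(`mem_cyclicCotensor_iff_ψ`). Over a field all kernels are compatible with tensor products.

*The coaction of `C^D`.* For `c ∈ C^D` the element `c⁽²⁾ ⊗ c⁽¹⁾` lies in `(C □_D C)^D`, so it is
`β(c₍₀₎ ⊗ c₍₋₁₎)` for a unique `c₍₀₎ ⊗ c₍₋₁₎ ∈ C^D ⊗ H`. This defines the coaction
(`coactFlip`), and each axiom of a stable anti-Yetter-Drinfeld module becomes an identity in `C`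
after an injective Galois map is applied to both sides. Applying `Δ` to the first factor of
`β(c₍₀₎ ⊗ c₍₋₁₎) = c⁽²⁾ ⊗ c⁽¹⁾` identifies it with `κ(c⁽³⁾ ⊗ c⁽¹⁾) ⊗ c⁽²⁾`.

*Intertwining.* Operators that leave the last factor alone are colinear, so they commute with the
Galois map on it. The last coface is treated by induction on `n`, where the antipode cancels
through `h⁽¹⁾ ⊗ h⁽²⁾ S(h⁽³⁾) = h ⊗ 1` (`ψ_lastCoface`). Letting `h₁` act on the coefficient
corresponds under `ψ` to applying `ε` to the first factor, and this turns the last coface into the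
rotation (`ψ_absorb`, `counitFirst_rotate_comulAt_zero`).

Finally, an isomorphism of cocyclic modules commutes with the differential of the total complex,
hence induces isomorphisms of cyclic cohomology (`CocyclicOps.Iso.hcEquiv`).
-/

noncomputable section

namespace HopfGalois

open scoped Coalgebra

/-! ### Cocyclic modules: pulling back the relations, and functoriality of cyclic cohomology -/

namespace CocyclicOps

variable {k : Type*} [Field k] {X Y : ℕ → Type*}
  [∀ n, AddCommGroup (X n)] [∀ n, Module k (X n)]
  [∀ n, AddCommGroup (Y n)] [∀ n, Module k (Y n)]

/-- The cocyclic relations pull back along injective maps that intertwine the operators. -/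
theorem IsCocyclic.of_injective {A : CocyclicOps k X} {B : CocyclicOps k Y} (hB : B.IsCocyclic)
    (f : ∀ n, X n →ₗ[k] Y n) (hf : ∀ n, Function.Injective (f n))
    (hδ : ∀ n i, i ≤ n + 1 → ∀ x, f (n + 1) (A.δ n i x) = B.δ n i (f n x))
    (hσ : ∀ n i, i ≤ n → ∀ x, f n (A.σ n i x) = B.σ n i (f (n + 1) x))
    (hτ : ∀ n x, f n (A.τ n x) = B.τ n (f n x)) : A.IsCocyclic where
  δ_δ n i j h₁ h₂ := LinearMap.ext fun x => hf _ <| by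
    have := LinearMap.congr_fun (hB.δ_δ n i j h₁ h₂) (f _ x)
    simp only [LinearMap.comp_apply] at this ⊢
    rw [hδ, hδ, hδ, hδ, this] <;> omega
  σ_σ n i j h₁ h₂ := LinearMap.ext fun x => hf _ <| by
    have := LinearMap.congr_fun (hB.σ_σ n i j h₁ h₂) (f _ x)
    simp only [LinearMap.comp_apply] at this ⊢
    rw [hσ, hσ, hσ, hσ, this] <;> omega
  σ_δ_lt n i j h₁ h₂ := LinearMap.ext fun x => hf _ <| by
    have := LinearMap.congr_fun (hB.σ_δ_lt n i j h₁ h₂) (f _ x)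
    simp only [LinearMap.comp_apply] at this ⊢
    rw [hσ, hδ, hδ, hσ, this] <;> omega
  σ_δ_id n j h := by
    constructor <;> refine LinearMap.ext fun x => hf _ ?_
    · have := LinearMap.congr_fun (hB.σ_δ_id n j h).1 (f _ x)
      simp only [LinearMap.comp_apply, LinearMap.id_apply] at this ⊢
      rw [hσ, hδ, this] <;> omega
    · have := LinearMap.congr_fun (hB.σ_δ_id n j h).2 (f _ x)
      simp only [LinearMap.comp_apply, LinearMap.id_apply] at this ⊢
      rw [hσ, hδ, this] <;> omega
  σ_δ_gt n i j h₁ h₂ := LinearMap.ext fun x => hf _ <| by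
    have := LinearMap.congr_fun (hB.σ_δ_gt n i j h₁ h₂) (f _ x)
    simp only [LinearMap.comp_apply] at this ⊢
    rw [hσ, hδ, hδ, hσ, this] <;> omega
  τ_δ n i h₁ h₂ := LinearMap.ext fun x => hf _ <| by
    have := LinearMap.congr_fun (hB.τ_δ n i h₁ h₂) (f _ x)
    simp only [LinearMap.comp_apply] at this ⊢
    rw [hτ, hδ, hδ, hτ, this] <;> omega
  τ_δ_zero n := LinearMap.ext fun x => hf _ <| by
    have := LinearMap.congr_fun (hB.τ_δ_zero n) (f _ x)
    simp only [LinearMap.comp_apply] at this ⊢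
    rw [hτ, hδ, hδ, this] <;> omega
  τ_σ n i h₁ h₂ := LinearMap.ext fun x => hf _ <| by
    have := LinearMap.congr_fun (hB.τ_σ n i h₁ h₂) (f _ x)
    simp only [LinearMap.comp_apply] at this ⊢
    rw [hτ, hσ, hσ, hτ, this] <;> omega
  τ_σ_zero n := LinearMap.ext fun x => hf _ <| by
    have := LinearMap.congr_fun (hB.τ_σ_zero n) (f _ x)
    simp only [LinearMap.comp_apply] at this ⊢
    rw [hτ, hσ, hσ, hτ, hτ, this] <;> omega
  τ_pow n := LinearMap.ext fun x => hf _ <| by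
    have h : ∀ m, f n ((A.τ n ^ m) x) = (B.τ n ^ m) (f n x) := fun m => by
      induction m with
      | zero => simp
      | succ m ih => rw [pow_succ', pow_succ', Module.End.mul_apply, Module.End.mul_apply, hτ, ih]
    rw [h, hB.τ_pow n]
    rfl

namespace Iso

variable {A : CocyclicOps k X} {B : CocyclicOps k Y} (Ψ : Iso A B)

theorem map_b (q : ℕ) (x : X q) : Ψ.equiv (q + 1) (A.b q x) = B.b q (Ψ.equiv q x) := by
  simp only [b, LinearMap.sum_apply, LinearMap.smul_apply, map_sum, map_smul]
  refine Finset.sum_congr rfl fun i hi => ?_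
  rw [Ψ.comm_δ q i (by have := Finset.mem_range.1 hi; omega)]

theorem map_b' (q : ℕ) (x : X q) : Ψ.equiv (q + 1) (A.b' q x) = B.b' q (Ψ.equiv q x) := by
  simp only [b', LinearMap.sum_apply, LinearMap.smul_apply, map_sum, map_smul]
  refine Finset.sum_congr rfl fun i hi => ?_
  rw [Ψ.comm_δ q i (by have := Finset.mem_range.1 hi; omega)]

theorem map_lam (q : ℕ) (x : X q) : Ψ.equiv q (A.lam q x) = B.lam q (Ψ.equiv q x) := by
  simp only [lam, LinearMap.smul_apply, map_smul, Ψ.comm_τ]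

theorem map_norm (q : ℕ) (x : X q) : Ψ.equiv q (A.norm q x) = B.norm q (Ψ.equiv q x) := by
  have h : ∀ m, Ψ.equiv q ((A.lam q ^ m) x) = (B.lam q ^ m) (Ψ.equiv q x) := fun m => by
    induction m with
    | zero => simp
    | succ m ih =>
      rw [pow_succ', pow_succ', Module.End.mul_apply, Module.End.mul_apply, map_lam, ih]
  simp only [norm, LinearMap.sum_apply, map_sum, h]

theorem map_vert (p q : ℕ) (x : X q) :
    Ψ.equiv (q + 1) (A.vert p q x) = B.vert p q (Ψ.equiv q x) := by
  unfold vert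
  split_ifs
  · exact Ψ.map_b q x
  · simp [Ψ.map_b' q x]

theorem map_horiz (p q : ℕ) (x : X q) :
    Ψ.equiv q (A.horiz p q x) = B.horiz p q (Ψ.equiv q x) := by
  unfold horiz
  split_ifs
  · simp [Ψ.map_lam q x]
  · exact Ψ.map_norm q x

/-- The isomorphism induced on the total complex in degree `n`. -/
def totEquiv (n : ℕ) : (∀ q : Fin (n + 1), X q) ≃ₗ[k] (∀ q : Fin (n + 1), Y q) :=
  LinearEquiv.piCongrRight fun q : Fin (n + 1) => Ψ.equiv q

theorem totEquiv_totD (n : ℕ) (z : ∀ q : Fin (n + 1), X q) :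
    Ψ.totEquiv (n + 1) (A.totD n z) = B.totD n (Ψ.totEquiv n z) := by
  funext q
  change Ψ.equiv q (A.totD n z q) = B.totD n (Ψ.totEquiv n z) q
  simp only [totD, LinearMap.pi_apply, LinearMap.add_apply, map_add]
  congr 1
  · refine Fin.cases ?_ (fun j => ?_) q
    · exact map_zero (Ψ.equiv 0)
    · exact Ψ.map_vert (n - j) j (z j)
  · split_ifs with h
    · exact Ψ.map_horiz (n - q) q (z ⟨q, h⟩)
    · exact map_zero (Ψ.equiv q)

theorem totEquiv_mem_cocycles (n : ℕ) (z : ∀ q : Fin (n + 1), X q) :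
    Ψ.totEquiv n z ∈ B.cocycles n ↔ z ∈ A.cocycles n := by
  rw [cocycles, cocycles, LinearMap.mem_ker, LinearMap.mem_ker, ← totEquiv_totD]
  exact LinearEquiv.map_eq_zero_iff _

theorem totEquiv_mem_coboundaries : ∀ (n : ℕ) (z : ∀ q : Fin (n + 1), X q),
    Ψ.totEquiv n z ∈ B.coboundaries n ↔ z ∈ A.coboundaries n
  | 0, z => LinearEquiv.map_eq_zero_iff (Ψ.totEquiv 0)
  | n + 1, z => by
    constructor
    · rintro ⟨y, hy⟩
      refine ⟨(Ψ.totEquiv n).symm y, (Ψ.totEquiv (n + 1)).injective ?_⟩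
      rw [totEquiv_totD, LinearEquiv.apply_symm_apply, hy]
    · rintro ⟨y, rfl⟩
      exact ⟨Ψ.totEquiv n y, (Ψ.totEquiv_totD n y).symm⟩

/-- The isomorphism induced on cocycles. -/
def cocyclesEquiv (n : ℕ) : A.cocycles n ≃ₗ[k] B.cocycles n :=
  (Ψ.totEquiv n).ofSubmodules _ _ <| by
    ext y
    obtain ⟨z, rfl⟩ := (Ψ.totEquiv n).surjective y
    simp [totEquiv_mem_cocycles]

/-- The isomorphism induced on cyclic cohomology. -/
def hcEquiv (n : ℕ) : A.HC n ≃ₗ[k] B.HC n :=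
  Submodule.Quotient.equiv _ _ (Ψ.cocyclesEquiv n) <| by
    ext y
    obtain ⟨z, rfl⟩ := (Ψ.cocyclesEquiv n).surjective y
    rw [Submodule.mem_map_equiv, LinearEquiv.symm_apply_apply]
    exact (Ψ.totEquiv_mem_coboundaries n z.1).symm

end Iso

end CocyclicOps

/-! ### Pure tensors -/

section PureTensors

variable (k : Type*) [Field k] {C : Type u} [AddCommGroup C] [Module k C]

/-- The pure tensor `f 0 ⊗ ⋯ ⊗ f n` in `C^{⊗(n+1)}`; the values of `f` beyond `n` are ignored,
which keeps the reindexing of the operators free of casts. -/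
def tens : ∀ n : ℕ, (ℕ → C) → iter k C C n
  | 0, f => iterZero.symm (f 0)
  | n + 1, f => (iterSucc n).symm (tens n f ⊗ₜ f (n + 1))

theorem tens_zero (f : ℕ → C) : tens k 0 f = iterZero.symm (f 0) := rfl

theorem tens_succ (n : ℕ) (f : ℕ → C) :
    tens k (n + 1) f = (iterSucc n).symm (tens k n f ⊗ₜ f (n + 1)) := rfl

variable {k}

theorem tens_congr {f g : ℕ → C} : ∀ {n : ℕ}, (∀ i ≤ n, f i = g i) → tens k n f = tens k n g
  | 0, h => by rw [tens_zero, tens_zero, h 0 le_rfl]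
  | n + 1, h => by
    rw [tens_succ, tens_succ, h (n + 1) le_rfl, tens_congr fun i hi => h i (by omega)]

/-- Linear maps out of `iter k V M (n + 1)` are determined on elements `x ⊗ v`. -/
theorem iter_succ_ext {V M : Type u} [AddCommGroup V] [Module k V] [AddCommGroup M] [Module k M]
    {P : Type*} [AddCommMonoid P] [Module k P] {n : ℕ} {F G : iter k V M (n + 1) →ₗ[k] P}
    (h : ∀ x v, F ((iterSucc n).symm (x ⊗ₜ v)) = G ((iterSucc n).symm (x ⊗ₜ v))) : F = G := by
  have : F ∘ₗ (iterSucc n).symm.toLinearMap = G ∘ₗ (iterSucc n).symm.toLinearMap :=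
    TensorProduct.ext' h
  ext x
  simpa using LinearMap.congr_fun this (iterSucc n x)

/-- Linear maps out of `C^{⊗(n+1)}` are determined on pure tensors. -/
theorem tens_ext {P : Type*} [AddCommMonoid P] [Module k P] :
    ∀ {n : ℕ} {F G : iter k C C n →ₗ[k] P}, (∀ f, F (tens k n f) = G (tens k n f)) → F = G
  | 0, F, G, h => by
    ext x
    exact h fun _ => iterZero x
  | n + 1, F, G, h => iter_succ_ext fun x v => by
    have : F ∘ₗ (iterSucc n).symm.toLinearMap ∘ₗ (TensorProduct.mk k _ C).flip v =
        G ∘ₗ (iterSucc n).symm.toLinearMap ∘ₗ (TensorProduct.mk k _ C).flip v := by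
      refine tens_ext fun f => ?_
      have := h (Function.update f (n + 1) v)
      rw [tens_succ, Function.update_self, tens_congr (g := f)] at this
      · exact this
      · intro i hi
        rw [Function.update_of_ne (by omega)]
    exact LinearMap.congr_fun this x

theorem tens_update_add (f : ℕ → C) (i : ℕ) (a b : C) : ∀ {n : ℕ}, i ≤ n →
    tens k n (Function.update f i (a + b)) =
      tens k n (Function.update f i a) + tens k n (Function.update f i b)
  | 0, h => by
    obtain rfl : i = 0 := by omega
    simp [tens_zero]
  | n + 1, h => by
    rcases Nat.lt_or_ge n i with h' | h'
    · obtain rfl : i = n + 1 := by omega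
      have (c : C) : tens k n (Function.update f (n + 1) c) = tens k n f :=
        tens_congr fun j hj => Function.update_of_ne (by omega) _ _
      simp only [tens_succ, Function.update_self, this, TensorProduct.tmul_add, map_add]
    · have (c : C) : Function.update f i c (n + 1) = f (n + 1) :=
        Function.update_of_ne (by omega) _ _
      simp only [tens_succ, this, tens_update_add f i a b h', TensorProduct.add_tmul, map_add]

theorem tens_update_smul (f : ℕ → C) (i : ℕ) (r : k) (a : C) : ∀ {n : ℕ}, i ≤ n →
    tens k n (Function.update f i (r • a)) = r • tens k n (Function.update f i a)
  | 0, h => by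
    obtain rfl : i = 0 := by omega
    simp [tens_zero]
  | n + 1, h => by
    rcases Nat.lt_or_ge n i with h' | h'
    · obtain rfl : i = n + 1 := by omega
      have (c : C) : tens k n (Function.update f (n + 1) c) = tens k n f :=
        tens_congr fun j hj => Function.update_of_ne (by omega) _ _
      simp only [tens_succ, Function.update_self, this, TensorProduct.tmul_smul, map_smul]
    · have (c : C) : Function.update f i c (n + 1) = f (n + 1) :=
        Function.update_of_ne (by omega) _ _
      simp only [tens_succ, this, tens_update_smul f i r a h', ← TensorProduct.smul_tmul', map_smul]

/-- The pure tensor `f 0 ⊗ ⋯ ⊗ c ⊗ ⋯ ⊗ f n`, with `c` in place `i`, as a linear function of `c`. -/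
def tensAt (f : ℕ → C) {i n : ℕ} (h : i ≤ n) : C →ₗ[k] iter k C C n where
  toFun c := tens k n (Function.update f i c)
  map_add' a b := tens_update_add f i a b h
  map_smul' r a := tens_update_smul f i r a h

end PureTensors

/-! ### Recursive description of the operators on `C^{⊗(n+1)}` -/

namespace ModuleCoalgebra

variable {k : Type*} [Field k] {C : Type u} [AddCommGroup C] [Module k C] [Coalgebra k C]

section Recursion

theorem comulAt_succ_of_le {n i : ℕ} (h : i ≤ n) (x : iter k C C n) (c : C) :
    comulAt (n + 1) i ((iterSucc n).symm (x ⊗ₜ c)) =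
      (iterSucc (n + 1)).symm (comulAt n i x ⊗ₜ c) := by
  simp [comulAt, h]

theorem counitAt_succ_of_le {n i : ℕ} (h : i ≤ n) (x : iter k C C (n + 1)) (c : C) :
    counitAt (n + 1) i ((iterSucc (n + 1)).symm (x ⊗ₜ c)) =
      (iterSucc n).symm (counitAt n i x ⊗ₜ c) := by
  simp [counitAt, h]

theorem counitAt_last : ∀ (n : ℕ) (x : iter k C C n) (c : C),
    counitAt n n ((iterSucc n).symm (x ⊗ₜ c)) = Coalgebra.counit (R := k) c • x
  | 0, x, c => by
    simp only [counitAt, LinearMap.comp_apply, LinearEquiv.coe_coe, LinearEquiv.apply_symm_apply,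
      LinearMap.lTensor_tmul, TensorProduct.rid_tmul]
  | n + 1, x, c => by
    simp only [counitAt, LinearMap.comp_apply, LinearEquiv.coe_coe, LinearEquiv.apply_symm_apply,
      LinearMap.lTensor_tmul, TensorProduct.rid_tmul, if_neg (Nat.not_succ_le_self n)]

/-- The right `C`-coaction on `C^{⊗(n+1)}` through the last factor. -/
def lastCoact (n : ℕ) : iter k C C n →ₗ[k] iter k C C n ⊗[k] C :=
  (iterSucc n).toLinearMap ∘ₗ comulAt n n

theorem comulAt_self (n : ℕ) (x : iter k C C n) :
    comulAt n n x = (iterSucc n).symm (lastCoact n x) := by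
  simp [lastCoact]

theorem lastCoact_zero (x : iter k C C 0) :
    lastCoact 0 x = (iterZero.symm.toLinearMap).rTensor C
      (Coalgebra.comul (R := k) (iterZero x : C)) := by
  simp [lastCoact, comulAt]

theorem lastCoact_succ (n : ℕ) (w : iter k C C n ⊗[k] C) :
    lastCoact (n + 1) ((iterSucc n).symm w) = ((iterSucc n).symm.toLinearMap).rTensor C
      ((TensorProduct.assoc k (iter k C C n) C C).symm
        ((Coalgebra.comul (R := k)).lTensor (iter k C C n) w)) := by
  simp [lastCoact, comulAt]

end Recursion

end ModuleCoalgebra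

/-! ### Right comodules -/

/-- `ρ : M → M ⊗ C` is a right coaction of the coalgebra `C` on `M`. -/
structure IsRightComodule {k C M : Type*} [Field k] [AddCommGroup C] [Module k C] [Coalgebra k C]
    [AddCommGroup M] [Module k M] (ρ : M →ₗ[k] M ⊗[k] C) : Prop where
  coassoc : ∀ m, TensorProduct.assoc k M C C (ρ.rTensor C (ρ m)) =
    (Coalgebra.comul (R := k)).lTensor M (ρ m)
  counit : ∀ m, TensorProduct.rid k M ((Coalgebra.counit (R := k)).lTensor M (ρ m)) = m

/-- The coaction on `N ⊗ C` through the second factor. -/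
def tensorCoact (k C N : Type*) [Field k] [AddCommGroup C] [Module k C] [Coalgebra k C]
    [AddCommGroup N] [Module k N] : N ⊗[k] C →ₗ[k] (N ⊗[k] C) ⊗[k] C :=
  (TensorProduct.assoc k N C C).symm.toLinearMap ∘ₗ
    (Coalgebra.comul (R := k) (A := C)).lTensor N

namespace IsRightComodule

variable {k C M N : Type*} [Field k] [AddCommGroup C] [Module k C] [Coalgebra k C]
    [AddCommGroup M] [Module k M] [AddCommGroup N] [Module k N]

theorem self : IsRightComodule (Coalgebra.comul (R := k) (A := C)) where
  coassoc m := Coalgebra.coassoc_apply m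
  counit m := by simp

theorem tensor : IsRightComodule (tensorCoact k C N) where
  coassoc w := by
    induction w with
    | zero => simp
    | add x y hx hy => simp only [map_add, hx, hy]
    | tmul x c =>
      have h₁ : ∀ u : C ⊗[k] C, TensorProduct.assoc k (N ⊗[k] C) C C
          ((tensorCoact k C N).rTensor C ((TensorProduct.assoc k N C C).symm (x ⊗ₜ u))) =
          (TensorProduct.assoc k N C (C ⊗[k] C)).symm (x ⊗ₜ (TensorProduct.assoc k C C C
            ((Coalgebra.comul (R := k)).rTensor C u))) := fun u => by
        induction u with
        | zero => simp
        | add x y hx hy => simp only [map_add, TensorProduct.tmul_add, hx, hy]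
        | tmul a b =>
          simp only [TensorProduct.assoc_symm_tmul, LinearMap.rTensor_tmul, tensorCoact,
            LinearMap.comp_apply, LinearMap.lTensor_tmul, LinearEquiv.coe_coe]
          generalize (Coalgebra.comul (R := k) a) = v
          induction v with
          | zero => simp
          | add x y hx hy => simp only [map_add, TensorProduct.tmul_add, TensorProduct.add_tmul,
              hx, hy]
          | tmul p q => simp
      have h₂ : ∀ u : C ⊗[k] C, (Coalgebra.comul (R := k)).lTensor (N ⊗[k] C)
              ((TensorProduct.assoc k N C C).symm (x ⊗ₜ u)) =
          (TensorProduct.assoc k N C (C ⊗[k] C)).symm (x ⊗ₜ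
            ((Coalgebra.comul (R := k)).lTensor C u)) := fun u => by
        induction u with
        | zero => simp
        | add x y hx hy => simp only [map_add, TensorProduct.tmul_add, hx, hy]
        | tmul a b => simp
      simp only [tensorCoact, LinearMap.comp_apply, LinearMap.lTensor_tmul,
        LinearEquiv.coe_coe] at h₁ h₂ ⊢
      rw [h₁, h₂, Coalgebra.coassoc_apply]
  counit w := by
    induction w with
    | zero => simp
    | add x y hx hy => simp only [map_add, hx, hy]
    | tmul x c =>
      have h : ∀ u : C ⊗[k] C, TensorProduct.rid k (N ⊗[k] C)
          ((Coalgebra.counit (R := k)).lTensor _ ((TensorProduct.assoc k N C C).symm (x ⊗ₜ u))) =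
          x ⊗ₜ TensorProduct.rid k C ((Coalgebra.counit (R := k)).lTensor _ u) := fun u => by
        induction u with
        | zero => simp
        | add x y hx hy => simp only [map_add, TensorProduct.tmul_add, hx, hy]
        | tmul a b => simp
      simp only [tensorCoact, LinearMap.comp_apply, LinearMap.lTensor_tmul, LinearEquiv.coe_coe]
      rw [h]
      simp

/-- The comodule axioms descend along surjective colinear maps. -/
theorem of_surjective {ρ : M →ₗ[k] M ⊗[k] C} {σ : N →ₗ[k] N ⊗[k] C} (hρ : IsRightComodule ρ)
    (f : M →ₗ[k] N) (hf : Function.Surjective f) (h : ∀ m, σ (f m) = f.rTensor C (ρ m)) :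
    IsRightComodule σ where
  coassoc n := by
    obtain ⟨m, rfl⟩ := hf n
    have h₁ : ∀ w : M ⊗[k] C, TensorProduct.assoc k N C C (σ.rTensor C (f.rTensor C w)) =
        f.rTensor _ (TensorProduct.assoc k M C C (ρ.rTensor C w)) := fun w => by
      induction w with
      | zero => simp
      | add x y hx hy => simp only [map_add, hx, hy]
      | tmul m c =>
        simp only [LinearMap.rTensor_tmul, h]
        generalize ρ m = v
        induction v with
        | zero => simp
        | add x y hx hy => simp only [map_add, TensorProduct.add_tmul, hx, hy]
        | tmul p q => simp
    rw [h, h₁, hρ.coassoc]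
    exact LinearMap.congr_fun ((LinearMap.rTensor_comp_lTensor ..).trans
      (LinearMap.lTensor_comp_rTensor ..).symm) (ρ m)
  counit n := by
    obtain ⟨m, rfl⟩ := hf n
    have h₁ : ∀ w : M ⊗[k] C, TensorProduct.rid k N
        ((Coalgebra.counit (R := k)).lTensor N (f.rTensor C w)) =
        f (TensorProduct.rid k M ((Coalgebra.counit (R := k)).lTensor M w)) := fun w => by
      induction w with
      | zero => simp
      | add x y hx hy => simp only [map_add, hx, hy]
      | tmul m c => simp
    rw [h, h₁, hρ.counit]

theorem tensorCoact_coact {ρ : M →ₗ[k] M ⊗[k] C}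
    (hρ : IsRightComodule ρ) (m : M) : tensorCoact k C M (ρ m) = ρ.rTensor C (ρ m) := by
  rw [tensorCoact, LinearMap.comp_apply, ← hρ.coassoc, LinearEquiv.coe_coe,
    LinearEquiv.symm_apply_apply]

theorem injective {ρ : M →ₗ[k] M ⊗[k] C}
    (hρ : IsRightComodule ρ) : Function.Injective ρ := fun x y h => by
  rw [← hρ.counit x, h, hρ.counit]

end IsRightComodule

/-! ### The cocyclic module of a coalgebra -/

namespace ModuleCoalgebra

variable {k : Type*} [Field k] {C : Type u} [AddCommGroup C] [Module k C]

theorem rotate_succ_succ (n : ℕ) (x : iter k C C (n + 1)) (c : C) :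
    rotate (n + 2) ((iterSucc (n + 1)).symm (x ⊗ₜ c)) = (iterSucc (n + 1)).symm
      (((iterSucc n).symm.toLinearMap).rTensor C (TensorProduct.rightComm k (iter k C C n) C C
        (iterSucc n (rotate (n + 1) x) ⊗ₜ c))) := by
  simp [rotate]

theorem rotate_iterSucc (n : ℕ) (w : iter k C C (n + 1) ⊗[k] C) :
    rotate (n + 2) ((iterSucc (n + 1)).symm w) = (iterSucc (n + 1)).symm
      (((iterSucc n).symm.toLinearMap).rTensor C (TensorProduct.rightComm k (iter k C C n) C C
        (((iterSucc n).toLinearMap ∘ₗ rotate (n + 1)).rTensor C w))) := by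
  induction w with
  | zero => simp
  | add x y hx hy => simp only [map_add, hx, hy]
  | tmul x c => rw [rotate_succ_succ]; rfl

theorem rotate_one (x : iter k C C 0) (c : C) :
    rotate 1 ((iterSucc 0).symm (x ⊗ₜ c)) =
      (iterSucc 0).symm (iterZero.symm c ⊗ₜ (iterZero x : C)) := by
  simp [rotate]

theorem rotate_tens (f : ℕ → C) : ∀ n : ℕ,
    rotate n (tens k n f) = tens k n fun j => if j < n then f (j + 1) else f 0
  | 0 => by simp [rotate, tens_zero]
  | 1 => by
    rw [tens_succ, tens_zero, rotate_one, tens_succ, tens_zero]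
    simp
  | n + 2 => by
    rw [tens_succ, rotate_succ_succ, rotate_tens f (n + 1), tens_succ k n,
      LinearEquiv.apply_symm_apply, TensorProduct.rightComm_tmul, LinearMap.rTensor_tmul,
      tens_succ k (n + 1), tens_succ k n, LinearEquiv.coe_coe]
    simp only [lt_irrefl, if_false, Nat.lt_succ_self, if_true]
    congr 4
    refine tens_congr fun i hi => ?_
    rw [if_pos (by omega), if_pos (by omega)]

variable [Coalgebra k C]

theorem isRightComodule_lastCoact : ∀ n : ℕ, IsRightComodule (lastCoact (k := k) (C := C) n)
  | 0 => IsRightComodule.self.of_surjective iterZero.symm.toLinearMap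
      iterZero.symm.surjective fun m => by rw [lastCoact_zero]; simp
  | n + 1 => IsRightComodule.tensor.of_surjective (iterSucc n).symm.toLinearMap
      (iterSucc n).symm.surjective fun m => by
        rw [LinearEquiv.coe_coe, lastCoact_succ]; rfl

/-- `c₀ ⊗ ⋯ ⊗ cₙ₊₁ ↦ ε(c₀) c₁ ⊗ ⋯ ⊗ cₙ₊₁`. -/
def counitFirst : ∀ n : ℕ, iter k C C (n + 1) →ₗ[k] iter k C C n
  | 0 => iterZero.symm.toLinearMap ∘ₗ (TensorProduct.lid k C).toLinearMap ∘ₗ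
      ((Coalgebra.counit (R := k)) ∘ₗ iterZero.toLinearMap).rTensor C ∘ₗ
      (iterSucc 0).toLinearMap
  | n + 1 => (iterSucc n).symm.toLinearMap ∘ₗ (counitFirst n).rTensor C ∘ₗ
      (iterSucc (n + 1)).toLinearMap

theorem counitFirst_zero (x : iter k C C 0) (c : C) :
    counitFirst 0 ((iterSucc 0).symm (x ⊗ₜ c)) =
      Coalgebra.counit (R := k) (iterZero x : C) • iterZero.symm c := by
  simp [counitFirst]

theorem counitFirst_succ (n : ℕ) (x : iter k C C (n + 1)) (c : C) :
    counitFirst (n + 1) ((iterSucc (n + 1)).symm (x ⊗ₜ c)) =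
      (iterSucc n).symm (counitFirst n x ⊗ₜ c) := by
  simp [counitFirst]

theorem counitFirst_comulAt_zero : ∀ (n : ℕ) (x : iter k C C n),
    counitFirst n (comulAt n 0 x) = x
  | 0, x => by
    have h : ∀ w : C ⊗[k] C, counitFirst 0 ((iterSucc 0).symm
        ((iterZero.symm.toLinearMap).rTensor C w)) = iterZero.symm (TensorProduct.lid k C
          ((Coalgebra.counit (R := k)).rTensor C w)) := fun w => by
      induction w with
      | zero => simp
      | add x y hx hy => simp only [map_add, hx, hy]
      | tmul m c => simp [counitFirst_zero]
    rw [comulAt_self, lastCoact_zero, h]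
    simp
  | n + 1, x => by
    refine LinearMap.congr_fun (f := counitFirst (n + 1) ∘ₗ comulAt (n + 1) 0)
      (g := LinearMap.id) (iter_succ_ext fun x c => ?_) x
    rw [LinearMap.comp_apply, comulAt_succ_of_le (Nat.zero_le n), counitFirst_succ,
      counitFirst_comulAt_zero, LinearMap.id_apply]

/-- Delete the entry `i` of a sequence. -/
def drop (i : ℕ) (f : ℕ → C) : ℕ → C := fun j => if j < i then f j else f (j + 1)

/-- Replace the entry `i` of a sequence by the two entries `a, b`. -/
def split (i : ℕ) (a b : C) (f : ℕ → C) : ℕ → C :=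
  fun j => if j < i then f j else if j = i then a else if j = i + 1 then b else f (j - 1)

theorem counitAt_tens (f : ℕ → C) : ∀ {n i : ℕ}, i ≤ n →
    counitAt n i (tens k (n + 1) f) =
      Coalgebra.counit (R := k) (f (i + 1)) • tens k n (drop (i + 1) f) := by
  intro n
  induction n with
  | zero =>
    intro i h
    obtain rfl : i = 0 := by omega
    rw [tens_succ, counitAt_last, tens_zero, tens_zero]
    simp [drop]
  | succ n ih =>
    intro i h
    rcases Nat.lt_or_ge n i with h' | h'
    · obtain rfl : i = n + 1 := by omega
      rw [tens_succ, counitAt_last]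
      congr 1
      refine tens_congr fun j hj => ?_
      rw [drop, if_pos (by omega)]
    · rw [tens_succ, counitAt_succ_of_le h', ih h', tens_succ k n]
      simp only [← TensorProduct.smul_tmul', map_smul]
      rw [drop, if_neg (by omega)]

theorem counitFirst_tens (f : ℕ → C) : ∀ n : ℕ, counitFirst n (tens k (n + 1) f) =
    Coalgebra.counit (R := k) (f 0) • tens k n fun j => f (j + 1)
  | 0 => by rw [tens_succ, counitFirst_zero, tens_zero, tens_zero, LinearEquiv.apply_symm_apply]
  | n + 1 => by
    rw [tens_succ, counitFirst_succ, counitFirst_tens f n, tens_succ k n]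
    simp only [← TensorProduct.smul_tmul', map_smul]

theorem comulAt_tens {ι : Type*} (s : Finset ι) (a b : ι → C) (f : ℕ → C) : ∀ {n i : ℕ}, i ≤ n →
    Coalgebra.comul (R := k) (f i) = ∑ j ∈ s, a j ⊗ₜ[k] b j →
    comulAt n i (tens k n f) = ∑ j ∈ s, tens k (n + 1) (split i (a j) (b j) f) := by
  intro n
  induction n with
  | zero =>
    intro i h hf
    obtain rfl : i = 0 := by omega
    rw [comulAt_self, lastCoact_zero, tens_zero, LinearEquiv.apply_symm_apply, hf]
    simp [tens_succ, tens_zero, split]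
  | succ n ih =>
    intro i h hf
    rcases Nat.lt_or_ge n i with h' | h'
    · obtain rfl : i = n + 1 := by omega
      rw [comulAt_self, tens_succ, lastCoact_succ, LinearMap.lTensor_tmul, hf,
        TensorProduct.tmul_sum]
      simp only [map_sum]
      refine Finset.sum_congr rfl fun j _ => ?_
      rw [TensorProduct.assoc_symm_tmul, LinearMap.rTensor_tmul, tens_succ, tens_succ,
        LinearEquiv.coe_coe]
      rw [tens_congr (f := f) (g := split (n + 1) (a j) (b j) f)
        fun i hi => by rw [split, if_pos (by omega)]]
      simp [split]
    · rw [tens_succ, comulAt_succ_of_le h', ih h' hf, TensorProduct.sum_tmul, map_sum]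
      refine Finset.sum_congr rfl fun j _ => ?_
      rw [tens_succ k (n + 1)]
      have : split i (a j) (b j) f (n + 1 + 1) = f (n + 1) := by
        rw [split, if_neg (by omega), if_neg (by omega), if_neg (by omega), Nat.add_sub_cancel]
      rw [this]

end ModuleCoalgebra

namespace ModuleCoalgebra

section Rotate

variable {k : Type*} [Field k] {C : Type u} [AddCommGroup C] [Module k C]

theorem rotate_pow_tens (n : ℕ) (f : ℕ → C) (m : ℕ) :
    (rotate n ^ m) (tens k n f) = tens k n fun j => f ((j + m) % (n + 1)) := by
  induction m with
  | zero =>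
    refine tens_congr fun i hi => ?_
    rw [Nat.add_zero, Nat.mod_eq_of_lt (by omega)]
  | succ m ih =>
    rw [pow_succ', Module.End.mul_apply, ih, rotate_tens]
    refine tens_congr fun i hi => ?_
    split_ifs with h
    · congr 2
      omega
    · obtain rfl : i = n := by omega
      rw [show i + (m + 1) = m + (i + 1) by omega, Nat.add_mod_right, Nat.zero_add]

theorem rotate_pow (n : ℕ) : rotate (k := k) (C := C) n ^ (n + 1) = 1 :=
  tens_ext fun f => by
    rw [rotate_pow_tens, Module.End.one_apply]
    refine tens_congr fun i hi => ?_
    rw [Nat.add_mod_right, Nat.mod_eq_of_lt (by omega)]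

end Rotate

variable {k : Type*} [Field k] {C : Type u} [AddCommGroup C] [Module k C] [Coalgebra k C]

theorem comulAt_tens_repr (f : ℕ → C) {n i : ℕ} (h : i ≤ n) {c : C} {ι : Type*}
    (r : Coalgebra.Repr k c ι)
    (hc : f i = c) :
    comulAt n i (tens k n f) =
      ∑ j ∈ r.index, tens k (n + 1) (split i (r.left j) (r.right j) f) :=
  comulAt_tens _ _ _ f h (by rw [hc, r.eq])

theorem comulAt_comulAt : ∀ {n i j : ℕ}, i < j → j ≤ n + 1 → ∀ x : iter k C C n,
    comulAt (n + 1) j (comulAt n i x) = comulAt (n + 1) i (comulAt n (j - 1) x) := by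
  -- the coassociativity of the coaction on the last factor
  have key (n : ℕ) (x : iter k C C n) :
      comulAt (n + 1) (n + 1) (comulAt n n x) = comulAt (n + 1) n (comulAt n n x) := by
    have h (w : iter k C C n ⊗[k] C) : comulAt (n + 1) n ((iterSucc n).symm w) =
        (iterSucc (n + 1)).symm (((iterSucc n).symm.toLinearMap).rTensor C
          ((lastCoact n).rTensor C w)) := by
      induction w with
      | zero => simp
      | add x y hx hy => simp only [map_add, hx, hy]
      | tmul x c => rw [comulAt_succ_of_le le_rfl, comulAt_self]; rfl
    rw [comulAt_self n, h, comulAt_self, lastCoact_succ, ← (isRightComodule_lastCoact n).coassoc,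
      LinearEquiv.symm_apply_apply]
  intro n
  induction n with
  | zero =>
    intro i j h₁ h₂ x
    obtain rfl : j = 1 := by omega
    obtain rfl : i = 0 := by omega
    exact key 0 x
  | succ n ih =>
    intro i j h₁ h₂ x
    rcases Nat.lt_or_ge i (n + 1) with hi | hi
    · refine LinearMap.congr_fun (f := comulAt (n + 2) j ∘ₗ comulAt (n + 1) i)
        (g := comulAt (n + 2) i ∘ₗ comulAt (n + 1) (j - 1)) (iter_succ_ext fun x c => ?_) x
      rw [LinearMap.comp_apply, LinearMap.comp_apply, comulAt_succ_of_le (by omega)]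
      rcases Nat.lt_or_ge (n + 1) j with hj | hj
      · obtain rfl : j = n + 2 := by omega
        rw [show n + 2 - 1 = n + 1 from rfl, comulAt_self, comulAt_self,
          lastCoact_succ, lastCoact_succ,
          LinearMap.lTensor_tmul, LinearMap.lTensor_tmul]
        generalize Coalgebra.comul (R := k) c = w
        induction w with
        | zero => simp
        | add x y hx hy => simp only [map_add, TensorProduct.tmul_add, hx, hy]
        | tmul a b =>
          rw [TensorProduct.assoc_symm_tmul, TensorProduct.assoc_symm_tmul, LinearMap.rTensor_tmul,
            LinearMap.rTensor_tmul, comulAt_succ_of_le (by omega), LinearEquiv.coe_coe,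
            LinearEquiv.coe_coe, comulAt_succ_of_le (by omega)]
      · rw [comulAt_succ_of_le hj, comulAt_succ_of_le (by omega), ih h₁ hj,
          comulAt_succ_of_le (by omega)]
    · obtain rfl : i = n + 1 := by omega
      obtain rfl : j = n + 2 := by omega
      exact key (n + 1) x

theorem rotate_comulAt {n i : ℕ} (h₁ : 1 ≤ i) (h₂ : i ≤ n) (x : iter k C C n) :
    rotate (n + 1) (comulAt n i x) = comulAt n (i - 1) (rotate n x) := by
  refine LinearMap.congr_fun (f := rotate (n + 1) ∘ₗ comulAt n i)
    (g := comulAt n (i - 1) ∘ₗ rotate n) (tens_ext fun f => ?_) x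
  rw [LinearMap.comp_apply, LinearMap.comp_apply, comulAt_tens_repr f h₂ (ℛ k (f i)) rfl,
    rotate_tens, comulAt_tens_repr _ (by omega) (ℛ k (f i))
      (by rw [if_pos (by omega), Nat.sub_add_cancel h₁]), map_sum]
  refine Finset.sum_congr rfl fun j _ => ?_
  rw [rotate_tens]
  refine tens_congr fun m hm => ?_
  simp only [split]
  grind

theorem rotate_rotate_comulAt_zero (n : ℕ) (x : iter k C C n) :
    rotate (n + 1) (rotate (n + 1) (comulAt n 0 x)) = comulAt n n (rotate n x) := by
  refine LinearMap.congr_fun (f := rotate (n + 1) ∘ₗ rotate (n + 1) ∘ₗ comulAt n 0)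
    (g := comulAt n n ∘ₗ rotate n) (tens_ext fun f => ?_) x
  rw [LinearMap.comp_apply, LinearMap.comp_apply, LinearMap.comp_apply,
    comulAt_tens_repr f (Nat.zero_le n) (ℛ k (f 0)) rfl, rotate_tens,
    comulAt_tens_repr _ le_rfl (ℛ k (f 0)) (if_neg (lt_irrefl n)), map_sum, map_sum]
  refine Finset.sum_congr rfl fun j _ => ?_
  rw [rotate_tens, rotate_tens]
  refine tens_congr fun m hm => ?_
  simp only [split]
  grind

theorem counitAt_counitAt {n i j : ℕ} (h₁ : i ≤ j) (h₂ : j ≤ n) (x : iter k C C (n + 2)) :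
    counitAt n j (counitAt (n + 1) i x) = counitAt n i (counitAt (n + 1) (j + 1) x) := by
  refine LinearMap.congr_fun (f := counitAt n j ∘ₗ counitAt (n + 1) i)
    (g := counitAt n i ∘ₗ counitAt (n + 1) (j + 1)) (tens_ext fun f => ?_) x
  rw [LinearMap.comp_apply, LinearMap.comp_apply, counitAt_tens f (by omega),
    counitAt_tens f (by omega), map_smul, map_smul, counitAt_tens _ h₂, counitAt_tens _ (by omega),
    smul_smul, smul_smul, mul_comm]
  have e₁ : drop (i + 1) f (j + 1) = f (j + 1 + 1) := by rw [drop, if_neg (by omega)]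
  have e₂ : drop (j + 1 + 1) f (i + 1) = f (i + 1) := by rw [drop, if_pos (by omega)]
  rw [e₁, e₂]
  congr 1
  refine tens_congr fun m hm => ?_
  simp only [drop]
  grind

theorem counitAt_comulAt_of_lt {n i j : ℕ} (h₁ : i < j) (h₂ : j ≤ n + 1)
    (x : iter k C C (n + 1)) :
    counitAt (n + 1) j (comulAt (n + 1) i x) = comulAt n i (counitAt n (j - 1) x) := by
  refine LinearMap.congr_fun (f := counitAt (n + 1) j ∘ₗ comulAt (n + 1) i)
    (g := comulAt n i ∘ₗ counitAt n (j - 1)) (tens_ext fun f => ?_) x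
  rw [LinearMap.comp_apply, LinearMap.comp_apply, comulAt_tens_repr f (by omega) (ℛ k (f i)) rfl,
    counitAt_tens f (by omega), map_smul, comulAt_tens_repr _ (by omega) (ℛ k (f i))
      (if_pos (by omega)), map_sum, Finset.smul_sum]
  refine Finset.sum_congr rfl fun l _ => ?_
  rw [counitAt_tens _ (by omega)]
  refine congrArg₂ (· • ·) (congrArg _ ?_) (tens_congr fun m hm => ?_)
  · simp only [split]
    grind
  · simp only [split, drop]
    grind

theorem counitAt_comulAt_of_gt {n i j : ℕ} (h₁ : j + 1 < i) (h₂ : i ≤ n + 1)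
    (x : iter k C C (n + 1)) :
    counitAt (n + 1) j (comulAt (n + 1) i x) = comulAt n (i - 1) (counitAt n j x) := by
  refine LinearMap.congr_fun (f := counitAt (n + 1) j ∘ₗ comulAt (n + 1) i)
    (g := comulAt n (i - 1) ∘ₗ counitAt n j) (tens_ext fun f => ?_) x
  rw [LinearMap.comp_apply, LinearMap.comp_apply, comulAt_tens_repr f (by omega) (ℛ k (f i)) rfl,
    counitAt_tens f (by omega), map_smul, comulAt_tens_repr _ (by omega) (ℛ k (f i))
      (by simp only [drop]; grind), map_sum, Finset.smul_sum]
  refine Finset.sum_congr rfl fun l _ => ?_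
  rw [counitAt_tens _ (by omega)]
  refine congrArg₂ (· • ·) (congrArg _ ?_) (tens_congr fun m hm => ?_)
  · simp only [split]
    grind
  · simp only [split, drop]
    grind

theorem counitAt_comulAt_self {n j : ℕ} (h : j ≤ n) (x : iter k C C n) :
    counitAt n j (comulAt n j x) = x := by
  refine LinearMap.congr_fun (f := counitAt n j ∘ₗ comulAt n j)
    (g := LinearMap.id) (tens_ext fun f => ?_) x
  have e : ∑ l ∈ (ℛ k (f j)).index,
      Coalgebra.counit (R := k) ((ℛ k (f j)).right l) •
        (ℛ k (f j)).left l = f j := by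
    have := congrArg (TensorProduct.rid k C)
      (Coalgebra.sum_tmul_counit_eq (R := k) (ℛ k (f j)))
    simpa only [map_sum, TensorProduct.rid_tmul, TensorProduct.lid_tmul, one_smul] using this
  rw [LinearMap.comp_apply, LinearMap.id_apply, comulAt_tens_repr f h (ℛ k (f j)) rfl, map_sum]
  trans tensAt f h (f j)
  · conv_rhs => rw [← e]
    rw [map_sum]
    refine Finset.sum_congr rfl fun l _ => ?_
    rw [counitAt_tens _ h, map_smul]
    refine congrArg₂ (· • ·) (congrArg _ ?_) (tens_congr fun m hm => ?_)
    · simp [split]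
    · simp only [split, drop, Function.update_apply]
      grind
  · exact congrArg (tens k n) (Function.update_eq_self _ f)

theorem counitAt_comulAt_succ {n j : ℕ} (h : j + 1 ≤ n) (x : iter k C C n) :
    counitAt n j (comulAt n (j + 1) x) = x := by
  refine LinearMap.congr_fun (f := counitAt n j ∘ₗ comulAt n (j + 1))
    (g := LinearMap.id) (tens_ext fun f => ?_) x
  have e : ∑ l ∈ (ℛ k (f (j + 1))).index,
      Coalgebra.counit (R := k) ((ℛ k (f (j + 1))).left l) •
        (ℛ k (f (j + 1))).right l = f (j + 1) := by
    have := congrArg (TensorProduct.lid k C)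
      (Coalgebra.sum_counit_tmul_eq (R := k) (ℛ k (f (j + 1))))
    simpa only [map_sum, TensorProduct.rid_tmul, TensorProduct.lid_tmul, one_smul] using this
  rw [LinearMap.comp_apply, LinearMap.id_apply, comulAt_tens_repr f h (ℛ k (f (j + 1))) rfl,
    map_sum]
  trans tensAt f h (f (j + 1))
  · conv_rhs => rw [← e]
    rw [map_sum]
    refine Finset.sum_congr rfl fun l _ => ?_
    rw [counitAt_tens _ (by omega), map_smul]
    refine congrArg₂ (· • ·) (congrArg _ ?_) (tens_congr fun m hm => ?_)
    · simp [split]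
    · simp only [split, drop, Function.update_apply]
      grind
  · exact congrArg (tens k n) (Function.update_eq_self _ f)

theorem rotate_counitAt {n i : ℕ} (h₁ : 1 ≤ i) (h₂ : i ≤ n) (x : iter k C C (n + 1)) :
    rotate n (counitAt n i x) = counitAt n (i - 1) (rotate (n + 1) x) := by
  refine LinearMap.congr_fun (f := rotate n ∘ₗ counitAt n i)
    (g := counitAt n (i - 1) ∘ₗ rotate (n + 1)) (tens_ext fun f => ?_) x
  rw [LinearMap.comp_apply, LinearMap.comp_apply, counitAt_tens f h₂, map_smul, rotate_tens,
    rotate_tens, counitAt_tens _ (by omega), if_pos (by omega), Nat.sub_add_cancel h₁]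
  congr 1
  refine tens_congr fun m hm => ?_
  simp only [drop]
  grind

theorem rotate_counitAt_zero (n : ℕ) (x : iter k C C (n + 1)) :
    rotate n (counitAt n 0 x) = counitAt n n (rotate (n + 1) (rotate (n + 1) x)) := by
  refine LinearMap.congr_fun (f := rotate n ∘ₗ counitAt n 0)
    (g := counitAt n n ∘ₗ rotate (n + 1) ∘ₗ rotate (n + 1)) (tens_ext fun f => ?_) x
  rw [LinearMap.comp_apply, LinearMap.comp_apply, LinearMap.comp_apply,
    counitAt_tens f (Nat.zero_le n), map_smul, rotate_tens,
    rotate_tens, rotate_tens, counitAt_tens _ le_rfl]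
  congr 1
  · simp
  refine tens_congr fun m hm => ?_
  simp only [drop]
  grind

theorem counitAt_last_rotate (n : ℕ) (x : iter k C C (n + 1)) :
    counitAt n n (rotate (n + 1) x) = counitFirst n x := by
  refine LinearMap.congr_fun (f := counitAt n n ∘ₗ rotate (n + 1))
    (g := counitFirst n) (tens_ext fun f => ?_) x
  rw [LinearMap.comp_apply, rotate_tens, counitAt_tens _ le_rfl, counitFirst_tens]
  congr 1
  · simp
  refine tens_congr fun m hm => ?_
  simp only [drop]
  grind

/-- Dropping the first factor of the last coface of `x` rotates `x`. -/
theorem counitFirst_rotate_comulAt_zero (n : ℕ) (x : iter k C C n) :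
    counitFirst n (rotate (n + 1) (comulAt n 0 x)) = rotate n x := by
  rw [← counitAt_last_rotate, ← rotate_counitAt_zero, counitAt_comulAt_self (Nat.zero_le n)]

variable (k C) in
/-- The cocyclic module of the coalgebra `C`, with components `C^{⊗(n+1)}`. -/
def coalgebraCocyclic : CocyclicOps k (fun n => iter k C C n) where
  δ n i := coface n i
  σ n i := counitAt n i
  τ n := rotate n

/-- The relations that involve the last coface `t d₀` follow from the others. -/
theorem isCocyclic_coalgebraCocyclic : (coalgebraCocyclic k C).IsCocyclic where
  δ_δ n i j h₁ h₂ := LinearMap.ext fun x => by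
    simp only [coalgebraCocyclic, LinearMap.comp_apply, coface]
    rcases Nat.lt_or_ge (n + 1) j with hj | hj
    · obtain rfl : j = n + 2 := by omega
      rw [if_neg (by omega), LinearMap.comp_apply, show n + 2 - 1 = n + 1 from rfl,
        if_neg (by omega : ¬ n + 1 ≤ n),
        LinearMap.comp_apply, if_pos (by omega : i ≤ n + 1)]
      rcases Nat.lt_or_ge n i with hi | hi
      · obtain rfl : i = n + 1 := by omega
        rw [if_neg (by omega), LinearMap.comp_apply, ← rotate_rotate_comulAt_zero,
          ← comulAt_comulAt Nat.zero_lt_one (by omega), rotate_comulAt le_rfl (by omega)]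
      · have := comulAt_comulAt (i := 0) (j := i + 1) (by omega) (by omega) x
        rw [Nat.add_sub_cancel] at this
        rw [if_pos hi, ← this, rotate_comulAt (by omega) (by omega), Nat.add_sub_cancel]
    · rw [if_pos hj, if_pos (by omega : i ≤ n), if_pos (by omega), if_pos (by omega),
        comulAt_comulAt h₁ hj]
  σ_σ n i j h₁ h₂ := LinearMap.ext fun x => counitAt_counitAt h₁ h₂ x
  σ_δ_lt n i j h₁ h₂ := LinearMap.ext fun x => by
    simp only [coalgebraCocyclic, LinearMap.comp_apply, coface]
    rw [if_pos (by omega), if_pos (by omega), counitAt_comulAt_of_lt h₁ h₂]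
  σ_δ_id n j h := by
    constructor <;> refine LinearMap.ext fun x => ?_ <;>
      simp only [coalgebraCocyclic, LinearMap.comp_apply, coface, LinearMap.id_apply]
    · rw [if_pos h, counitAt_comulAt_self h]
    · split_ifs with hj
      · exact counitAt_comulAt_succ hj x
      · obtain rfl : j = n := by omega
        rw [LinearMap.comp_apply, counitAt_last_rotate, counitFirst_comulAt_zero]
  σ_δ_gt n i j h₁ h₂ := LinearMap.ext fun x => by
    simp only [coalgebraCocyclic, LinearMap.comp_apply, coface]
    rcases Nat.lt_or_ge (n + 1) i with hi | hi
    · rw [if_neg (by omega), if_neg (by omega), LinearMap.comp_apply, LinearMap.comp_apply]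
      have := rotate_counitAt (i := j + 1) (by omega) (by omega) (comulAt (n + 1) 0 x)
      rw [Nat.add_sub_cancel] at this
      rw [← this, counitAt_comulAt_of_lt (by omega) (by omega), Nat.add_sub_cancel]
    · rw [if_pos hi, if_pos (by omega), counitAt_comulAt_of_gt h₁ hi]
  τ_δ n i h₁ h₂ := LinearMap.ext fun x => by
    simp only [coalgebraCocyclic, LinearMap.comp_apply, coface]
    rw [if_pos (by omega : i - 1 ≤ n)]
    split_ifs with hi
    · exact rotate_comulAt h₁ hi x
    · obtain rfl : i = n + 1 := by omega
      exact rotate_rotate_comulAt_zero n x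
  τ_δ_zero n := LinearMap.ext fun x => by
    simp only [coalgebraCocyclic, LinearMap.comp_apply, coface]
    rw [if_pos (by omega), if_neg (by omega), LinearMap.comp_apply]
  τ_σ n i h₁ h₂ := LinearMap.ext fun x => rotate_counitAt h₁ h₂ x
  τ_σ_zero n := LinearMap.ext fun x => rotate_counitAt_zero n x
  τ_pow n := rotate_pow n

end ModuleCoalgebra

/-! ### Linear algebra of subspaces of tensor products over a field -/

section LinearAlgebra

variable {k V M N : Type*} [Field k] [AddCommGroup V] [Module k V]
  [AddCommGroup M] [Module k M] [AddCommGroup N] [Module k N]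

theorem rTensor_injective (f : M →ₗ[k] N) (hf : Function.Injective f) :
    Function.Injective (f.rTensor V) := Module.Flat.rTensor_preserves_injective_linearMap f hf

theorem lTensor_injective (f : M →ₗ[k] N) (hf : Function.Injective f) :
    Function.Injective (f.lTensor V) := Module.Flat.lTensor_preserves_injective_linearMap f hf

theorem rTensor_ker (f : M →ₗ[k] N) (x : M ⊗[k] V) :
    f.rTensor V x = 0 ↔ ∃ y, (LinearMap.ker f).subtype.rTensor V y = x :=
  Module.Flat.rTensor_exact V (f := (LinearMap.ker f).subtype) (g := f)
    (fun y => by simp) x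

theorem mkQ_rTensor_eq_zero_iff (P : Submodule k M) (x : M ⊗[k] V) :
    P.mkQ.rTensor V x = 0 ↔ ∃ y, P.subtype.rTensor V y = x :=
  Module.Flat.rTensor_exact V (f := P.subtype) (g := P.mkQ)
    (fun y => by simp) x

theorem mem_coinvariants_iff {D : Type*} [AddCommGroup D] [Module k D] (ρ : M →ₗ[k] M ⊗[k] D)
    (l : M →ₗ[k] D ⊗[k] M) (m : M) :
    m ∈ coinvariants ρ l ↔ TensorProduct.comm k M D (ρ m) = l m := by
  have h (φ : Module.Dual k D) (w : M ⊗[k] D) : TensorProduct.lid k M (φ.rTensor M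
      (TensorProduct.comm k M D w)) = TensorProduct.rid k M (φ.lTensor M w) := by
    induction w with
    | zero => simp
    | add x y hx hy => simp only [map_add, hx, hy]
    | tmul x c => simp
  simp only [coinvariants, Submodule.mem_iInf, LinearMap.mem_eqLocus, LinearMap.comp_apply,
    LinearEquiv.coe_coe, ← h]
  refine ⟨fun H => ?_, fun H φ => by rw [H]⟩
  classical
  let b := Module.Basis.ofVectorSpace k D
  refine (TensorProduct.equivFinsuppOfBasisLeft b).injective (Finsupp.ext fun i => ?_)
  rw [TensorProduct.equivFinsuppOfBasisLeft_apply, TensorProduct.equivFinsuppOfBasisLeft_apply, H]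

/-- The kernel of `f ⊗ V` on `P ⊗ V` is `(P ⊓ ker f) ⊗ V`. -/
theorem exists_rTensor_subtype_inf (P Q : Submodule k M)
    (f : M →ₗ[k] N) (hQ : ∀ m, m ∈ P → f m = 0 → m ∈ Q) (x : M ⊗[k] V)
    (h₁ : P.mkQ.rTensor V x = 0) (h₂ : f.rTensor V x = 0) :
    ∃ y, Q.subtype.rTensor V y = x := by
  obtain ⟨y, rfl⟩ := (mkQ_rTensor_eq_zero_iff _ _).1 h₁
  have h₃ : (f ∘ₗ P.subtype).rTensor V y = 0 := by
    rw [LinearMap.rTensor_comp, LinearMap.comp_apply, h₂]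
  obtain ⟨z, rfl⟩ := (rTensor_ker _ _).1 h₃
  let g : LinearMap.ker (f ∘ₗ P.subtype) →ₗ[k] Q :=
    (P.subtype ∘ₗ Submodule.subtype _).codRestrict Q fun m => hQ _ m.1.2 m.2
  refine ⟨g.rTensor V z, ?_⟩
  rw [← LinearMap.comp_apply, ← LinearMap.comp_apply, ← LinearMap.rTensor_comp,
    ← LinearMap.rTensor_comp]
  rfl

end LinearAlgebra

/-! ### The Galois map of a comodule -/

namespace ModuleCoalgebra

variable {k : Type*} [Field k] {H : Type u} [Ring H] [HopfAlgebra k H]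
  {C : Type u} [AddCommGroup C] [Module k C] [Coalgebra k C] (A : ModuleCoalgebra k H C)
  {M N : Type*} [AddCommGroup M] [Module k M] [AddCommGroup N] [Module k N]

/-- The Galois map `M ⊗ H → M ⊗ C`, `m ⊗ h ↦ m₍₀₎ ⊗ m₍₁₎ ◁ h`, of a right `C`-comodule `M`. -/
def gal (ρ : M →ₗ[k] M ⊗[k] C) : M ⊗[k] H →ₗ[k] M ⊗[k] C :=
  A.act.lTensor M ∘ₗ (TensorProduct.assoc k M C H).toLinearMap ∘ₗ ρ.rTensor H

theorem gal_tmul (ρ : M →ₗ[k] M ⊗[k] C) (m : M) (h : H) :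
    A.gal ρ (m ⊗ₜ h) = A.act.lTensor M (TensorProduct.assoc k M C H (ρ m ⊗ₜ h)) := rfl

theorem galoisMap_eq_gal : A.galoisMap = A.gal Coalgebra.comul := rfl

/-- The Galois map is natural in the comodule. -/
theorem gal_rTensor {ρ : M →ₗ[k] M ⊗[k] C} {σ : N →ₗ[k] N ⊗[k] C} (f : M →ₗ[k] N)
    (h : ∀ m, σ (f m) = f.rTensor C (ρ m)) (w : M ⊗[k] H) :
    A.gal σ (f.rTensor H w) = f.rTensor C (A.gal ρ w) := by
  induction w with
  | zero => simp
  | add x y hx hy => simp only [map_add, hx, hy]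
  | tmul m g =>
    rw [LinearMap.rTensor_tmul, gal_tmul, gal_tmul, h]
    generalize ρ m = v
    induction v with
    | zero => simp
    | add x y hx hy => simp only [map_add, TensorProduct.add_tmul, hx, hy]
    | tmul p q => simp

theorem gal_tensorCoact (w : (N ⊗[k] C) ⊗[k] H) :
    A.gal (tensorCoact k C N) w = (TensorProduct.assoc k N C C).symm
      (A.galoisMap.lTensor N (TensorProduct.assoc k N C H w)) := by
  induction w with
  | zero => simp
  | add x y hx hy => simp only [map_add, hx, hy]
  | tmul m g =>
    induction m with
    | zero => simp
    | add x y hx hy => simp only [map_add, TensorProduct.add_tmul, hx, hy]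
    | tmul n c =>
      rw [gal_tmul, TensorProduct.assoc_tmul, LinearMap.lTensor_tmul, galoisMap_eq_gal, gal_tmul,
        tensorCoact, LinearMap.comp_apply, LinearMap.lTensor_tmul, LinearEquiv.coe_coe]
      generalize Coalgebra.comul (R := k) c = v
      induction v with
      | zero => simp
      | add x y hx hy => simp only [map_add, TensorProduct.add_tmul, TensorProduct.tmul_add, hx, hy]
      | tmul p q => simp

variable {A}

theorem IsHopfGalois.galoisMap_injective (hA : A.IsHopfGalois) :
    Function.Injective A.galoisMap := Set.injOn_univ.1 hA.injOn

theorem IsHopfGalois.mem_cotensorSq_iff (hA : A.IsHopfGalois) (w : C ⊗[k] C) :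
    w ∈ A.cotensorSq ↔ ∃ x, A.galoisMap x = w := by
  have := hA.image_eq
  rw [Set.image_univ] at this
  rw [← SetLike.mem_coe, ← this, Set.mem_range]

theorem IsHopfGalois.gal_tensorCoact_injective (hA : A.IsHopfGalois) :
    Function.Injective (A.gal (tensorCoact k C N)) := by
  have : A.gal (tensorCoact k C N) = (TensorProduct.assoc k N C C).symm.toLinearMap ∘ₗ
      A.galoisMap.lTensor N ∘ₗ (TensorProduct.assoc k N C H).toLinearMap :=
    LinearMap.ext A.gal_tensorCoact
  rw [this, LinearMap.coe_comp, LinearMap.coe_comp]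
  exact (TensorProduct.assoc k N C C).symm.injective.comp
    ((lTensor_injective _ hA.galoisMap_injective).comp (TensorProduct.assoc k N C H).injective)

/-- Every comodule `M` embeds by its coaction into the comodule `M ⊗ C`, whose Galois map is
`M ⊗ β`. -/
theorem IsHopfGalois.gal_injective (hA : A.IsHopfGalois) {ρ : M →ₗ[k] M ⊗[k] C}
    (hρ : IsRightComodule ρ) : Function.Injective (A.gal ρ) := by
  refine Function.Injective.of_comp (f := ρ.rTensor C) ?_
  have : ρ.rTensor C ∘ A.gal ρ = A.gal (tensorCoact k C M) ∘ ρ.rTensor H :=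
    funext fun w => (A.gal_rTensor ρ hρ.tensorCoact_coact w).symm
  rw [this]
  exact hA.gal_tensorCoact_injective.comp (rTensor_injective _ hρ.injective)

/-- For a subcomodule `P` of `M`, the Galois map of `M` reflects membership in `P ⊗ C`. -/
theorem IsHopfGalois.gal_mem_iff (hA : A.IsHopfGalois) {ρ : M →ₗ[k] M ⊗[k] C}
    (hρ : IsRightComodule ρ) {P : Submodule k M} (hP : ∀ p ∈ P, P.mkQ.rTensor C (ρ p) = 0)
    (x : M ⊗[k] H) : P.mkQ.rTensor C (A.gal ρ x) = 0 ↔ P.mkQ.rTensor H x = 0 := by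
  constructor
  · intro h
    obtain ⟨y, hy⟩ := (mkQ_rTensor_eq_zero_iff P _).1 h
    -- as `P` is a subcomodule, `(ρ ⊗ C) (gal x)` lies in `P ⊗ C ⊗ C`
    have h₁ : (P.mkQ.rTensor C).rTensor C (ρ.rTensor C (A.gal ρ x)) = 0 := by
      rw [← hy]
      clear hy
      induction y with
      | zero => simp
      | add x y hx hy => simp only [map_add, hx, hy, add_zero]
      | tmul p c =>
        rw [LinearMap.rTensor_tmul, LinearMap.rTensor_tmul, LinearMap.rTensor_tmul,
          Submodule.subtype_apply, hP p p.2, TensorProduct.zero_tmul]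
    rw [← A.gal_rTensor ρ hρ.tensorCoact_coact, gal_tensorCoact] at h₁
    have h₂ (y : M ⊗[k] (C ⊗[k] H)) : (P.mkQ.rTensor C).rTensor C
        ((TensorProduct.assoc k M C C).symm (A.galoisMap.lTensor M y)) =
        (TensorProduct.assoc k _ C C).symm (A.galoisMap.lTensor _ (P.mkQ.rTensor _ y)) := by
      induction y with
      | zero => simp
      | add x y hx hy => simp only [map_add, hx, hy]
      | tmul m z =>
        rw [LinearMap.rTensor_tmul, LinearMap.lTensor_tmul, LinearMap.lTensor_tmul]
        generalize A.galoisMap z = v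
        induction v with
        | zero => simp
        | add x y hx hy => simp only [map_add, TensorProduct.tmul_add, hx, hy]
        | tmul p q => simp
    rw [h₂, LinearEquiv.map_eq_zero_iff,
      LinearMap.map_eq_zero_iff _ (lTensor_injective _ hA.galoisMap_injective)] at h₁
    have h₃ (y : M ⊗[k] H) : ((TensorProduct.lid k H).toLinearMap ∘ₗ
        (Coalgebra.counit (R := k) (A := C)).rTensor H).lTensor _
          (P.mkQ.rTensor _ (TensorProduct.assoc k M C H (ρ.rTensor H y))) = P.mkQ.rTensor H y := by
      induction y with
      | zero => simp
      | add x y hx hy => simp only [map_add, hx, hy]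
      | tmul m z =>
        conv_rhs => rw [← hρ.counit m]
        rw [LinearMap.rTensor_tmul]
        generalize ρ m = v
        induction v with
        | zero => simp
        | add x y hx hy => simp only [map_add, TensorProduct.add_tmul, hx, hy]
        | tmul p q => simp [TensorProduct.smul_tmul']
    rw [← h₃, h₁, map_zero]
  · intro h
    obtain ⟨y, rfl⟩ := (mkQ_rTensor_eq_zero_iff P _).1 h
    clear h
    induction y with
    | zero => simp
    | add x y hx hy => simp only [map_add, hx, hy, add_zero]
    | tmul p g =>
      have h₁ (v : M ⊗[k] C) : P.mkQ.rTensor C (A.act.lTensor M (TensorProduct.assoc k M C H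
          (v ⊗ₜ g))) = A.act.lTensor _ (TensorProduct.assoc k _ C H (P.mkQ.rTensor C v ⊗ₜ g)) := by
        induction v with
        | zero => simp
        | add x y hx hy => simp only [map_add, TensorProduct.add_tmul, hx, hy]
        | tmul p q => simp
      rw [LinearMap.rTensor_tmul, gal_tmul, h₁, Submodule.subtype_apply, hP p p.2]
      simp

/-- The Galois map of a comodule is itself colinear:
`m₍₀₎ ⊗ (m₍₁₎ ◁ h)⁽¹⁾ ⊗ (m₍₁₎ ◁ h)⁽²⁾ = m₍₀₎ ⊗ m₍₁₎ ◁ h⁽¹⁾ ⊗ m₍₂₎ ◁ h⁽²⁾`. -/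
theorem tensorCoact_gal {ρ : M →ₗ[k] M ⊗[k] C} (hρ : IsRightComodule ρ) (m : M) (h : H) :
    tensorCoact k C M (A.gal ρ (m ⊗ₜ h)) = TensorProduct.map (A.gal ρ) A.act
      (TensorProduct.tensorTensorTensorComm k M C H H
        (ρ m ⊗ₜ Coalgebra.comul (R := k) h)) := by
  let F (v : H ⊗[k] H) : C ⊗[k] C →ₗ[k] C ⊗[k] C := TensorProduct.map A.act A.act ∘ₗ
    (TensorProduct.tensorTensorTensorComm k C C H H).toLinearMap ∘ₗ
    (TensorProduct.mk k _ _).flip v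
  have h₁ (w : M ⊗[k] C) : tensorCoact k C M (A.act.lTensor M (TensorProduct.assoc k M C H
      (w ⊗ₜ h))) = (TensorProduct.assoc k M C C).symm ((F (Coalgebra.comul (R := k) h)).lTensor M
        ((Coalgebra.comul (R := k)).lTensor M w)) := by
    induction w with
    | zero => simp
    | add x y hx hy => simp only [map_add, TensorProduct.add_tmul, hx, hy]
    | tmul p q => simp [tensorCoact, F, A.comul_act]
  have h₂ (w : M ⊗[k] C) (v : H ⊗[k] H) : TensorProduct.map (A.gal ρ) A.act
      (TensorProduct.tensorTensorTensorComm k M C H H (w ⊗ₜ v)) =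
      (TensorProduct.assoc k M C C).symm ((F v).lTensor M
        (TensorProduct.assoc k M C C (ρ.rTensor C w))) := by
    induction w with
    | zero => simp
    | add x y hx hy => simp only [map_add, TensorProduct.add_tmul, hx, hy]
    | tmul p q =>
      induction v with
      | zero => simp [F]
      | add x y hx hy =>
        have e : F (x + y) = F x + F y := by simp [F, LinearMap.comp_add]
        simp only [map_add, TensorProduct.tmul_add, hx, hy, e, LinearMap.lTensor_add,
          LinearMap.add_apply]
      | tmul a b =>
        rw [TensorProduct.tensorTensorTensorComm_tmul, TensorProduct.map_tmul, gal_tmul,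
          LinearMap.rTensor_tmul]
        generalize ρ p = u
        induction u with
        | zero => simp
        | add x y hx hy => simp only [map_add, TensorProduct.add_tmul, hx, hy]
        | tmul r s => simp [F]
  rw [gal_tmul, h₁, h₂, hρ.coassoc]

variable (A) in
theorem π_act (c : C) (h : H) : A.π (A.act (c ⊗ₜ h)) = Coalgebra.counit (R := k) h • A.π c := by
  rw [← map_smul, ← sub_eq_zero, ← map_sub, Submodule.mkQ_apply, Submodule.Quotient.mk_eq_zero]
  exact Submodule.subset_span ⟨c, h, rfl⟩

/-- The Galois map is colinear for the right `D`-coactions of `M` and of `C`. -/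
theorem tensorCoact_gal_quotient {ρ : M →ₗ[k] M ⊗[k] C} (hρ : IsRightComodule ρ) (m : M) (h : H) :
    A.π.lTensor _ (tensorCoact k C M (A.gal ρ (m ⊗ₜ h))) = (A.gal ρ).rTensor _
      (TensorProduct.rightComm k M A.D H (A.π.lTensor M (ρ m) ⊗ₜ h)) := by
  rw [tensorCoact_gal hρ]
  have h₁ (w : M ⊗[k] C) (v : H ⊗[k] H) : A.π.lTensor _ (TensorProduct.map (A.gal ρ) A.act
      (TensorProduct.tensorTensorTensorComm k M C H H (w ⊗ₜ v))) = (A.gal ρ).rTensor _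
      (TensorProduct.rightComm k M A.D H (A.π.lTensor M w ⊗ₜ TensorProduct.rid k H
        ((Coalgebra.counit (R := k)).lTensor H v))) := by
    induction w with
    | zero => simp
    | add x y hx hy => simp only [map_add, TensorProduct.add_tmul, hx, hy]
    | tmul p q =>
      induction v with
      | zero => simp
      | add x y hx hy => simp only [map_add, TensorProduct.tmul_add, hx, hy]
      | tmul a b =>
        rw [TensorProduct.tensorTensorTensorComm_tmul, TensorProduct.map_tmul,
          LinearMap.lTensor_tmul, π_act]
        simp
  rw [h₁, Coalgebra.lTensor_counit_comul, TensorProduct.rid_tmul, one_smul]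

/-! ### The image of the Galois map -/

section
variable (A)

/-- The image of the Galois map of `M` is the cotensor product `M □_D C`. -/
def GaloisRange (ρ : M →ₗ[k] M ⊗[k] C) : Prop :=
  ∀ w, w ∈ cotensor (A.π.lTensor M ∘ₗ ρ) A.leftCoact ↔ ∃ x, A.gal ρ x = w

end

theorem IsHopfGalois.galoisRange_self (hA : A.IsHopfGalois) :
    A.GaloisRange (Coalgebra.comul (R := k) (A := C)) := hA.mem_cotensorSq_iff

theorem IsHopfGalois.galoisRange_tensorCoact (hA : A.IsHopfGalois) :
    A.GaloisRange (tensorCoact k C N) := fun w => by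
  let γ : C ⊗[k] C →ₗ[k] C ⊗[k] (A.D ⊗[k] C) :=
    (TensorProduct.assoc k C A.D C).toLinearMap ∘ₗ A.rightCoact.rTensor C - A.leftCoact.lTensor C
  have hγ : Function.Exact A.galoisMap γ := fun y => by
    rw [Set.mem_range, ← hA.mem_cotensorSq_iff, cotensorSq, cotensor, LinearMap.mem_eqLocus,
      LinearMap.sub_apply, sub_eq_zero]
  have h₁ (w : (N ⊗[k] C) ⊗[k] C) : TensorProduct.assoc k N C (A.D ⊗[k] C)
      (TensorProduct.assoc k (N ⊗[k] C) A.D C ((A.π.lTensor _ ∘ₗ tensorCoact k C N).rTensor C w)) =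
      ((TensorProduct.assoc k C A.D C).toLinearMap ∘ₗ A.rightCoact.rTensor C).lTensor N
        (TensorProduct.assoc k N C C w) := by
    induction w with
    | zero => simp
    | add x y hx hy => simp only [map_add, hx, hy]
    | tmul m c =>
      induction m with
      | zero => simp
      | add x y hx hy => simp only [map_add, TensorProduct.add_tmul, hx, hy]
      | tmul n d =>
        simp only [tensorCoact, rightCoact, LinearMap.rTensor_tmul, LinearMap.comp_apply,
          LinearMap.lTensor_tmul, LinearEquiv.coe_coe, TensorProduct.assoc_tmul]
        generalize Coalgebra.comul (R := k) d = v
        induction v with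
        | zero => simp
        | add x y hx hy => simp only [map_add, TensorProduct.add_tmul, TensorProduct.tmul_add,
            hx, hy]
        | tmul p q => simp
  have h₂ (w : (N ⊗[k] C) ⊗[k] C) : TensorProduct.assoc k N C (A.D ⊗[k] C)
      (A.leftCoact.lTensor _ w) = (A.leftCoact.lTensor C).lTensor N
        (TensorProduct.assoc k N C C w) := by
    induction w with
    | zero => simp
    | add x y hx hy => simp only [map_add, hx, hy]
    | tmul m c =>
      induction m with
      | zero => simp
      | add x y hx hy => simp only [map_add, TensorProduct.add_tmul, hx, hy]
      | tmul n d => simp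
  have h₃ : w ∈ cotensor (A.π.lTensor _ ∘ₗ tensorCoact k C N) A.leftCoact ↔
      γ.lTensor N (TensorProduct.assoc k N C C w) = 0 := by
    rw [cotensor, LinearMap.mem_eqLocus, LinearMap.comp_apply, LinearEquiv.coe_coe,
      ← (TensorProduct.assoc k N C (A.D ⊗[k] C)).injective.eq_iff, h₁, h₂, ← sub_eq_zero,
      ← LinearMap.sub_apply, ← LinearMap.lTensor_sub]
  rw [h₃, Module.Flat.lTensor_exact N hγ]
  constructor
  · rintro ⟨y, hy⟩
    refine ⟨(TensorProduct.assoc k N C H).symm y, ?_⟩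
    rw [gal_tensorCoact, LinearEquiv.apply_symm_apply, hy, LinearEquiv.symm_apply_apply]
  · rintro ⟨x, rfl⟩
    exact ⟨TensorProduct.assoc k N C H x, by rw [gal_tensorCoact, LinearEquiv.apply_symm_apply]⟩

theorem GaloisRange.of_equiv {ρ : M →ₗ[k] M ⊗[k] C} {σ : N →ₗ[k] N ⊗[k] C}
    (hρ : A.GaloisRange ρ) (f : M ≃ₗ[k] N) (h : ∀ m, σ (f m) = f.toLinearMap.rTensor C (ρ m)) :
    A.GaloisRange σ := fun w => by
  obtain ⟨w, rfl⟩ := (f.rTensor C).surjective w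
  have h₁ (w : M ⊗[k] C) : TensorProduct.assoc k N A.D C ((A.π.lTensor N ∘ₗ σ).rTensor C
      (f.toLinearMap.rTensor C w)) = f.toLinearMap.rTensor _ (TensorProduct.assoc k M A.D C
        ((A.π.lTensor M ∘ₗ ρ).rTensor C w)) := by
    induction w with
    | zero => simp
    | add x y hx hy => simp only [map_add, hx, hy]
    | tmul m c =>
      simp only [LinearMap.rTensor_tmul, LinearMap.comp_apply, LinearEquiv.coe_coe, h]
      generalize ρ m = v
      induction v with
      | zero => simp
      | add x y hx hy => simp only [map_add, TensorProduct.add_tmul, hx, hy]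
      | tmul p q => simp
  have h₂ (w : M ⊗[k] C) : A.leftCoact.lTensor N (f.toLinearMap.rTensor C w) =
      f.toLinearMap.rTensor _ (A.leftCoact.lTensor M w) := by
    induction w with
    | zero => simp
    | add x y hx hy => simp only [map_add, hx, hy]
    | tmul m c => simp
  have h₃ : f.toLinearMap.rTensor C w ∈ cotensor (A.π.lTensor N ∘ₗ σ) A.leftCoact ↔
      w ∈ cotensor (A.π.lTensor M ∘ₗ ρ) A.leftCoact := by
    simp only [cotensor, LinearMap.mem_eqLocus, LinearMap.comp_apply, LinearEquiv.coe_coe] at h₁ ⊢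
    erw [h₁, h₂]
    exact (f.rTensor (A.D ⊗[k] C)).injective.eq_iff
  refine h₃.trans ((hρ w).trans ?_)
  constructor
  · rintro ⟨x, rfl⟩
    exact ⟨f.toLinearMap.rTensor H x, A.gal_rTensor f.toLinearMap h x⟩
  · rintro ⟨x, hx⟩
    refine ⟨(f.rTensor H).symm x, (f.rTensor C).injective ?_⟩
    refine Eq.trans (A.gal_rTensor f.toLinearMap h _).symm (Eq.trans ?_ hx)
    exact congrArg _ ((f.rTensor H).apply_symm_apply x)

end ModuleCoalgebra

/-! ### The image of `ψ` -/

namespace ModuleCoalgebra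

variable {k : Type*} [Field k] {H : Type u} [Ring H] [HopfAlgebra k H]
  {C : Type u} [AddCommGroup C] [Module k C] [Coalgebra k C] {A : ModuleCoalgebra k H C}

theorem lastCoact_iterZero (c : C) :
    lastCoact 0 (iterZero.symm c : iter k C C 0) =
      (iterZero.symm.toLinearMap).rTensor C (Coalgebra.comul (R := k) c) := by
  rw [lastCoact_zero, LinearEquiv.apply_symm_apply]

theorem lastCoact_iterSucc (n : ℕ) (w : iter k C C n ⊗[k] C) :
    lastCoact (n + 1) ((iterSucc n).symm w) =
      ((iterSucc n).symm.toLinearMap).rTensor C (tensorCoact k C _ w) := by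
  rw [lastCoact_succ]
  rfl

variable (A)

theorem galoisLast_eq : ∀ (n : ℕ) (w : iter k C C n ⊗[k] H),
    A.galoisLast n w = (iterSucc n).symm (A.gal (lastCoact n) w)
  | 0, w => by
    obtain ⟨w, rfl⟩ := ((iterZero (k := k) (V := C) (M := C)).symm.rTensor H).surjective w
    refine congrArg (iterSucc 0).symm (Eq.trans ?_ (A.gal_rTensor iterZero.symm.toLinearMap
      lastCoact_iterZero w).symm)
    refine congrArg _ (congrArg A.galoisMap ?_)
    exact LinearEquiv.symm_apply_apply
      ((iterZero (k := k) (V := C) (M := C)).symm.rTensor H) w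
  | n + 1, w => by
    obtain ⟨w, rfl⟩ := ((iterSucc (k := k) (V := C) (M := C) n).symm.rTensor H).surjective w
    refine congrArg (iterSucc (n + 1)).symm (Eq.trans ?_
      (A.gal_rTensor (iterSucc n).symm.toLinearMap (lastCoact_iterSucc n) w).symm)
    rw [gal_tensorCoact]
    refine congrArg (((iterSucc n).symm.toLinearMap).rTensor C) (congrArg
      (TensorProduct.assoc k (iter k C C n) C C).symm (congrArg (A.galoisMap.lTensor (iter k C C n))
        (congrArg (TensorProduct.assoc k (iter k C C n) C H) ?_)))
    exact LinearEquiv.symm_apply_apply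
      ((iterSucc (k := k) (V := C) (M := C) n).symm.rTensor H) w

theorem iterSucc_galoisLast (n : ℕ) (w : iter k C C n ⊗[k] H) :
    iterSucc n (A.galoisLast n w) = A.gal (lastCoact n) w := by
  rw [galoisLast_eq, LinearEquiv.apply_symm_apply]

theorem rightCoactPow_eq : ∀ (n : ℕ) (x : iter k C C n),
    A.rightCoactPow n x = A.π.lTensor _ (lastCoact n x)
  | 0, x => by
    obtain ⟨c, rfl⟩ := iterZero.symm.surjective x
    rw [lastCoact_iterZero]
    simp only [rightCoactPow, LinearMap.comp_apply, LinearEquiv.coe_coe,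
      LinearEquiv.apply_symm_apply, rightCoact]
    generalize Coalgebra.comul (R := k) c = v
    induction v with
    | zero => simp
    | add x y hx hy => simp only [map_add, hx, hy]
    | tmul p q => simp
  | n + 1, x => by
    obtain ⟨w, rfl⟩ := (iterSucc n).symm.surjective x
    rw [lastCoact_iterSucc]
    simp only [rightCoactPow, LinearMap.comp_apply, LinearEquiv.coe_coe,
      LinearEquiv.apply_symm_apply, tensorCoact]
    induction w with
    | zero => simp
    | add x y hx hy => simp only [map_add, hx, hy]
    | tmul x c =>
      simp only [LinearMap.lTensor_tmul, rightCoact, LinearMap.comp_apply]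
      generalize Coalgebra.comul (R := k) c = v
      induction v with
      | zero => simp
      | add x y hx hy => simp only [map_add, TensorProduct.tmul_add, hx, hy]
      | tmul p q => simp

theorem rightCoactPow_eq_comp (n : ℕ) :
    A.rightCoactPow n = A.π.lTensor _ ∘ₗ lastCoact n := LinearMap.ext (A.rightCoactPow_eq n)

theorem leftCoactPow_succ (n : ℕ) (x : iter k C C n) (c : C) :
    A.leftCoactPow (n + 1) ((iterSucc n).symm (x ⊗ₜ c)) =
      ((iterSucc n).symm.toLinearMap).lTensor A.D
        (TensorProduct.assoc k A.D (iter k C C n) C (A.leftCoactPow n x ⊗ₜ c)) := by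
  simp [leftCoactPow]

variable {A}

theorem IsHopfGalois.galoisRange_lastCoact (hA : A.IsHopfGalois) : ∀ n : ℕ,
    A.GaloisRange (lastCoact (k := k) (C := C) n)
  | 0 => hA.galoisRange_self.of_equiv iterZero.symm lastCoact_iterZero
  | n + 1 => hA.galoisRange_tensorCoact.of_equiv (iterSucc n).symm (lastCoact_iterSucc n)

theorem IsHopfGalois.galoisLast_injective (hA : A.IsHopfGalois) (n : ℕ) :
    Function.Injective (A.galoisLast n) := by
  have : A.galoisLast n = (iterSucc n).symm.toLinearMap ∘ₗ A.gal (lastCoact n) :=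
    LinearMap.ext (A.galoisLast_eq n)
  rw [this]
  exact (iterSucc n).symm.injective.comp (hA.gal_injective (isRightComodule_lastCoact n))

/-- `C □_D ⋯ □_D C` is a `C`-subcomodule of `C^{⊗(n+1)}`. -/
def IsSubcomodulePow (A : ModuleCoalgebra k H C) (n : ℕ) : Prop :=
  ∀ x ∈ A.cotensorPow n, (A.cotensorPow n).mkQ.rTensor C (lastCoact n x) = 0

theorem IsHopfGalois.mem_cotensorPow_succ (hA : A.IsHopfGalois) {n : ℕ}
    (hn : A.IsSubcomodulePow n) (w : iter k C C (n + 1)) : w ∈ A.cotensorPow (n + 1) ↔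
      ∃ x, (A.cotensorPow n).mkQ.rTensor H x = 0 ∧ A.galoisLast n x = w := by
  have h₁ : w ∈ A.cotensorPow (n + 1) ↔ (A.cotensorPow n).mkQ.rTensor C (iterSucc n w) = 0 ∧
      ∃ x, A.gal (lastCoact n) x = iterSucc n w := by
    rw [mkQ_rTensor_eq_zero_iff, ← hA.galoisRange_lastCoact n, ← rightCoactPow_eq_comp]
    rfl
  rw [h₁]
  constructor
  · rintro ⟨h, x, hx⟩
    refine ⟨x, ?_, ?_⟩
    · rwa [← hA.gal_mem_iff (isRightComodule_lastCoact n) hn, hx]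
    · rw [galoisLast_eq, hx, LinearEquiv.symm_apply_apply]
  · rintro ⟨x, hx, rfl⟩
    rw [iterSucc_galoisLast, hA.gal_mem_iff (isRightComodule_lastCoact n) hn]
    exact ⟨hx, x, rfl⟩

variable (A) in
theorem cotensorPow_zero_mkQ : (A.cotensorPow 0).mkQ = 0 :=
  LinearMap.ext fun y => (Submodule.Quotient.mk_eq_zero _).2 (Submodule.mem_top (x := y))

theorem IsHopfGalois.isSubcomodulePow (hA : A.IsHopfGalois) : ∀ n : ℕ, A.IsSubcomodulePow n
  | 0 => fun x _ => by
    rw [cotensorPow_zero_mkQ, LinearMap.rTensor_zero, LinearMap.zero_apply]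
  | n + 1 => fun w hw => by
    have hn := hA.isSubcomodulePow n
    obtain ⟨x, hx, rfl⟩ := (hA.mem_cotensorPow_succ hn w).1 hw
    clear hw
    obtain ⟨y, rfl⟩ := (mkQ_rTensor_eq_zero_iff _ _).1 hx
    clear hx
    rw [galoisLast_eq, lastCoact_iterSucc]
    induction y with
    | zero => simp
    | add x y hx hy => simp only [map_add, hx, hy, add_zero]
    | tmul p h =>
      rw [LinearMap.rTensor_tmul, tensorCoact_gal (isRightComodule_lastCoact n)]
      obtain ⟨v, hv⟩ := (mkQ_rTensor_eq_zero_iff _ _).1 (hn p p.2)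
      rw [Submodule.subtype_apply, ← hv]
      generalize Coalgebra.comul (R := k) h = u
      clear hv
      induction v with
      | zero => simp
      | add x y hx hy => simp only [map_add, TensorProduct.add_tmul, hx, hy, add_zero]
      | tmul p' c =>
        induction u with
        | zero => simp
        | add x y hx hy => simp only [map_add, TensorProduct.tmul_add, hx, hy, add_zero]
        | tmul a b =>
          have : A.galoisLast n ((p' : iter k C C n) ⊗ₜ a) ∈ A.cotensorPow (n + 1) :=
            (hA.mem_cotensorPow_succ hn _).2 ⟨_, (mkQ_rTensor_eq_zero_iff _ _).2
              ⟨p' ⊗ₜ a, rfl⟩, rfl⟩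
          rw [LinearMap.rTensor_tmul, TensorProduct.tensorTensorTensorComm_tmul,
            TensorProduct.map_tmul, LinearMap.rTensor_tmul, LinearMap.rTensor_tmul,
            LinearEquiv.coe_coe, Submodule.subtype_apply, ← galoisLast_eq,
            Submodule.mkQ_apply, (Submodule.Quotient.mk_eq_zero _).2 this, TensorProduct.zero_tmul]

/-- The difference of the two `D`-coactions on `C^{⊗(n+1)}`; its kernel is the space of
`D`-coinvariants. -/
def coactDiff (A : ModuleCoalgebra k H C) (n : ℕ) : iter k C C n →ₗ[k] A.D ⊗[k] iter k C C n :=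
  (TensorProduct.comm k _ A.D).toLinearMap ∘ₗ A.rightCoactPow n - A.leftCoactPow n

theorem mem_cyclicCotensor_iff (n : ℕ) (x : iter k C C n) :
    x ∈ A.cyclicCotensor n ↔ x ∈ A.cotensorPow n ∧ A.coactDiff n x = 0 := by
  rw [cyclicCotensor, Submodule.mem_inf, mem_coinvariants_iff, coactDiff, LinearMap.sub_apply,
    sub_eq_zero]
  rfl

/-- The two coactions on `C^{⊗(n+1)}`, of `D` on the first factor and of `C` on the last one,
commute. -/
theorem assoc_leftCoactPow_lastCoact : ∀ (n : ℕ) (x : iter k C C n),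
    TensorProduct.assoc k _ _ _ ((A.leftCoactPow n).rTensor C (lastCoact n x)) =
      (lastCoact n).lTensor A.D (A.leftCoactPow n x)
  | 0, x => by
    obtain ⟨c, rfl⟩ := iterZero.symm.surjective x
    have h₁ (v : C ⊗[k] C) : TensorProduct.assoc k _ _ _ ((A.leftCoactPow 0).rTensor C
        ((iterZero.symm.toLinearMap).rTensor C v)) =
        ((iterZero.symm.toLinearMap).rTensor C).lTensor A.D (A.π.rTensor (C ⊗[k] C)
          (TensorProduct.assoc k C C C ((Coalgebra.comul (R := k)).rTensor C v))) := by
      induction v with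
      | zero => simp
      | add x y hx hy => simp only [map_add, hx, hy]
      | tmul p q =>
        simp only [leftCoactPow, leftCoact, LinearMap.rTensor_tmul, LinearMap.comp_apply,
          LinearEquiv.coe_coe, LinearEquiv.apply_symm_apply]
        generalize Coalgebra.comul (R := k) p = v
        induction v with
        | zero => simp
        | add x y hx hy => simp only [map_add, TensorProduct.add_tmul, hx, hy]
        | tmul p q => simp
    have h₂ (v : C ⊗[k] C) : (lastCoact 0).lTensor A.D ((iterZero.symm.toLinearMap).lTensor A.D
        (A.π.rTensor C v)) = ((iterZero.symm.toLinearMap).rTensor C).lTensor A.D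
          (A.π.rTensor (C ⊗[k] C) ((Coalgebra.comul (R := k)).lTensor C v)) := by
      induction v with
      | zero => simp
      | add x y hx hy => simp only [map_add, hx, hy]
      | tmul p q => simp [lastCoact_iterZero]
    rw [lastCoact_iterZero, h₁, Coalgebra.coassoc_apply, ← h₂]
    rfl
  | n + 1, x => by
    refine LinearMap.congr_fun (f := (TensorProduct.assoc k _ _ _).toLinearMap ∘ₗ
      (A.leftCoactPow (n + 1)).rTensor C ∘ₗ lastCoact (n + 1))
        (g := (lastCoact (n + 1)).lTensor A.D ∘ₗ A.leftCoactPow (n + 1))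
          (iter_succ_ext fun x c => ?_) x
    simp only [LinearMap.comp_apply, LinearEquiv.coe_coe]
    rw [lastCoact_iterSucc, leftCoactPow_succ, tensorCoact, LinearMap.comp_apply,
      LinearMap.lTensor_tmul, LinearEquiv.coe_coe]
    have h₁ (v : C ⊗[k] C) : TensorProduct.assoc k _ _ _ ((A.leftCoactPow (n + 1)).rTensor C
        (((iterSucc n).symm.toLinearMap).rTensor C ((TensorProduct.assoc k _ _ _).symm
          (x ⊗ₜ v)))) = ((((iterSucc n).symm.toLinearMap).rTensor C) ∘ₗ
            (TensorProduct.assoc k _ _ _).symm.toLinearMap ∘ₗ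
            (TensorProduct.mk k (iter k C C n) (C ⊗[k] C)).flip v).lTensor A.D
              (A.leftCoactPow n x) := by
      induction v with
      | zero => simp
      | add x y hx hy =>
        simp only [map_add, TensorProduct.tmul_add, hx, hy, LinearMap.comp_add,
          LinearMap.lTensor_add, LinearMap.add_apply]
      | tmul p q =>
        simp only [TensorProduct.assoc_symm_tmul, LinearMap.rTensor_tmul, LinearEquiv.coe_coe,
          leftCoactPow_succ]
        generalize A.leftCoactPow n x = v
        induction v with
        | zero => simp
        | add x y hx hy => simp only [map_add, TensorProduct.add_tmul, hx, hy]
        | tmul p q => simp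
    rw [h₁]
    generalize A.leftCoactPow n x = v
    induction v with
    | zero => simp
    | add x y hx hy => simp only [map_add, TensorProduct.add_tmul, hx, hy]
    | tmul p q =>
      simp [lastCoact_iterSucc, tensorCoact]

/-- The Galois map on the last factor is colinear for both `D`-coactions. -/
theorem coactDiff_galoisLast (n : ℕ) (x : iter k C C n ⊗[k] H) :
    A.coactDiff (n + 1) (A.galoisLast n x) = (A.galoisLast n).lTensor A.D
      (TensorProduct.assoc k _ _ _ ((A.coactDiff n).rTensor H x)) := by
  induction x with
  | zero => simp
  | add x y hx hy => simp only [map_add, hx, hy]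
  | tmul x h =>
    rw [LinearMap.rTensor_tmul]
    simp only [coactDiff, LinearMap.sub_apply, TensorProduct.sub_tmul, map_sub]
    congr 1
    · rw [LinearMap.comp_apply, rightCoactPow_eq, galoisLast_eq, lastCoact_iterSucc,
        LinearMap.comp_apply, rightCoactPow_eq]
      have h₁ (w : (iter k C C n ⊗[k] C) ⊗[k] C) :
          A.π.lTensor _ (((iterSucc n).symm.toLinearMap).rTensor C w) =
            ((iterSucc n).symm.toLinearMap).rTensor A.D (A.π.lTensor _ w) :=
        (LinearMap.congr_fun (LinearMap.lTensor_comp_rTensor ..) _).trans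
          (LinearMap.congr_fun (LinearMap.rTensor_comp_lTensor ..) _).symm
      rw [h₁, tensorCoact_gal_quotient (isRightComodule_lastCoact n)]
      generalize A.π.lTensor _ (lastCoact n x) = v
      induction v with
      | zero => simp
      | add x y hx hy => simp only [map_add, TensorProduct.add_tmul, hx, hy]
      | tmul p q => simp [galoisLast_eq]
    · have h₁ (v : iter k C C n ⊗[k] C) : A.leftCoactPow (n + 1)
          ((iterSucc n).symm (A.act.lTensor _ (TensorProduct.assoc k _ C H (v ⊗ₜ h)))) =
          ((iterSucc n).symm.toLinearMap).lTensor A.D (TensorProduct.assoc k _ _ _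
            (A.act.lTensor _ (TensorProduct.assoc k _ C H
              ((A.leftCoactPow n).rTensor C v ⊗ₜ h)))) := by
        induction v with
        | zero => simp
        | add x y hx hy => simp only [map_add, TensorProduct.add_tmul, hx, hy]
        | tmul p q => simp [leftCoactPow_succ]
      rw [galoisLast_eq, gal_tmul, h₁]
      have h₂ : (A.leftCoactPow n).rTensor C (lastCoact n x) = (TensorProduct.assoc k _ _ _).symm
          ((lastCoact n).lTensor A.D (A.leftCoactPow n x)) := by
        rw [← assoc_leftCoactPow_lastCoact, LinearEquiv.symm_apply_apply]
      rw [h₂]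
      generalize A.leftCoactPow n x = v
      induction v with
      | zero => simp
      | add x y hx hy => simp only [map_add, TensorProduct.add_tmul, hx, hy]
      | tmul d t =>
        rw [LinearMap.lTensor_tmul, TensorProduct.assoc_tmul, LinearMap.lTensor_tmul,
          galoisLast_eq, gal_tmul]
        generalize lastCoact n t = v
        induction v with
        | zero => simp
        | add x y hx hy => simp only [map_add, TensorProduct.add_tmul, TensorProduct.tmul_add,
            hx, hy]
        | tmul p q => simp

theorem IsHopfGalois.mem_cyclicCotensor_succ (hA : A.IsHopfGalois) (n : ℕ)
    (w : iter k C C (n + 1)) : w ∈ A.cyclicCotensor (n + 1) ↔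
      ∃ y, A.galoisLast n ((A.cyclicCotensor n).subtype.rTensor H y) = w := by
  rw [mem_cyclicCotensor_iff, hA.mem_cotensorPow_succ (hA.isSubcomodulePow n)]
  have hinj : Function.Injective (A.galoisLast n) := hA.galoisLast_injective n
  constructor
  · rintro ⟨⟨x, hx, rfl⟩, h⟩
    rw [coactDiff_galoisLast, LinearMap.map_eq_zero_iff _ (lTensor_injective _ hinj),
      LinearEquiv.map_eq_zero_iff] at h
    obtain ⟨y, rfl⟩ := exists_rTensor_subtype_inf _ (A.cyclicCotensor n) _
      (fun m h₁ h₂ => (mem_cyclicCotensor_iff n m).2 ⟨h₁, h₂⟩) x hx h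
    exact ⟨y, rfl⟩
  · rintro ⟨y, rfl⟩
    refine ⟨⟨_, ?_, rfl⟩, ?_⟩
    · rw [← LinearMap.comp_apply, ← LinearMap.rTensor_comp]
      have : (A.cotensorPow n).mkQ ∘ₗ (A.cyclicCotensor n).subtype = 0 :=
        LinearMap.ext fun m => (Submodule.Quotient.mk_eq_zero _).2
          ((mem_cyclicCotensor_iff n _).1 m.2).1
      rw [this, LinearMap.rTensor_zero, LinearMap.zero_apply]
    · rw [coactDiff_galoisLast, ← LinearMap.comp_apply (LinearMap.rTensor H _),
        ← LinearMap.rTensor_comp]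
      have : A.coactDiff n ∘ₗ (A.cyclicCotensor n).subtype = 0 :=
        LinearMap.ext fun m => ((mem_cyclicCotensor_iff n _).1 m.2).2
      rw [this, LinearMap.rTensor_zero, LinearMap.zero_apply, map_zero, map_zero]

theorem ψ_zero (x : iter k H A.CD 0) : A.ψ 0 x = iterZero.symm (iterZero x : A.CD).1 := rfl

theorem ψ_succ (n : ℕ) (x : iter k H A.CD n) (h : H) :
    A.ψ (n + 1) ((iterSucc n).symm (x ⊗ₜ h)) = A.galoisLast n (A.ψ n x ⊗ₜ h) := rfl

theorem IsHopfGalois.ψ_injective (hA : A.IsHopfGalois) : ∀ n, Function.Injective (A.ψ n)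
  | 0 => iterZero.symm.injective.comp (Subtype.val_injective.comp iterZero.injective)
  | n + 1 => (hA.galoisLast_injective n).comp ((rTensor_injective _ (hA.ψ_injective n)).comp
      (iterSucc n).injective)

theorem IsHopfGalois.mem_cyclicCotensor_iff_ψ (hA : A.IsHopfGalois) : ∀ (n : ℕ) (w : iter k C C n),
    w ∈ A.cyclicCotensor n ↔ ∃ x, A.ψ n x = w
  | 0, w => by
    obtain ⟨c, rfl⟩ := iterZero.symm.surjective w
    have : iterZero.symm c ∈ A.cyclicCotensor 0 ↔ c ∈ A.CD := by
      have h₁ : TensorProduct.comm k _ A.D (A.rightCoactPow 0 (iterZero.symm c)) =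
          (iterZero.symm.lTensor A.D) (TensorProduct.comm k C A.D (A.rightCoact c)) := by
        simp only [rightCoactPow, LinearMap.comp_apply, LinearEquiv.coe_coe,
          LinearEquiv.apply_symm_apply]
        generalize A.rightCoact c = v
        induction v with
        | zero => simp
        | add x y hx hy => simp only [map_add, hx, hy]
        | tmul p q => simp
      rw [cyclicCotensor, Submodule.mem_inf, CD, mem_coinvariants_iff, mem_coinvariants_iff, h₁]
      have h₂ : A.leftCoactPow 0 (iterZero.symm c) =
        (iterZero.symm.lTensor A.D) (A.leftCoact c) := rfl
      rw [h₂, (iterZero.symm.lTensor A.D).injective.eq_iff]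
      exact ⟨fun h => h.2, fun h => ⟨Submodule.mem_top, h⟩⟩
    rw [this]
    constructor
    · intro h
      exact ⟨iterZero.symm ⟨c, h⟩, rfl⟩
    · rintro ⟨x, hx⟩
      rw [← iterZero.symm.injective hx]
      exact (iterZero x : A.CD).2
  | n + 1, w => by
    rw [hA.mem_cyclicCotensor_succ]
    let g : iter k H A.CD n →ₗ[k] A.cyclicCotensor n :=
      (A.ψ n).codRestrict _ fun x => (hA.mem_cyclicCotensor_iff_ψ n _).2 ⟨x, rfl⟩
    have hg : Function.Surjective g := fun y => by
      obtain ⟨x, hx⟩ := (hA.mem_cyclicCotensor_iff_ψ n _).1 y.2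
      exact ⟨x, Subtype.ext hx⟩
    have h (z) : A.galoisLast n ((A.cyclicCotensor n).subtype.rTensor H (g.rTensor H z)) =
        A.ψ (n + 1) ((iterSucc n).symm z) := by
      rw [← LinearMap.comp_apply (LinearMap.rTensor H _), ← LinearMap.rTensor_comp]
      rfl
    constructor
    · rintro ⟨y, rfl⟩
      obtain ⟨z, rfl⟩ := LinearMap.rTensor_surjective H hg y
      exact ⟨_, (h z).symm⟩
    · rintro ⟨x, rfl⟩
      exact ⟨g.rTensor H (iterSucc n x), (h _).trans (by rw [LinearEquiv.symm_apply_apply])⟩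

end ModuleCoalgebra

/-! ### The stable anti-Yetter-Drinfeld module `C^D` -/

/-- `h⁽¹⁾ ⊗ h⁽²⁾ S(h⁽³⁾) = h ⊗ 1`. -/
theorem comul_mul_antipode {k H : Type*} [Field k] [Ring H] [HopfAlgebra k H] (h : H) :
    (LinearMap.mul' k H ∘ₗ (HopfAlgebra.antipode k).lTensor H).lTensor H
      (TensorProduct.assoc k H H H ((Coalgebra.comul (R := k)).rTensor H
        (Coalgebra.comul (R := k) h))) = h ⊗ₜ 1 := by
  rw [Coalgebra.coassoc_apply, ← LinearMap.comp_apply, ← LinearMap.lTensor_comp,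
    LinearMap.comp_assoc, HopfAlgebra.mul_antipode_lTensor_comul, LinearMap.lTensor_comp,
    LinearMap.comp_apply, Coalgebra.lTensor_counit_comul]
  simp

namespace ModuleCoalgebra

variable {k : Type*} [Field k] {H : Type u} [Ring H] [HopfAlgebra k H]
  {C : Type u} [AddCommGroup C] [Module k C] [Coalgebra k C] {A : ModuleCoalgebra k H C}

theorem galoisMap_tmul (c : C) (h : H) : A.galoisMap (c ⊗ₜ h) =
    A.act.lTensor C (TensorProduct.assoc k C C H (Coalgebra.comul (R := k) c ⊗ₜ h)) := rfl

/-- `m₍₀₎ ε(m₍₁₎ ◁ h) = ε(h) m`. -/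
theorem counit_gal {M : Type*} [AddCommGroup M] [Module k M] {ρ : M →ₗ[k] M ⊗[k] C}
    (hρ : IsRightComodule ρ) (m : M) (h : H) :
    TensorProduct.rid k M ((Coalgebra.counit (R := k)).lTensor M (A.gal ρ (m ⊗ₜ h))) =
      Coalgebra.counit (R := k) h • m := by
  conv_rhs => rw [← hρ.counit m]
  rw [gal_tmul]
  generalize ρ m = v
  induction v with
  | zero => simp
  | add x y hx hy => simp only [map_add, TensorProduct.add_tmul, hx, hy, smul_add]
  | tmul p q => simp [A.counit_act, smul_smul, mul_comm]

/-- `ε(c⁽¹⁾) c⁽²⁾ ◁ h = c ◁ h`. -/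
theorem counit_galoisMap (x : C ⊗[k] H) :
    TensorProduct.lid k C ((Coalgebra.counit (R := k)).rTensor C (A.galoisMap x)) = A.act x := by
  induction x with
  | zero => simp
  | add x y hx hy => simp only [map_add, hx, hy]
  | tmul c h =>
    have h₁ (v : C ⊗[k] C) : TensorProduct.lid k C ((Coalgebra.counit (R := k)).rTensor C
        (A.act.lTensor C (TensorProduct.assoc k C C H (v ⊗ₜ h)))) =
        A.act (TensorProduct.lid k C ((Coalgebra.counit (R := k)).rTensor C v) ⊗ₜ h) := by
      induction v with
      | zero => simp
      | add x y hx hy => simp only [map_add, TensorProduct.add_tmul, hx, hy]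
      | tmul p q => simp [← TensorProduct.smul_tmul']
    rw [galoisMap_tmul, h₁, Coalgebra.rTensor_counit_comul, TensorProduct.lid_tmul, one_smul]

theorem mem_CD_iff (c : C) :
    c ∈ A.CD ↔ TensorProduct.comm k C A.D (A.rightCoact c) = A.leftCoact c :=
  mem_coinvariants_iff _ _ _

variable (A) in
theorem act_mem_CD {c : C} (hc : c ∈ A.CD) (h : H) : A.act (c ⊗ₜ h) ∈ A.CD := by
  rw [mem_CD_iff] at hc ⊢
  have h₁ (v : C ⊗[k] C) (u : H ⊗[k] H) : A.π.lTensor C (TensorProduct.map A.act A.act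
      (TensorProduct.tensorTensorTensorComm k C C H H (v ⊗ₜ u))) = A.act.rTensor A.D
        (TensorProduct.rightComm k C A.D H (A.π.lTensor C v ⊗ₜ TensorProduct.rid k H
          ((Coalgebra.counit (R := k)).lTensor H u))) := by
    induction v with
    | zero => simp
    | add x y hx hy => simp only [map_add, TensorProduct.add_tmul, hx, hy]
    | tmul p q =>
      induction u with
      | zero => simp
      | add x y hx hy => simp only [map_add, TensorProduct.tmul_add, hx, hy]
      | tmul a b =>
        rw [TensorProduct.tensorTensorTensorComm_tmul, TensorProduct.map_tmul,
          LinearMap.lTensor_tmul, π_act]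
        simp
  have h₂ (v : C ⊗[k] C) (u : H ⊗[k] H) : A.π.rTensor C (TensorProduct.map A.act A.act
      (TensorProduct.tensorTensorTensorComm k C C H H (v ⊗ₜ u))) = A.act.lTensor A.D
        (TensorProduct.assoc k A.D C H (A.π.rTensor C v ⊗ₜ TensorProduct.lid k H
          ((Coalgebra.counit (R := k)).rTensor H u))) := by
    induction v with
    | zero => simp
    | add x y hx hy => simp only [map_add, TensorProduct.add_tmul, hx, hy]
    | tmul p q =>
      induction u with
      | zero => simp
      | add x y hx hy => simp only [map_add, TensorProduct.tmul_add, hx, hy]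
      | tmul a b =>
        rw [TensorProduct.tensorTensorTensorComm_tmul, TensorProduct.map_tmul,
          LinearMap.rTensor_tmul, π_act]
        simp [TensorProduct.smul_tmul]
  have h₃ (v : C ⊗[k] A.D) : TensorProduct.comm k C A.D (A.act.rTensor A.D
      (TensorProduct.rightComm k C A.D H (v ⊗ₜ h))) = A.act.lTensor A.D
        (TensorProduct.assoc k A.D C H (TensorProduct.comm k C A.D v ⊗ₜ h)) := by
    induction v with
    | zero => simp
    | add x y hx hy => simp only [map_add, TensorProduct.add_tmul, hx, hy]
    | tmul p q => simp
  rw [rightCoact, leftCoact, LinearMap.comp_apply, LinearMap.comp_apply, A.comul_act, h₁, h₂,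
    Coalgebra.rTensor_counit_comul, Coalgebra.lTensor_counit_comul, TensorProduct.rid_tmul,
    TensorProduct.lid_tmul, one_smul, h₃]
  rw [rightCoact, leftCoact, LinearMap.comp_apply, LinearMap.comp_apply] at hc
  rw [hc]

/-- For `c ∈ C^D`, applying `Δ` to `c⁽¹⁾ ⊗ π(c⁽²⁾) = c⁽²⁾ ⊗ π(c⁽¹⁾)` gives
`c⁽²⁾ ⊗ π(c⁽³⁾) ⊗ c⁽¹⁾ = c⁽³⁾ ⊗ π(c⁽¹⁾) ⊗ c⁽²⁾`. -/
theorem comm_comul_mem_cotensorSq {c : C} (hc : c ∈ A.CD) :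
    TensorProduct.comm k C C (Coalgebra.comul (R := k) c) ∈ A.cotensorSq := by
  rw [mem_CD_iff] at hc
  rw [cotensorSq, cotensor, LinearMap.mem_eqLocus, LinearMap.comp_apply, LinearEquiv.coe_coe]
  let P : A.D ⊗[k] (C ⊗[k] C) →ₗ[k] C ⊗[k] (A.D ⊗[k] C) :=
    (TensorProduct.comm k _ _).toLinearMap ∘ₗ (TensorProduct.assoc k _ _ _).symm.toLinearMap
  let Φ₁ : C ⊗[k] (C ⊗[k] C) →ₗ[k] C ⊗[k] (A.D ⊗[k] C) :=
    (A.π.rTensor C ∘ₗ (TensorProduct.comm k C C).toLinearMap).lTensor C ∘ₗ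
      (TensorProduct.leftComm k C C C).toLinearMap
  let Φ₂ : C ⊗[k] (C ⊗[k] C) →ₗ[k] C ⊗[k] (A.D ⊗[k] C) :=
    (A.π.rTensor C).lTensor C ∘ₗ (TensorProduct.comm k _ _).toLinearMap ∘ₗ
      (TensorProduct.assoc k _ _ _).symm.toLinearMap
  have h₁ (v : C ⊗[k] C) : TensorProduct.assoc k C A.D C (A.rightCoact.rTensor C
      (TensorProduct.comm k C C v)) = Φ₁ ((Coalgebra.comul (R := k)).lTensor C v) := by
    induction v with
    | zero => simp
    | add x y hx hy => simp only [map_add, hx, hy]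
    | tmul p q =>
      simp only [TensorProduct.comm_tmul, LinearMap.rTensor_tmul, LinearMap.lTensor_tmul,
        rightCoact, LinearMap.comp_apply]
      generalize Coalgebra.comul (R := k) q = v
      induction v with
      | zero => simp
      | add x y hx hy => simp only [map_add, TensorProduct.add_tmul, TensorProduct.tmul_add, hx, hy]
      | tmul p q => simp [Φ₁]
  have h₂ (v : C ⊗[k] C) : P ((Coalgebra.comul (R := k)).lTensor A.D (TensorProduct.comm k C A.D
      (A.π.lTensor C v))) = Φ₁ (TensorProduct.assoc k C C C
        ((Coalgebra.comul (R := k)).rTensor C v)) := by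
    induction v with
    | zero => simp
    | add x y hx hy => simp only [map_add, hx, hy]
    | tmul p q =>
      simp only [TensorProduct.comm_tmul, LinearMap.rTensor_tmul, LinearMap.lTensor_tmul]
      generalize Coalgebra.comul (R := k) p = v
      induction v with
      | zero => simp
      | add x y hx hy => simp only [map_add, TensorProduct.add_tmul, TensorProduct.tmul_add, hx, hy]
      | tmul p q => simp [Φ₁, P]
  have h₃ (v : C ⊗[k] C) : A.leftCoact.lTensor C (TensorProduct.comm k C C v) =
      Φ₂ (TensorProduct.assoc k C C C ((Coalgebra.comul (R := k)).rTensor C v)) := by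
    induction v with
    | zero => simp
    | add x y hx hy => simp only [map_add, hx, hy]
    | tmul p q =>
      simp only [TensorProduct.comm_tmul, LinearMap.rTensor_tmul, LinearMap.lTensor_tmul,
        leftCoact, LinearMap.comp_apply]
      generalize Coalgebra.comul (R := k) p = v
      induction v with
      | zero => simp
      | add x y hx hy => simp only [map_add, TensorProduct.add_tmul, TensorProduct.tmul_add, hx, hy]
      | tmul p q => simp [Φ₂]
  have h₄ (v : C ⊗[k] C) : P ((Coalgebra.comul (R := k)).lTensor A.D (A.π.rTensor C v)) =
      Φ₂ ((Coalgebra.comul (R := k)).lTensor C v) := by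
    induction v with
    | zero => simp
    | add x y hx hy => simp only [map_add, hx, hy]
    | tmul p q =>
      simp only [LinearMap.rTensor_tmul, LinearMap.lTensor_tmul]
      generalize Coalgebra.comul (R := k) q = v
      induction v with
      | zero => simp
      | add x y hx hy => simp only [map_add, TensorProduct.tmul_add, hx, hy]
      | tmul p q => simp [Φ₂, P]
  rw [h₁, h₃, ← Coalgebra.coassoc_apply, ← h₂, Coalgebra.coassoc_apply, ← h₄]
  exact congrArg (fun w => P ((Coalgebra.comul (R := k)).lTensor A.D w)) hc

theorem rotate_comulAt_iterZero (c : C) :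
    rotate 1 (comulAt 0 0 (iterZero.symm c)) = (iterSucc 0).symm
      ((iterZero.symm.toLinearMap).rTensor C (TensorProduct.comm k C C (Coalgebra.comul (R := k) c))) := by
  rw [comulAt_self, lastCoact_iterZero]
  generalize Coalgebra.comul (R := k) c = v
  induction v with
  | zero => simp
  | add x y hx hy => simp only [map_add, hx, hy]
  | tmul p q => simp [rotate_one]

theorem galoisLast_zero (x : C ⊗[k] H) :
    A.galoisLast 0 ((iterZero.symm.toLinearMap).rTensor H x) =
      (iterSucc 0).symm ((iterZero.symm.toLinearMap).rTensor C (A.galoisMap x)) := by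
  rw [galoisLast_eq, A.gal_rTensor iterZero.symm.toLinearMap lastCoact_iterZero]
  rfl

/-- `c⁽²⁾ ⊗ c⁽¹⁾` lies in the cyclic cotensor product `(C □_D C)^D` for `c ∈ C^D`; both
`D`-coactions produce `π(c⁽²⁾) ⊗ c⁽³⁾ ⊗ c⁽¹⁾`. -/
theorem IsHopfGalois.rotate_comulAt_mem (hA : A.IsHopfGalois) {c : C} (hc : c ∈ A.CD) :
    rotate 1 (comulAt 0 0 (iterZero.symm c)) ∈ A.cyclicCotensor 1 := by
  rw [mem_cyclicCotensor_iff]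
  constructor
  · obtain ⟨x, hx⟩ := (hA.mem_cotensorSq_iff _).1 (comm_comul_mem_cotensorSq hc)
    refine (hA.mem_cotensorPow_succ (hA.isSubcomodulePow 0) _).2
      ⟨(iterZero.symm.toLinearMap).rTensor H x, ?_, ?_⟩
    · rw [cotensorPow_zero_mkQ, LinearMap.rTensor_zero, LinearMap.zero_apply]
    · rw [galoisLast_zero, hx, rotate_comulAt_iterZero]
  · rw [rotate_comulAt_iterZero, coactDiff, LinearMap.sub_apply, sub_eq_zero, LinearMap.comp_apply,
      rightCoactPow_eq, lastCoact_iterSucc]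
    let Φ : C ⊗[k] (C ⊗[k] C) →ₗ[k] A.D ⊗[k] iter k C C 1 :=
      TensorProduct.map A.π ((iterSucc 0).symm.toLinearMap ∘ₗ
        (iterZero.symm.toLinearMap).rTensor C ∘ₗ (TensorProduct.comm k C C).toLinearMap) ∘ₗ
      (TensorProduct.leftComm k C C C).toLinearMap
    have h₁ (v : C ⊗[k] C) : TensorProduct.comm k _ A.D (A.π.lTensor _
        (((iterSucc 0).symm.toLinearMap).rTensor C (tensorCoact k C _
          ((iterZero.symm.toLinearMap).rTensor C (TensorProduct.comm k C C v))))) =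
        Φ (TensorProduct.assoc k C C C ((Coalgebra.comul (R := k)).rTensor C v)) := by
      induction v with
      | zero => simp
      | add x y hx hy => simp only [map_add, hx, hy]
      | tmul p q =>
        simp only [TensorProduct.comm_tmul, LinearMap.rTensor_tmul, LinearMap.lTensor_tmul,
          tensorCoact, LinearMap.comp_apply]
        generalize Coalgebra.comul (R := k) p = v
        induction v with
        | zero => simp
        | add x y hx hy => simp only [map_add, TensorProduct.add_tmul, TensorProduct.tmul_add,
            hx, hy]
        | tmul p q => simp [Φ]
    have h₂ (v : C ⊗[k] C) : A.leftCoactPow 1 ((iterSucc 0).symm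
        ((iterZero.symm.toLinearMap).rTensor C (TensorProduct.comm k C C v))) =
        Φ ((Coalgebra.comul (R := k)).lTensor C v) := by
      induction v with
      | zero => simp
      | add x y hx hy => simp only [map_add, hx, hy]
      | tmul p q =>
        simp only [TensorProduct.comm_tmul, LinearMap.rTensor_tmul, LinearMap.lTensor_tmul,
          leftCoactPow_succ]
        simp only [leftCoactPow, leftCoact, LinearMap.comp_apply, LinearEquiv.coe_coe,
          LinearEquiv.apply_symm_apply]
        generalize Coalgebra.comul (R := k) q = v
        induction v with
        | zero => simp
        | add x y hx hy => simp only [map_add, TensorProduct.add_tmul, TensorProduct.tmul_add,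
            hx, hy]
        | tmul p q => simp [Φ]
    rw [h₂, ← Coalgebra.coassoc_apply, ← h₁]
    rfl

theorem IsHopfGalois.exists_coact (hA : A.IsHopfGalois) (c : A.CD) :
    ∃ x : A.CD ⊗[k] H, A.galoisMap (A.CD.subtype.rTensor H x) =
      TensorProduct.comm k C C (Coalgebra.comul (R := k) (c : C)) := by
  obtain ⟨y, hy⟩ := (hA.mem_cyclicCotensor_iff_ψ 1 _).1 (hA.rotate_comulAt_mem c.2)
  obtain ⟨y, rfl⟩ := (iterSucc 0).symm.surjective y
  refine ⟨(iterZero.toLinearMap).rTensor H y, ?_⟩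
  rw [rotate_comulAt_iterZero] at hy
  have hy' : A.galoisLast 0 ((iterZero.symm.toLinearMap).rTensor H (A.CD.subtype.rTensor H
      ((iterZero.toLinearMap).rTensor H y))) = _ := Eq.trans (congrArg (A.galoisLast 0) ?_) hy
  · rw [galoisLast_zero] at hy'
    exact (iterZero.symm.rTensor C).injective ((iterSucc 0).symm.injective hy')
  · rw [← LinearMap.comp_apply, ← LinearMap.comp_apply, ← LinearMap.rTensor_comp,
      ← LinearMap.rTensor_comp]
    rfl

theorem IsHopfGalois.galoisMap_CD_injective (hA : A.IsHopfGalois) :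
    Function.Injective (A.galoisMap ∘ₗ A.CD.subtype.rTensor H) :=
  hA.galoisMap_injective.comp (rTensor_injective _ Subtype.val_injective)

/-- The coaction of `C^D` with its tensor factors exchanged, `c ↦ c₍₀₎ ⊗ c₍₋₁₎`. It is
characterized by `c₍₀₎⁽¹⁾ ⊗ c₍₀₎⁽²⁾ ◁ c₍₋₁₎ = c⁽²⁾ ⊗ c⁽¹⁾`. -/
def IsHopfGalois.coactFlip (hA : A.IsHopfGalois) : A.CD →ₗ[k] A.CD ⊗[k] H :=
  (LinearEquiv.ofInjective _ hA.galoisMap_CD_injective).symm.toLinearMap ∘ₗ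
    ((TensorProduct.comm k C C).toLinearMap ∘ₗ Coalgebra.comul ∘ₗ A.CD.subtype).codRestrict _
      fun c => hA.exists_coact c

theorem IsHopfGalois.galoisMap_coactFlip (hA : A.IsHopfGalois) (c : A.CD) :
    A.galoisMap (A.CD.subtype.rTensor H (hA.coactFlip c)) =
      TensorProduct.comm k C C (Coalgebra.comul (R := k) (c : C)) :=
  congrArg Subtype.val ((LinearEquiv.ofInjective _ hA.galoisMap_CD_injective).apply_symm_apply
    (((TensorProduct.comm k C C).toLinearMap ∘ₗ Coalgebra.comul ∘ₗ A.CD.subtype).codRestrict _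
      (fun c => hA.exists_coact c) c))

end ModuleCoalgebra

namespace ModuleCoalgebra

variable {k : Type*} [Field k] {H : Type u} [Ring H] [HopfAlgebra k H]
  {C : Type u} [AddCommGroup C] [Module k C] [Coalgebra k C] {A : ModuleCoalgebra k H C}

variable (A) in
/-- The right `H`-action on `C^D`. -/
def actCD : A.CD ⊗[k] H →ₗ[k] A.CD :=
  (A.act ∘ₗ A.CD.subtype.rTensor H).codRestrict A.CD fun x => by
    induction x with
    | zero => simp
    | add x y hx hy => rw [map_add]; exact add_mem hx hy
    | tmul c h => exact A.act_mem_CD c.2 h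

theorem coe_actCD (x : A.CD ⊗[k] H) :
    (A.actCD x : C) = A.act (A.CD.subtype.rTensor H x) := rfl

/-- Colinearity of the Galois map: from `x = c ⊗ h` both sides produce
`(c⁽²⁾ ⊗ c⁽³⁾ ◁ h) ⊗ c⁽¹⁾`. -/
theorem galoisMap_comul (x : C ⊗[k] H) :
    A.galoisMap.rTensor C (TensorProduct.comm k C (C ⊗[k] H) (TensorProduct.assoc k C C H
      ((Coalgebra.comul (R := k)).rTensor H x))) =
    TensorProduct.comm k C (C ⊗[k] C) (TensorProduct.assoc k C C C
      ((Coalgebra.comul (R := k)).rTensor C (A.galoisMap x))) := by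
  induction x with
  | zero => simp
  | add x y hx hy => simp only [map_add, hx, hy]
  | tmul c h =>
    let Φ : C ⊗[k] (C ⊗[k] C) →ₗ[k] (C ⊗[k] C) ⊗[k] C :=
      (TensorProduct.comm k _ _).toLinearMap ∘ₗ
        ((A.act ∘ₗ (TensorProduct.mk k C H).flip h).lTensor C).lTensor C
    have h₁ (v : C ⊗[k] C) : A.galoisMap.rTensor C (TensorProduct.comm k C (C ⊗[k] H)
        (TensorProduct.assoc k C C H (v ⊗ₜ h))) = Φ ((Coalgebra.comul (R := k)).lTensor C v) := by
      induction v with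
      | zero => simp
      | add x y hx hy => simp only [map_add, TensorProduct.add_tmul, hx, hy]
      | tmul p q =>
        simp only [TensorProduct.assoc_tmul, TensorProduct.comm_tmul, LinearMap.rTensor_tmul,
          LinearMap.lTensor_tmul, galoisMap_tmul]
        generalize Coalgebra.comul (R := k) q = v
        induction v with
        | zero => simp
        | add x y hx hy => simp only [map_add, TensorProduct.add_tmul, TensorProduct.tmul_add,
            hx, hy]
        | tmul p q => simp [Φ]
    have h₂ (v : C ⊗[k] C) : TensorProduct.comm k C (C ⊗[k] C) (TensorProduct.assoc k C C C
        ((Coalgebra.comul (R := k)).rTensor C (A.act.lTensor C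
          (TensorProduct.assoc k C C H (v ⊗ₜ h))))) =
        Φ (TensorProduct.assoc k C C C ((Coalgebra.comul (R := k)).rTensor C v)) := by
      induction v with
      | zero => simp
      | add x y hx hy => simp only [map_add, TensorProduct.add_tmul, hx, hy]
      | tmul p q =>
        simp only [TensorProduct.assoc_tmul, LinearMap.rTensor_tmul, LinearMap.lTensor_tmul]
        generalize Coalgebra.comul (R := k) p = v
        induction v with
        | zero => simp
        | add x y hx hy => simp only [map_add, TensorProduct.add_tmul, hx, hy]
        | tmul p q => simp [Φ]
    rw [LinearMap.rTensor_tmul, galoisMap_tmul, h₁, h₂, Coalgebra.coassoc_apply]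

/-- Both sides are `(c⁽³⁾ ⊗ c⁽¹⁾) ⊗ c⁽²⁾`. -/
theorem tensorCoact_comm_comul (c : C) :
    tensorCoact k C C (TensorProduct.comm k C C (Coalgebra.comul (R := k) c)) =
      comulCyc (k := k) c := by
  rw [comulCyc, LinearMap.comp_apply, LinearMap.comp_apply, LinearMap.comp_apply]
  generalize Coalgebra.comul (R := k) c = v
  induction v with
  | zero => simp
  | add x y hx hy => simp only [map_add, hx, hy]
  | tmul p q => simp [tensorCoact]

theorem comm_assoc_comul_comm_comul (c : C) :
    TensorProduct.comm k C (C ⊗[k] C) (TensorProduct.assoc k C C C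
      ((Coalgebra.comul (R := k)).rTensor C (TensorProduct.comm k C C
        (Coalgebra.comul (R := k) c)))) = comulCyc (k := k) c := by
  let Φ : C ⊗[k] (C ⊗[k] C) →ₗ[k] (C ⊗[k] C) ⊗[k] C :=
    (TensorProduct.assoc k _ _ _).symm.toLinearMap ∘ₗ (TensorProduct.comm k _ _).toLinearMap ∘ₗ
      (TensorProduct.assoc k _ _ _).symm.toLinearMap
  have h₁ (v : C ⊗[k] C) : TensorProduct.comm k C (C ⊗[k] C) (TensorProduct.assoc k C C C
      ((Coalgebra.comul (R := k)).rTensor C (TensorProduct.comm k C C v))) =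
      Φ ((Coalgebra.comul (R := k)).lTensor C v) := by
    induction v with
    | zero => simp
    | add x y hx hy => simp only [map_add, hx, hy]
    | tmul p q =>
      simp only [TensorProduct.comm_tmul, LinearMap.rTensor_tmul, LinearMap.lTensor_tmul]
      generalize Coalgebra.comul (R := k) q = v
      induction v with
      | zero => simp
      | add x y hx hy => simp only [map_add, TensorProduct.add_tmul, TensorProduct.tmul_add, hx, hy]
      | tmul p q => simp [Φ]
  rw [h₁, ← Coalgebra.coassoc_apply]
  simp [Φ, comulCyc]

/-- `c ⊗ g ⊗ h ↦ c⁽¹⁾ ⊗ c⁽²⁾ ◁ h ⊗ c⁽³⁾ ◁ g`. -/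
def galoisTwice (A : ModuleCoalgebra k H C) : (C ⊗[k] H) ⊗[k] H →ₗ[k] (C ⊗[k] C) ⊗[k] C :=
  A.galoisMap.rTensor C ∘ₗ (TensorProduct.rightComm k C C H).toLinearMap ∘ₗ
    A.galoisMap.rTensor H

theorem IsHopfGalois.galoisTwice_injective (hA : A.IsHopfGalois) :
    Function.Injective A.galoisTwice :=
  (rTensor_injective _ hA.galoisMap_injective).comp
    ((TensorProduct.rightComm k C C H).injective.comp
      (rTensor_injective _ hA.galoisMap_injective))

/-- Both sides of the coassociativity of the coaction have the image
`c⁽³⁾ ⊗ c⁽¹⁾ ⊗ c⁽²⁾` under `galoisTwice`. -/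
theorem IsHopfGalois.coactFlip_coassoc (hA : A.IsHopfGalois) (m : A.CD) :
    (TensorProduct.assoc k A.CD H H).symm ((TensorProduct.comm k H H).toLinearMap.lTensor A.CD
      ((Coalgebra.comul (R := k)).lTensor A.CD (hA.coactFlip m))) =
    hA.coactFlip.rTensor H (hA.coactFlip m) := by
  have hinj : Function.Injective (A.galoisTwice ∘ₗ (A.CD.subtype.rTensor H).rTensor H) :=
    hA.galoisTwice_injective.comp
      (rTensor_injective _ (rTensor_injective _ Subtype.val_injective))
  apply hinj
  have h₁ (x : A.CD ⊗[k] H) : A.galoisTwice ((A.CD.subtype.rTensor H).rTensor H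
      ((TensorProduct.assoc k A.CD H H).symm ((TensorProduct.comm k H H).toLinearMap.lTensor A.CD
        ((Coalgebra.comul (R := k)).lTensor A.CD x)))) =
      tensorCoact k C C (A.galoisMap (A.CD.subtype.rTensor H x)) := by
    induction x with
    | zero => simp
    | add x y hx hy => simp only [map_add, hx, hy]
    | tmul c h =>
      rw [LinearMap.rTensor_tmul, galoisMap_eq_gal, tensorCoact_gal IsRightComodule.self,
        LinearMap.lTensor_tmul, LinearMap.lTensor_tmul, LinearEquiv.coe_coe]
      generalize Coalgebra.comul (R := k) h = v
      induction v with
      | zero => simp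
      | add x y hx hy => simp only [map_add, TensorProduct.tmul_add, hx, hy]
      | tmul p q =>
        simp only [TensorProduct.comm_tmul, TensorProduct.assoc_symm_tmul, LinearMap.rTensor_tmul,
          galoisTwice, LinearMap.comp_apply, galoisMap_tmul, LinearEquiv.coe_coe]
        generalize Coalgebra.comul (R := k) (A.CD.subtype c) = v
        induction v with
        | zero => simp
        | add x y hx hy => simp only [map_add, TensorProduct.add_tmul, hx, hy]
        | tmul p q => simp [galoisMap_eq_gal]
  have h₂ (x : A.CD ⊗[k] H) : A.galoisTwice ((A.CD.subtype.rTensor H).rTensor H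
      (hA.coactFlip.rTensor H x)) = A.galoisMap.rTensor C (TensorProduct.comm k C (C ⊗[k] H)
        (TensorProduct.assoc k C C H ((Coalgebra.comul (R := k)).rTensor H
          (A.CD.subtype.rTensor H x)))) := by
    induction x with
    | zero => simp
    | add x y hx hy => simp only [map_add, hx, hy]
    | tmul c h =>
      rw [galoisTwice, LinearMap.comp_apply, LinearMap.comp_apply, LinearMap.rTensor_tmul,
        LinearMap.rTensor_tmul, LinearMap.rTensor_tmul, hA.galoisMap_coactFlip,
        LinearMap.rTensor_tmul, LinearMap.rTensor_tmul, Submodule.subtype_apply]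
      congr 1
      generalize Coalgebra.comul (R := k) (c : C) = v
      induction v with
      | zero => simp
      | add x y hx hy => simp only [map_add, TensorProduct.add_tmul, hx, hy]
      | tmul p q => simp
  rw [LinearMap.comp_apply, LinearMap.comp_apply, h₁, h₂, galoisMap_comul, hA.galoisMap_coactFlip,
    tensorCoact_comm_comul, comm_assoc_comul_comm_comul]

variable (A) in
/-- `u⁽¹⁾ ◁ b⁽¹⁾ ⊗ u⁽²⁾ ◁ b⁽²⁾ S(b⁽³⁾) y = u⁽¹⁾ ◁ b ⊗ u⁽²⁾ ◁ y`. -/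
theorem galoisMap_act_antipode (u : C) (b y : H) :
    A.galoisMap (TensorProduct.map (A.act ∘ₗ TensorProduct.mk k C H u)
      (LinearMap.mulRight k y ∘ₗ HopfAlgebra.antipode k) (Coalgebra.comul (R := k) b)) =
    TensorProduct.map A.act A.act (TensorProduct.tensorTensorTensorComm k C C H H
      (Coalgebra.comul (R := k) u ⊗ₜ (b ⊗ₜ y))) := by
  have h₁ (t : H ⊗[k] H) : A.galoisMap (TensorProduct.map (A.act ∘ₗ TensorProduct.mk k C H u)
      (LinearMap.mulRight k y ∘ₗ HopfAlgebra.antipode k) t) =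
      TensorProduct.map A.act A.act (TensorProduct.tensorTensorTensorComm k C C H H
        (Coalgebra.comul (R := k) u ⊗ₜ ((LinearMap.mulRight k y).lTensor H
          ((LinearMap.mul' k H ∘ₗ (HopfAlgebra.antipode k).lTensor H).lTensor H
            (TensorProduct.assoc k H H H ((Coalgebra.comul (R := k)).rTensor H t)))))) := by
    induction t with
    | zero => simp
    | add x y hx hy => simp only [map_add, TensorProduct.tmul_add, hx, hy]
    | tmul p q =>
      rw [TensorProduct.map_tmul, galoisMap_tmul, LinearMap.comp_apply, TensorProduct.mk_apply,
        A.comul_act, LinearMap.rTensor_tmul]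
      generalize Coalgebra.comul (R := k) p = v
      generalize Coalgebra.comul (R := k) u = w
      induction w with
      | zero => simp
      | add x y hx hy => simp only [map_add, TensorProduct.add_tmul, hx, hy]
      | tmul p' q' =>
        induction v with
        | zero => simp
        | add x y hx hy => simp only [map_add, TensorProduct.add_tmul, TensorProduct.tmul_add,
            hx, hy]
        | tmul p q => simp [A.act_mul, mul_assoc]
  rw [h₁, comul_mul_antipode, LinearMap.lTensor_tmul, LinearMap.mulRight_apply, one_mul]

/-- `galoisMap_act_antipode` with `y = g h⁽¹⁾`, in the form needed for the anti-Yetter-Drinfeld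
condition. -/
theorem sum_galoisMap_antipode (u : C) (g h : H) {r : ℕ} (h₁ h₂ h₃ : Fin r → H)
    (hh : (Coalgebra.comul (R := k)).lTensor H (Coalgebra.comul (R := k) h) =
      ∑ i, h₁ i ⊗ₜ[k] (h₂ i ⊗ₜ[k] h₃ i)) :
    A.galoisMap (∑ i, A.act (u ⊗ₜ h₂ i) ⊗ₜ[k] (HopfAlgebra.antipode k (h₃ i) * g * h₁ i)) =
      TensorProduct.map A.act A.act (TensorProduct.tensorTensorTensorComm k C C H H
        (A.galoisMap (u ⊗ₜ g) ⊗ₜ TensorProduct.comm k H H (Coalgebra.comul (R := k) h))) := by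
  let W : H ⊗[k] (H ⊗[k] H) →ₗ[k] C ⊗[k] C := A.galoisMap ∘ₗ
    TensorProduct.map (A.act ∘ₗ TensorProduct.mk k C H u) (LinearMap.mul' k H ∘ₗ
      TensorProduct.map (HopfAlgebra.antipode k) (LinearMap.mulLeft k g) ∘ₗ
        (TensorProduct.comm k H H).toLinearMap) ∘ₗ (TensorProduct.leftComm k H H H).toLinearMap
  have hW (a : H) (t : H ⊗[k] H) : W (a ⊗ₜ t) = A.galoisMap (TensorProduct.map
      (A.act ∘ₗ TensorProduct.mk k C H u)
        (LinearMap.mulRight k (g * a) ∘ₗ HopfAlgebra.antipode k) t) := by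
    induction t with
    | zero => simp
    | add x y hx hy => simp only [map_add, TensorProduct.tmul_add, hx, hy]
    | tmul p q => simp [W, mul_assoc]
  have hW' (t : H ⊗[k] H) : W ((Coalgebra.comul (R := k)).lTensor H t) =
      TensorProduct.map A.act A.act (TensorProduct.tensorTensorTensorComm k C C H H
        (A.galoisMap (u ⊗ₜ g) ⊗ₜ TensorProduct.comm k H H t)) := by
    induction t with
    | zero => simp
    | add x y hx hy => simp only [map_add, TensorProduct.tmul_add, hx, hy]
    | tmul a b =>
      rw [LinearMap.lTensor_tmul, hW, galoisMap_act_antipode, galoisMap_tmul]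
      generalize Coalgebra.comul (R := k) u = w
      induction w with
      | zero => simp
      | add x y hx hy => simp only [map_add, TensorProduct.add_tmul, hx, hy]
      | tmul p q => simp [A.act_mul]
  rw [← hW', hh, map_sum, map_sum]
  refine Finset.sum_congr rfl fun i _ => ?_
  simp [W, mul_assoc]

/-- The stable anti-Yetter-Drinfeld module `C^D`. -/
def IsHopfGalois.sayd (hA : A.IsHopfGalois) : SAYD k H A.CD where
  act := A.actCD
  coact := (TensorProduct.comm k A.CD H).toLinearMap ∘ₗ hA.coactFlip
  act_one m := Subtype.ext (A.act_one m)
  act_mul m g h := Subtype.ext (A.act_mul m g h)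
  coact_counit m := Subtype.ext <| by
    have h₁ (x : A.CD ⊗[k] H) : ((TensorProduct.lid k A.CD ((Coalgebra.counit (R := k)).rTensor A.CD
        (TensorProduct.comm k A.CD H x)) : A.CD) : C) = TensorProduct.rid k C
          ((Coalgebra.counit (R := k)).lTensor C (A.galoisMap (A.CD.subtype.rTensor H x))) := by
      induction x with
      | zero => simp
      | add x y hx hy => simp only [map_add, Submodule.coe_add, hx, hy]
      | tmul c h =>
        rw [LinearMap.rTensor_tmul, galoisMap_eq_gal, counit_gal IsRightComodule.self]
        simp
    rw [LinearMap.comp_apply, LinearEquiv.coe_coe, h₁, hA.galoisMap_coactFlip]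
    have h₂ (v : C ⊗[k] C) : TensorProduct.rid k C ((Coalgebra.counit (R := k)).lTensor C
        (TensorProduct.comm k C C v)) = TensorProduct.lid k C
          ((Coalgebra.counit (R := k)).rTensor C v) := by
      induction v with
      | zero => simp
      | add x y hx hy => simp only [map_add, hx, hy]
      | tmul c h => simp
    rw [h₂, Coalgebra.rTensor_counit_comul, TensorProduct.lid_tmul, one_smul]
  coact_coassoc m := by
    let P : (A.CD ⊗[k] H) ⊗[k] H →ₗ[k] H ⊗[k] (H ⊗[k] A.CD) :=
      (TensorProduct.comm k A.CD H).toLinearMap.lTensor H ∘ₗ (TensorProduct.comm k _ _).toLinearMap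
    have h₁ (x : A.CD ⊗[k] H) : TensorProduct.assoc k H H A.CD ((Coalgebra.comul (R := k)).rTensor
        A.CD (TensorProduct.comm k A.CD H x)) = P ((TensorProduct.assoc k A.CD H H).symm
          ((TensorProduct.comm k H H).toLinearMap.lTensor A.CD
            ((Coalgebra.comul (R := k)).lTensor A.CD x))) := by
      induction x with
      | zero => simp
      | add x y hx hy => simp only [map_add, hx, hy]
      | tmul c h =>
        rw [TensorProduct.comm_tmul, LinearMap.rTensor_tmul, LinearMap.lTensor_tmul]
        generalize Coalgebra.comul (R := k) h = v
        induction v with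
        | zero => simp
        | add x y hx hy => simp only [map_add, TensorProduct.add_tmul, TensorProduct.tmul_add,
            hx, hy]
        | tmul p q => simp [P]
    have h₂ (x : A.CD ⊗[k] H) : ((TensorProduct.comm k A.CD H).toLinearMap ∘ₗ
        hA.coactFlip).lTensor H (TensorProduct.comm k A.CD H x) =
          P (hA.coactFlip.rTensor H x) := by
      induction x with
      | zero => simp
      | add x y hx hy => simp only [map_add, hx, hy]
      | tmul c h => simp [P]
    have h₃ := congrArg P (hA.coactFlip_coassoc m)
    rw [← h₁, ← h₂] at h₃
    exact h₃
  ayd m h r s h₁ h₂ h₃ g m₀ hh hm := by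
    have hm' : hA.coactFlip m = ∑ j, m₀ j ⊗ₜ[k] g j := by
      have := congrArg (TensorProduct.comm k A.CD H).symm hm
      rw [LinearMap.comp_apply, LinearEquiv.coe_coe, LinearEquiv.symm_apply_apply] at this
      simpa using this
    apply (TensorProduct.comm k A.CD H).symm.injective
    rw [LinearMap.comp_apply, LinearEquiv.coe_coe, LinearEquiv.symm_apply_apply]
    apply hA.galoisMap_CD_injective
    rw [LinearMap.comp_apply, LinearMap.comp_apply, hA.galoisMap_coactFlip, Finset.sum_comm]
    have h₄ (v : C ⊗[k] C) (w : H ⊗[k] H) : TensorProduct.comm k C C (TensorProduct.map A.act A.act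
        (TensorProduct.tensorTensorTensorComm k C C H H (v ⊗ₜ w))) =
        TensorProduct.map A.act A.act (TensorProduct.tensorTensorTensorComm k C C H H
          (TensorProduct.comm k C C v ⊗ₜ TensorProduct.comm k H H w)) := by
      induction v with
      | zero => simp
      | add x y hx hy => simp only [map_add, TensorProduct.add_tmul, hx, hy]
      | tmul p q =>
        induction w with
        | zero => simp
        | add x y hx hy => simp only [map_add, TensorProduct.tmul_add, hx, hy]
        | tmul a b => simp
    rw [coe_actCD, LinearMap.rTensor_tmul, A.comul_act, h₄, Submodule.subtype_apply,
      ← hA.galoisMap_coactFlip, hm']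
    simp only [map_sum, TensorProduct.sum_tmul]
    refine Finset.sum_congr rfl fun j _ => ?_
    rw [LinearMap.rTensor_tmul, ← sum_galoisMap_antipode _ _ _ _ _ _ hh, map_sum]
    rfl
  stable m := Subtype.ext <| by
    have h₁ (v : C ⊗[k] C) : TensorProduct.lid k C ((Coalgebra.counit (R := k)).rTensor C
        (TensorProduct.comm k C C v)) = TensorProduct.rid k C
          ((Coalgebra.counit (R := k)).lTensor C v) := by
      induction v with
      | zero => simp
      | add x y hx hy => simp only [map_add, hx, hy]
      | tmul c h => simp
    have h₂ : TensorProduct.comm k H A.CD (((TensorProduct.comm k A.CD H).toLinearMap ∘ₗ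
        hA.coactFlip) m) = hA.coactFlip m :=
      (TensorProduct.comm k A.CD H).symm_apply_apply (hA.coactFlip m)
    rw [h₂, coe_actCD, ← counit_galoisMap, hA.galoisMap_coactFlip, h₁,
      Coalgebra.lTensor_counit_comul, TensorProduct.rid_tmul, one_smul]

theorem IsHopfGalois.galoisInv_codRestrict (hA : A.IsHopfGalois) (x : C ⊗[k] H)
    (hx : A.galoisMap x ∈ A.cotensorSq) : A.galoisInv hA ⟨A.galoisMap x, hx⟩ = x := by
  rw [galoisInv, LinearEquiv.coe_coe, LinearEquiv.symm_apply_eq]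
  rfl

theorem IsHopfGalois.isCanonical_sayd (hA : A.IsHopfGalois) : A.IsCanonical hA hA.sayd where
  act_eq c h := rfl
  coact_eq c := by
    let β : C ⊗[k] H →ₗ[k] A.cotensorSq :=
      A.galoisMap.codRestrict A.cotensorSq fun x => hA.mapsTo (Set.mem_univ x)
    refine ⟨β.rTensor C (TensorProduct.comm k C (C ⊗[k] H) (TensorProduct.assoc k C C H
      ((Coalgebra.comul (R := k)).rTensor H (A.CD.subtype.rTensor H (hA.coactFlip c))))), ?_, ?_⟩
    · rw [← comm_assoc_comul_comm_comul, ← hA.galoisMap_coactFlip, ← galoisMap_comul,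
        ← LinearMap.comp_apply (LinearMap.rTensor C _), ← LinearMap.rTensor_comp]
      rfl
    · have h₁ : A.κ hA ∘ₗ β =
          (TensorProduct.lid k H).toLinearMap ∘ₗ (Coalgebra.counit (R := k)).rTensor H := by
        refine LinearMap.ext fun x => ?_
        rw [κ, LinearMap.comp_apply, LinearMap.comp_apply, LinearMap.comp_apply]
        exact congrArg _ (congrArg _ (hA.galoisInv_codRestrict x _))
      have h₂ (x : C ⊗[k] H) : (A.κ hA ∘ₗ β).rTensor C (TensorProduct.comm k C (C ⊗[k] H)
          (TensorProduct.assoc k C C H ((Coalgebra.comul (R := k)).rTensor H x))) =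
          TensorProduct.comm k C H x := by
        rw [h₁]
        induction x with
        | zero => simp
        | add x y hx hy => simp only [map_add, hx, hy]
        | tmul c h =>
          have h₃ (v : C ⊗[k] C) : ((TensorProduct.lid k H).toLinearMap ∘ₗ
              (Coalgebra.counit (R := k)).rTensor H).rTensor C (TensorProduct.comm k C (C ⊗[k] H)
              (TensorProduct.assoc k C C H (v ⊗ₜ h))) = h ⊗ₜ TensorProduct.rid k C
                ((Coalgebra.counit (R := k)).lTensor C v) := by
            induction v with
            | zero => simp
            | add x y hx hy => simp only [map_add, TensorProduct.add_tmul, TensorProduct.tmul_add,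
                hx, hy]
            | tmul p q => simp [TensorProduct.smul_tmul]
          rw [LinearMap.rTensor_tmul, h₃, Coalgebra.lTensor_counit_comul, TensorProduct.rid_tmul,
            one_smul, TensorProduct.comm_tmul]
      rw [← LinearMap.comp_apply (LinearMap.rTensor C _), ← LinearMap.rTensor_comp, h₂]
      have h₄ (x : A.CD ⊗[k] H) : A.CD.subtype.lTensor H (TensorProduct.comm k A.CD H x) =
          TensorProduct.comm k C H (A.CD.subtype.rTensor H x) := by
        induction x with
        | zero => simp
        | add x y hx hy => simp only [map_add, hx, hy]
        | tmul p q => simp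
      exact h₄ _

end ModuleCoalgebra

/-! ### Compatibility of `ψ` with the operators -/

namespace SAYD

variable {k : Type*} [Field k] {H : Type u} [Ring H] [HopfAlgebra k H]
  {M : Type u} [AddCommGroup M] [Module k M]

theorem insertOne_self : ∀ (n : ℕ) (x : iter k H M n),
    insertOne n n x = (iterSucc n).symm (x ⊗ₜ (1 : H))
  | 0, _ => rfl
  | n + 1, x => by simp [insertOne]

theorem insertOne_succ_of_le {n i : ℕ} (h : i ≤ n) (x : iter k H M n) (g : H) :
    insertOne (n + 1) i ((iterSucc n).symm (x ⊗ₜ g)) =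
      (iterSucc (n + 1)).symm (insertOne n i x ⊗ₜ g) := by
  simp [insertOne, h]

theorem codegen_self : ∀ (n : ℕ) (x : iter k H M n) (g : H),
    codegen n n ((iterSucc n).symm (x ⊗ₜ g)) = Coalgebra.counit (R := k) g • x
  | 0, x, g => by
    simp only [codegen, LinearMap.comp_apply, LinearEquiv.coe_coe, LinearEquiv.apply_symm_apply,
      LinearMap.lTensor_tmul, TensorProduct.rid_tmul]
  | n + 1, x, g => by
    simp only [codegen, LinearMap.comp_apply, LinearEquiv.coe_coe, LinearEquiv.apply_symm_apply,
      LinearMap.lTensor_tmul, TensorProduct.rid_tmul, if_neg (by omega : ¬ n + 1 < n),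
      if_neg (by omega : ¬ n + 1 = n)]

theorem codegen_succ_of_lt {n i : ℕ} (h : i < n) (x : iter k H M (n + 1)) (g : H) :
    codegen (n + 1) i ((iterSucc (n + 1)).symm (x ⊗ₜ g)) =
      (iterSucc n).symm (codegen n i x ⊗ₜ g) := by
  simp [codegen, h]

theorem codegen_succ_self (n : ℕ) (x : iter k H M n) (g h : H) :
    codegen (n + 1) n ((iterSucc (n + 1)).symm ((iterSucc n).symm (x ⊗ₜ g) ⊗ₜ h)) =
      (iterSucc n).symm (x ⊗ₜ (g * h)) := by
  simp [codegen]

theorem lastCoface_succ (S : SAYD k H M) (n : ℕ) (x : iter k H M n) (g : H) :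
    S.lastCoface (n + 1) ((iterSucc n).symm (x ⊗ₜ g)) = (iterSucc (n + 1)).symm
      (((iterSucc n).symm.toLinearMap).rTensor H (twist (iter k H M n)
        (iterSucc n (S.lastCoface n x) ⊗ₜ Coalgebra.comul (R := k) g))) := by
  simp [lastCoface]

theorem absorb_zero (S : SAYD k H M) (x : iter k H M 0) (g : H) :
    S.absorb 0 ((iterSucc 0).symm (x ⊗ₜ g)) = iterZero.symm (S.act ((iterZero x : M) ⊗ₜ g)) := by
  simp [absorb]

theorem absorb_succ (S : SAYD k H M) (n : ℕ) (x : iter k H M (n + 1)) (g : H) :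
    S.absorb (n + 1) ((iterSucc (n + 1)).symm (x ⊗ₜ g)) =
      (iterSucc n).symm (S.absorb n x ⊗ₜ g) := by
  simp [absorb]

end SAYD

namespace ModuleCoalgebra

variable {k : Type*} [Field k] {H : Type u} [Ring H] [HopfAlgebra k H]
  {C : Type u} [AddCommGroup C] [Module k C] [Coalgebra k C] {A : ModuleCoalgebra k H C}

theorem comulAt_iterSucc {n i : ℕ} (h : i ≤ n) (w : iter k C C n ⊗[k] C) :
    comulAt (n + 1) i ((iterSucc n).symm w) =
      (iterSucc (n + 1)).symm ((comulAt n i).rTensor C w) := by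
  induction w with
  | zero => simp
  | add x y hx hy => simp only [map_add, hx, hy]
  | tmul x c => rw [comulAt_succ_of_le h, LinearMap.rTensor_tmul]

theorem counitAt_iterSucc {n i : ℕ} (h : i ≤ n) (w : iter k C C (n + 1) ⊗[k] C) :
    counitAt (n + 1) i ((iterSucc (n + 1)).symm w) =
      (iterSucc n).symm ((counitAt n i).rTensor C w) := by
  induction w with
  | zero => simp
  | add x y hx hy => simp only [map_add, hx, hy]
  | tmul x c => rw [counitAt_succ_of_le h, LinearMap.rTensor_tmul]

theorem counitAt_last_iterSucc (n : ℕ) (w : iter k C C n ⊗[k] C) :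
    counitAt n n ((iterSucc n).symm w) =
      TensorProduct.rid k _ ((Coalgebra.counit (R := k)).lTensor _ w) := by
  induction w with
  | zero => simp
  | add x y hx hy => simp only [map_add, hx, hy]
  | tmul x c => rw [counitAt_last, LinearMap.lTensor_tmul, TensorProduct.rid_tmul]

theorem counitFirst_iterSucc (n : ℕ) (w : iter k C C (n + 1) ⊗[k] C) :
    counitFirst (n + 1) ((iterSucc (n + 1)).symm w) =
      (iterSucc n).symm ((counitFirst n).rTensor C w) := by
  induction w with
  | zero => simp
  | add x y hx hy => simp only [map_add, hx, hy]
  | tmul x c => rw [counitFirst_succ, LinearMap.rTensor_tmul]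

/-- The operators that leave the last factor alone are colinear for the coaction on it, hence they
commute with the Galois map on the last factor. -/
theorem lastCoact_comulAt {n i : ℕ} (h : i ≤ n) (x : iter k C C n) :
    lastCoact (n + 1) (comulAt n i x) = (comulAt n i).rTensor C (lastCoact n x) := by
  apply (iterSucc (n + 1)).symm.injective
  rw [← comulAt_self, comulAt_comulAt (by omega) le_rfl, Nat.add_sub_cancel, comulAt_self n,
    comulAt_iterSucc h]

theorem lastCoact_counitAt {n i : ℕ} (h : i < n) (x : iter k C C (n + 1)) :
    lastCoact n (counitAt n i x) = (counitAt n i).rTensor C (lastCoact (n + 1) x) := by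
  apply (iterSucc n).symm.injective
  rw [← comulAt_self, ← counitAt_iterSucc h.le, ← comulAt_self,
    counitAt_comulAt_of_gt (by omega) le_rfl, Nat.add_sub_cancel]

theorem lastCoact_counitFirst : ∀ (n : ℕ) (x : iter k C C (n + 1)),
    lastCoact n (counitFirst n x) = (counitFirst n).rTensor C (lastCoact (n + 1) x)
  | 0, x => by
    refine LinearMap.congr_fun (f := lastCoact 0 ∘ₗ counitFirst 0)
      (g := (counitFirst 0).rTensor C ∘ₗ lastCoact 1) (iter_succ_ext fun x c => ?_) x
    rw [LinearMap.comp_apply, LinearMap.comp_apply, counitFirst_zero, map_smul, lastCoact_iterZero,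
      lastCoact_iterSucc, tensorCoact, LinearMap.comp_apply, LinearMap.lTensor_tmul]
    generalize Coalgebra.comul (R := k) c = v
    induction v with
    | zero => simp
    | add x y hx hy => simp only [map_add, TensorProduct.tmul_add, smul_add, hx, hy]
    | tmul p q => simp [counitFirst_zero, TensorProduct.smul_tmul']
  | n + 1, x => by
    refine LinearMap.congr_fun (f := lastCoact (n + 1) ∘ₗ counitFirst (n + 1))
      (g := (counitFirst (n + 1)).rTensor C ∘ₗ lastCoact (n + 2)) (iter_succ_ext fun x c => ?_) x
    rw [LinearMap.comp_apply, LinearMap.comp_apply, counitFirst_succ, lastCoact_iterSucc,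
      lastCoact_iterSucc, tensorCoact, tensorCoact, LinearMap.comp_apply, LinearMap.comp_apply,
      LinearMap.lTensor_tmul, LinearMap.lTensor_tmul]
    generalize Coalgebra.comul (R := k) c = v
    induction v with
    | zero => simp
    | add x y hx hy => simp only [map_add, TensorProduct.tmul_add, hx, hy]
    | tmul p q => simp [counitFirst_succ]

theorem comulAt_galoisLast {n i : ℕ} (h : i ≤ n) (x : iter k C C n) (g : H) :
    comulAt (n + 1) i (A.galoisLast n (x ⊗ₜ g)) = A.galoisLast (n + 1) (comulAt n i x ⊗ₜ g) := by
  rw [galoisLast_eq, galoisLast_eq, comulAt_iterSucc h,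
    ← A.gal_rTensor (comulAt n i) (lastCoact_comulAt h), LinearMap.rTensor_tmul]

theorem counitAt_galoisLast {n i : ℕ} (h : i < n) (x : iter k C C (n + 1)) (g : H) :
    counitAt (n + 1) i (A.galoisLast (n + 1) (x ⊗ₜ g)) =
      A.galoisLast n (counitAt n i x ⊗ₜ g) := by
  rw [galoisLast_eq, galoisLast_eq, counitAt_iterSucc h.le,
    ← A.gal_rTensor (counitAt n i) (lastCoact_counitAt h), LinearMap.rTensor_tmul]

theorem counitFirst_galoisLast (n : ℕ) (x : iter k C C (n + 1)) (g : H) :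
    counitFirst (n + 1) (A.galoisLast (n + 1) (x ⊗ₜ g)) =
      A.galoisLast n (counitFirst n x ⊗ₜ g) := by
  rw [galoisLast_eq, galoisLast_eq, counitFirst_iterSucc,
    ← A.gal_rTensor (counitFirst n) (lastCoact_counitFirst n), LinearMap.rTensor_tmul]

theorem galoisLast_one (n : ℕ) (x : iter k C C n) :
    A.galoisLast n (x ⊗ₜ 1) = comulAt n n x := by
  rw [galoisLast_eq, comulAt_self, gal_tmul]
  generalize lastCoact n x = v
  induction v with
  | zero => simp
  | add x y hx hy => simp only [map_add, TensorProduct.add_tmul, hx, hy]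
  | tmul p q => simp [A.act_one]

theorem counitAt_last_galoisLast (n : ℕ) (x : iter k C C n) (h : H) :
    counitAt n n (A.galoisLast n (x ⊗ₜ h)) = Coalgebra.counit (R := k) h • x := by
  rw [galoisLast_eq, counitAt_last_iterSucc, counit_gal (isRightComodule_lastCoact n)]

theorem galoisLast_galoisLast (n : ℕ) (x : iter k C C n) (g h : H) :
    A.galoisLast (n + 1) (A.galoisLast n (x ⊗ₜ g) ⊗ₜ h) = (iterSucc (n + 1)).symm
      (((iterSucc n).symm.toLinearMap).rTensor C (A.gal (tensorCoact k C (iter k C C n))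
        (A.gal (lastCoact n) (x ⊗ₜ g) ⊗ₜ h))) := by
  rw [galoisLast_eq, galoisLast_eq, ← A.gal_rTensor (iterSucc n).symm.toLinearMap
    (lastCoact_iterSucc n), LinearMap.rTensor_tmul]
  rfl

/-- `ε` on the middle factor of `c⁽¹⁾ ⊗ c⁽²⁾ ◁ g⁽¹⁾ ⊗ c⁽³⁾ ◁ g⁽²⁾ h` multiplies `g` and `h`. -/
theorem counitAt_galoisLast_galoisLast (n : ℕ) (x : iter k C C n) (g h : H) :
    counitAt (n + 1) n (A.galoisLast (n + 1) (A.galoisLast n (x ⊗ₜ g) ⊗ₜ h)) =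
      A.galoisLast n (x ⊗ₜ (g * h)) := by
  have h₁ (v : iter k C C n ⊗[k] C) (u : H ⊗[k] H) : counitAt (n + 1) n ((iterSucc (n + 1)).symm
      (((iterSucc n).symm.toLinearMap).rTensor C (A.act.lTensor _ (TensorProduct.assoc k _ C H
        (TensorProduct.map (A.gal (lastCoact n)) A.act
          (TensorProduct.tensorTensorTensorComm k _ C H H (v ⊗ₜ u)) ⊗ₜ h))))) =
      (iterSucc n).symm (A.act.lTensor _ (TensorProduct.assoc k _ C H (v ⊗ₜ
        (TensorProduct.lid k H ((Coalgebra.counit (R := k)).rTensor H u) * h)))) := by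
    induction v with
    | zero => simp
    | add x y hx hy => simp only [map_add, TensorProduct.add_tmul, hx, hy]
    | tmul p c =>
      induction u with
      | zero => simp
      | add x y hx hy => simp only [map_add, TensorProduct.tmul_add, TensorProduct.add_tmul,
          add_mul, hx, hy]
      | tmul a b =>
        rw [TensorProduct.tensorTensorTensorComm_tmul, TensorProduct.map_tmul,
          TensorProduct.assoc_tmul, LinearMap.lTensor_tmul, LinearMap.rTensor_tmul,
          LinearEquiv.coe_coe, ← galoisLast_eq, counitAt_succ_of_le le_rfl,
          counitAt_last_galoisLast]
        simp [A.act_mul, TensorProduct.smul_tmul]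
  rw [galoisLast_galoisLast, gal_tmul, tensorCoact_gal (isRightComodule_lastCoact n), h₁,
    Coalgebra.rTensor_counit_comul, TensorProduct.lid_tmul, one_smul, galoisLast_eq, gal_tmul]

/-- `m₍₀₎ ⊗ m₍₁₎ ◁ h⁽¹⁾ ⊗ m₍₂₎ ◁ h⁽²⁾ S(h⁽³⁾) q = m₍₀₎ ⊗ m₍₁₎ ◁ h ⊗ m₍₂₎ ◁ q`. -/
theorem gal_gal_antipode {M : Type*} [AddCommGroup M] [Module k M] {ρ : M →ₗ[k] M ⊗[k] C}
    (hρ : IsRightComodule ρ) (m : M) (h q : H) :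
    A.gal (tensorCoact k C M) (TensorProduct.map (A.gal ρ ∘ₗ TensorProduct.mk k M H m)
      (LinearMap.mulRight k q ∘ₗ HopfAlgebra.antipode k) (Coalgebra.comul (R := k) h)) =
    (A.gal ρ).rTensor C (TensorProduct.rightComm k M C H (A.gal ρ (m ⊗ₜ q) ⊗ₜ h)) := by
  have h₁ (t : H ⊗[k] H) : A.gal (tensorCoact k C M)
      (TensorProduct.map (A.gal ρ ∘ₗ TensorProduct.mk k M H m)
        (LinearMap.mulRight k q ∘ₗ HopfAlgebra.antipode k) t) =
      TensorProduct.map (A.gal ρ) A.act (TensorProduct.tensorTensorTensorComm k M C H H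
        (ρ m ⊗ₜ ((LinearMap.mulRight k q).lTensor H
          ((LinearMap.mul' k H ∘ₗ (HopfAlgebra.antipode k).lTensor H).lTensor H
            (TensorProduct.assoc k H H H ((Coalgebra.comul (R := k)).rTensor H t)))))) := by
    induction t with
    | zero => simp
    | add x y hx hy => simp only [map_add, TensorProduct.tmul_add, hx, hy]
    | tmul a b =>
      rw [TensorProduct.map_tmul, gal_tmul, LinearMap.comp_apply, TensorProduct.mk_apply,
        tensorCoact_gal hρ, LinearMap.rTensor_tmul]
      generalize Coalgebra.comul (R := k) a = v
      generalize ρ m = w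
      induction w with
      | zero => simp
      | add x y hx hy => simp only [map_add, TensorProduct.add_tmul, hx, hy]
      | tmul p' q' =>
        induction v with
        | zero => simp
        | add x y hx hy => simp only [map_add, TensorProduct.add_tmul, TensorProduct.tmul_add,
            hx, hy]
        | tmul p q => simp [A.act_mul, mul_assoc]
  rw [h₁, comul_mul_antipode, LinearMap.lTensor_tmul, LinearMap.mulRight_apply, one_mul,
    gal_tmul (m := m)]
  generalize ρ m = w
  induction w with
  | zero => simp
  | add x y hx hy => simp only [map_add, TensorProduct.add_tmul, hx, hy]
  | tmul p c => simp

/-- The rotation carries the coaction on the last factor to the coaction on the last factor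
but one; this is the relation `t d_{n+1} = d_n t`. -/
theorem rightComm_rotate_lastCoact (n : ℕ) (x : iter k C C (n + 1)) :
    TensorProduct.rightComm k (iter k C C n) C C (((iterSucc n).toLinearMap ∘ₗ
      rotate (n + 1)).rTensor C (lastCoact (n + 1) x)) =
      (lastCoact n).rTensor C (iterSucc n (rotate (n + 1) x)) := by
  have h := rotate_comulAt (i := n + 1) (by omega) le_rfl x
  rw [comulAt_self, rotate_iterSucc, Nat.add_sub_cancel,
    ← (iterSucc n).symm_apply_apply (rotate (n + 1) x), comulAt_iterSucc le_rfl] at h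
  have h' := (iterSucc (n + 1)).symm.injective h
  refine ((iterSucc n).symm.rTensor C).injective (h'.trans ?_)
  rw [lastCoact, LinearMap.rTensor_comp, LinearMap.comp_apply]
  exact (LinearEquiv.symm_apply_apply ((iterSucc n).rTensor C) _).symm

/-- `c₁ ⊗ ⋯ ⊗ cₙ₊₁⁽¹⁾ ⊗ cₙ₊₁⁽²⁾ ◁ h ⊗ c₀` arises from `c₀ ⊗ ⋯ ⊗ cₙ₊₁ ⊗ h` in two ways. -/
theorem rotate_galoisLast (n : ℕ) (x : iter k C C (n + 1)) (h : H) :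
    rotate (n + 2) (A.galoisLast (n + 1) (x ⊗ₜ h)) = (iterSucc (n + 1)).symm
      ((A.galoisLast n).rTensor C (TensorProduct.rightComm k (iter k C C n) C H
        (iterSucc n (rotate (n + 1) x) ⊗ₜ h))) := by
  have h₁ (v : iter k C C (n + 1) ⊗[k] C) : ((iterSucc n).toLinearMap ∘ₗ
      rotate (n + 1)).rTensor C (A.act.lTensor _ (TensorProduct.assoc k _ C H (v ⊗ₜ h))) =
      A.act.lTensor _ (TensorProduct.assoc k _ C H
        ((((iterSucc n).toLinearMap ∘ₗ rotate (n + 1)).rTensor C v) ⊗ₜ h)) := by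
    induction v with
    | zero => simp
    | add x y hx hy => simp only [map_add, TensorProduct.add_tmul, hx, hy]
    | tmul p c => simp
  have h₂ : ((iterSucc n).toLinearMap ∘ₗ rotate (n + 1)).rTensor C (lastCoact (n + 1) x) =
      (TensorProduct.rightComm k (iter k C C n) C C).symm
        ((lastCoact n).rTensor C (iterSucc n (rotate (n + 1) x))) := by
    rw [← rightComm_rotate_lastCoact, LinearEquiv.symm_apply_apply]
  rw [galoisLast_eq, rotate_iterSucc, gal_tmul, h₁, h₂]
  congr 1
  generalize iterSucc n (rotate (n + 1) x) = v
  induction v with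
  | zero => simp
  | add x y hx hy => simp only [map_add, TensorProduct.add_tmul, hx, hy]
  | tmul s u =>
    rw [TensorProduct.rightComm_tmul, LinearMap.rTensor_tmul, LinearMap.rTensor_tmul,
      galoisLast_eq, gal_tmul]
    generalize lastCoact n s = w
    induction w with
    | zero => simp
    | add x y hx hy => simp only [map_add, TensorProduct.add_tmul, hx, hy]
    | tmul p q => simp [TensorProduct.rightComm_symm]

theorem ψ_insertOne : ∀ {n i : ℕ}, i ≤ n → ∀ x : iter k H A.CD n,
    A.ψ (n + 1) (SAYD.insertOne n i x) = comulAt n i (A.ψ n x) := by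
  intro n
  induction n with
  | zero =>
    intro i h x
    obtain rfl : i = 0 := by omega
    rw [SAYD.insertOne_self, ψ_succ, galoisLast_one]
  | succ n ih =>
    intro i h x
    rcases Nat.lt_or_ge n i with h' | h'
    · obtain rfl : i = n + 1 := by omega
      rw [SAYD.insertOne_self, ψ_succ, galoisLast_one]
    · refine LinearMap.congr_fun (f := A.ψ (n + 2) ∘ₗ SAYD.insertOne (n + 1) i)
        (g := comulAt (n + 1) i ∘ₗ A.ψ (n + 1)) (iter_succ_ext fun x g => ?_) x
      rw [LinearMap.comp_apply, LinearMap.comp_apply, SAYD.insertOne_succ_of_le h', ψ_succ, ψ_succ,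
        ih h', comulAt_galoisLast h']

theorem ψ_codegen : ∀ {n i : ℕ}, i ≤ n → ∀ x : iter k H A.CD (n + 1),
    A.ψ n (SAYD.codegen n i x) = counitAt n i (A.ψ (n + 1) x) := by
  have key (n : ℕ) (x : iter k H A.CD (n + 1)) :
      A.ψ n (SAYD.codegen n n x) = counitAt n n (A.ψ (n + 1) x) := by
    refine LinearMap.congr_fun (f := A.ψ n ∘ₗ SAYD.codegen n n)
        (g := counitAt n n ∘ₗ A.ψ (n + 1)) (iter_succ_ext fun x g => ?_) x
    rw [LinearMap.comp_apply, LinearMap.comp_apply, SAYD.codegen_self, ψ_succ,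
      counitAt_last_galoisLast, map_smul]
  intro n
  induction n with
  | zero =>
    intro i h x
    obtain rfl : i = 0 := by omega
    exact key 0 x
  | succ n ih =>
    intro i h x
    rcases Nat.lt_or_ge n i with h' | h'
    · obtain rfl : i = n + 1 := by omega
      exact key (n + 1) x
    · refine LinearMap.congr_fun (f := A.ψ (n + 1) ∘ₗ SAYD.codegen (n + 1) i)
        (g := counitAt (n + 1) i ∘ₗ A.ψ (n + 2)) (iter_succ_ext fun x g => ?_) x
      rw [LinearMap.comp_apply, LinearMap.comp_apply, ψ_succ]
      rcases Nat.lt_or_ge i n with h'' | h''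
      · rw [SAYD.codegen_succ_of_lt h'', ψ_succ, ih h', counitAt_galoisLast h'']
      · obtain rfl : i = n := by omega
        refine LinearMap.congr_fun (f := A.ψ (i + 1) ∘ₗ SAYD.codegen (i + 1) i ∘ₗ
          (iterSucc (i + 1)).symm.toLinearMap ∘ₗ (TensorProduct.mk k _ H).flip g)
          (g := counitAt (i + 1) i ∘ₗ A.galoisLast (i + 1) ∘ₗ (TensorProduct.mk k _ H).flip g ∘ₗ
            A.ψ (i + 1)) (iter_succ_ext fun x h => ?_) x
        simp only [LinearMap.comp_apply, LinearMap.flip_apply, TensorProduct.mk_apply,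
          LinearEquiv.coe_coe]
        rw [SAYD.codegen_succ_self, ψ_succ, ψ_succ, counitAt_galoisLast_galoisLast]

theorem IsHopfGalois.ψ_lastCoface (hA : A.IsHopfGalois) : ∀ (n : ℕ) (x : iter k H A.CD n),
    A.ψ (n + 1) (hA.sayd.lastCoface n x) = rotate (n + 1) (comulAt n 0 (A.ψ n x))
  | 0, x => by
    rw [ψ_zero, rotate_comulAt_iterZero, ← hA.galoisMap_coactFlip, ← galoisLast_zero]
    have h₁ : hA.sayd.lastCoface 0 x = (iterSucc 0).symm ((iterZero.symm.toLinearMap).rTensor H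
        (hA.coactFlip (iterZero x))) := by
      simp [SAYD.lastCoface, sayd]
    have h₂ (w : A.CD ⊗[k] H) : A.ψ 1 ((iterSucc 0).symm
        ((iterZero.symm.toLinearMap).rTensor H w)) = A.galoisLast 0
          ((iterZero.symm.toLinearMap).rTensor H (A.CD.subtype.rTensor H w)) := by
      induction w with
      | zero => simp
      | add x y hx hy => simp only [map_add, hx, hy]
      | tmul c g =>
        rw [LinearMap.rTensor_tmul, ψ_succ]
        rfl
    rw [h₁, h₂]
  | n + 1, x => by
    refine LinearMap.congr_fun (f := A.ψ (n + 2) ∘ₗ hA.sayd.lastCoface (n + 1))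
        (g := rotate (n + 2) ∘ₗ comulAt (n + 1) 0 ∘ₗ A.ψ (n + 1)) (iter_succ_ext fun x h => ?_) x
    rw [LinearMap.comp_apply, LinearMap.comp_apply, LinearMap.comp_apply, ψ_succ,
      comulAt_galoisLast (Nat.zero_le n), rotate_galoisLast, ← hA.ψ_lastCoface n x,
      SAYD.lastCoface_succ]
    obtain ⟨w, hw⟩ := (iterSucc n).symm.surjective (hA.sayd.lastCoface n x)
    rw [← hw, LinearEquiv.apply_symm_apply]
    clear hw
    induction w with
    | zero => simp
    | add x y hx hy => simp only [map_add, TensorProduct.add_tmul, hx, hy]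
    | tmul y q =>
      rw [ψ_succ, iterSucc_galoisLast]
      have h₁ (t : H ⊗[k] H) : A.ψ (n + 2) ((iterSucc (n + 1)).symm
          (((iterSucc n).symm.toLinearMap).rTensor H (SAYD.twist (iter k H A.CD n)
            ((y ⊗ₜ q) ⊗ₜ t)))) = (iterSucc (n + 1)).symm (((iterSucc n).symm.toLinearMap).rTensor C
              (A.gal (tensorCoact k C (iter k C C n)) (TensorProduct.map
                (A.gal (lastCoact n) ∘ₗ TensorProduct.mk k (iter k C C n) H (A.ψ n y))
                (LinearMap.mulRight k q ∘ₗ HopfAlgebra.antipode k) t))) := by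
        induction t with
        | zero => simp
        | add x y hx hy => simp only [map_add, TensorProduct.tmul_add, hx, hy]
        | tmul a b =>
          have h₂ : SAYD.twist (iter k H A.CD n) ((y ⊗ₜ[k] q) ⊗ₜ[k] (a ⊗ₜ[k] b)) =
              (y ⊗ₜ[k] a) ⊗ₜ[k] (HopfAlgebra.antipode k b * q) := by
            simp [SAYD.twist]
          rw [h₂, LinearMap.rTensor_tmul, ψ_succ, LinearEquiv.coe_coe, ψ_succ,
            galoisLast_galoisLast]
          rfl
      rw [h₁, gal_gal_antipode (isRightComodule_lastCoact n), ← LinearMap.comp_apply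
        (LinearMap.rTensor C _), ← LinearMap.rTensor_comp]
      have h₃ : (iterSucc n).symm.toLinearMap ∘ₗ A.gal (lastCoact n) = A.galoisLast n :=
        LinearMap.ext fun w => (A.galoisLast_eq n w).symm
      rw [h₃]

theorem IsHopfGalois.ψ_absorb (hA : A.IsHopfGalois) : ∀ (n : ℕ) (x : iter k H A.CD (n + 1)),
    A.ψ n (hA.sayd.absorb n x) = counitFirst n (A.ψ (n + 1) x)
  | 0, x => by
    refine LinearMap.congr_fun (f := A.ψ 0 ∘ₗ hA.sayd.absorb 0)
        (g := counitFirst 0 ∘ₗ A.ψ 1) (iter_succ_ext fun x h => ?_) x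
    have h₁ : A.ψ 1 ((iterSucc 0).symm (x ⊗ₜ h)) = (iterSucc 0).symm
        ((iterZero.symm.toLinearMap).rTensor C (A.galoisMap ((iterZero x : A.CD).1 ⊗ₜ h))) := by
      rw [ψ_succ, ← galoisLast_zero]
      rfl
    have h₂ (w : C ⊗[k] C) : counitFirst 0 ((iterSucc 0).symm
        ((iterZero.symm.toLinearMap).rTensor C w)) = iterZero.symm (TensorProduct.lid k C
          ((Coalgebra.counit (R := k)).rTensor C w)) := by
      induction w with
      | zero => simp
      | add x y hx hy => simp only [map_add, hx, hy]
      | tmul m c => simp [counitFirst_zero]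
    rw [LinearMap.comp_apply, LinearMap.comp_apply, SAYD.absorb_zero, h₁, h₂, counit_galoisMap]
    rfl
  | n + 1, x => by
    refine LinearMap.congr_fun (f := A.ψ (n + 1) ∘ₗ hA.sayd.absorb (n + 1))
        (g := counitFirst (n + 1) ∘ₗ A.ψ (n + 2)) (iter_succ_ext fun x h => ?_) x
    rw [LinearMap.comp_apply, LinearMap.comp_apply, SAYD.absorb_succ, ψ_succ, ψ_succ,
      hA.ψ_absorb n, counitFirst_galoisLast]

theorem IsHopfGalois.ψ_δ (hA : A.IsHopfGalois) (n i : ℕ) (x : iter k H A.CD n) :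
    A.ψ (n + 1) (hA.sayd.hopfCocyclic.δ n i x) = coface n i (A.ψ n x) := by
  simp only [SAYD.hopfCocyclic, coface]
  split_ifs with h
  · exact ψ_insertOne h x
  · exact hA.ψ_lastCoface n x

theorem IsHopfGalois.ψ_τ (hA : A.IsHopfGalois) (n : ℕ) (x : iter k H A.CD n) :
    A.ψ n (hA.sayd.hopfCocyclic.τ n x) = rotate n (A.ψ n x) := by
  rw [SAYD.hopfCocyclic, LinearMap.comp_apply, hA.ψ_absorb, hA.ψ_lastCoface,
    counitFirst_rotate_comulAt_zero]

/-! ### The isomorphism of cocyclic modules -/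

/-- The bijection `C^n(H, C^D) ≃ C^n(C(D), C)` given by `ψ`. -/
def IsHopfGalois.ψEquiv (hA : A.IsHopfGalois) (n : ℕ) :
    iter k H A.CD n ≃ₗ[k] A.cyclicCotensor n :=
  LinearEquiv.ofBijective
    ((A.ψ n).codRestrict _ fun x => (hA.mem_cyclicCotensor_iff_ψ n _).2 ⟨x, rfl⟩)
    ⟨fun _ _ h => hA.ψ_injective n (congrArg Subtype.val h), fun y => by
      obtain ⟨x, hx⟩ := (hA.mem_cyclicCotensor_iff_ψ n _).1 y.2
      exact ⟨x, Subtype.ext hx⟩⟩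

theorem IsHopfGalois.coe_ψEquiv (hA : A.IsHopfGalois) (n : ℕ) (x : iter k H A.CD n) :
    (hA.ψEquiv n x : iter k C C n) = A.ψ n x := rfl

/-- The relative cocyclic module of the coextension, with the operators transported along `ψ`;
as `ψ` intertwines the operators, these are the restrictions of the operators on `C^{⊗(n+1)}`. -/
def IsHopfGalois.relativeCocyclic (hA : A.IsHopfGalois) :
    CocyclicOps k (fun n => A.cyclicCotensor n) where
  δ n i := (hA.ψEquiv (n + 1)).toLinearMap ∘ₗ hA.sayd.hopfCocyclic.δ n i ∘ₗ
    (hA.ψEquiv n).symm.toLinearMap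
  σ n i := (hA.ψEquiv n).toLinearMap ∘ₗ hA.sayd.hopfCocyclic.σ n i ∘ₗ
    (hA.ψEquiv (n + 1)).symm.toLinearMap
  τ n := (hA.ψEquiv n).toLinearMap ∘ₗ hA.sayd.hopfCocyclic.τ n ∘ₗ
    (hA.ψEquiv n).symm.toLinearMap

theorem IsHopfGalois.isRelative_relativeCocyclic (hA : A.IsHopfGalois) :
    A.IsRelative hA.relativeCocyclic where
  δ_eq n i _ x := by
    obtain ⟨y, rfl⟩ := (hA.ψEquiv n).surjective x
    simp only [relativeCocyclic, LinearMap.comp_apply, LinearEquiv.coe_coe,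
      LinearEquiv.symm_apply_apply, coe_ψEquiv, hA.ψ_δ]
  σ_eq n i hi x := by
    obtain ⟨y, rfl⟩ := (hA.ψEquiv (n + 1)).surjective x
    simp only [relativeCocyclic, LinearMap.comp_apply, LinearEquiv.coe_coe,
      LinearEquiv.symm_apply_apply, coe_ψEquiv]
    exact ψ_codegen hi y
  τ_eq n x := by
    obtain ⟨y, rfl⟩ := (hA.ψEquiv n).surjective x
    simp only [relativeCocyclic, LinearMap.comp_apply, LinearEquiv.coe_coe,
      LinearEquiv.symm_apply_apply, coe_ψEquiv, hA.ψ_τ]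

/-- The isomorphism `ψ` of cocyclic modules. -/
def IsHopfGalois.cocyclicIso (hA : A.IsHopfGalois) :
    CocyclicOps.Iso hA.sayd.hopfCocyclic hA.relativeCocyclic where
  equiv := hA.ψEquiv
  comm_δ n i _ x := by simp [relativeCocyclic]
  comm_σ n i _ x := by simp [relativeCocyclic]
  comm_τ n x := by simp [relativeCocyclic]

theorem IsHopfGalois.isCocyclic_hopfCocyclic (hA : A.IsHopfGalois) :
    hA.sayd.hopfCocyclic.IsCocyclic :=
  isCocyclic_coalgebraCocyclic.of_injective A.ψ hA.ψ_injective (fun n i _ => hA.ψ_δ n i)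
    (fun _ _ hi => ψ_codegen hi) hA.ψ_τ

theorem IsRelative.isCocyclic {Y : CocyclicOps k (fun n => A.cyclicCotensor n)}
    (hY : A.IsRelative Y) : Y.IsCocyclic :=
  isCocyclic_coalgebraCocyclic.of_injective (fun n => (A.cyclicCotensor n).subtype)
    (fun _ => Subtype.val_injective) hY.δ_eq hY.σ_eq hY.τ_eq

end ModuleCoalgebra

end HopfGalois

end

theorem theorem3p12 {k : Type*} [Field k] {H C : Type u} [Ring H] [HopfAlgebra k H]
    [AddCommGroup C] [Module k C] [Coalgebra k C]
    (A : HopfGalois.ModuleCoalgebra k H C) (hA : A.IsHopfGalois) :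
    ∃ (S : HopfGalois.SAYD k H A.CD)
      (Y : HopfGalois.CocyclicOps k (fun n => A.cyclicCotensor n)),
      A.IsCanonical hA S ∧ S.hopfCocyclic.IsCocyclic ∧
      A.IsRelative Y ∧ Y.IsCocyclic ∧
      ∃ Ψ : HopfGalois.CocyclicOps.Iso S.hopfCocyclic Y,
        (∀ n x, (Ψ.equiv n x : HopfGalois.iter k C C n) = A.ψ n x) ∧
        ∀ n, ∃ (hΨ : ∀ z : ∀ q : Fin (n + 1), HopfGalois.iter k H A.CD q,
              z ∈ S.hopfCocyclic.cocycles n →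
              (fun q : Fin (n + 1) => Ψ.equiv q (z q)) ∈ Y.cocycles n)
            (e : S.hopfCocyclic.HC n ≃ₗ[k] Y.HC n),
          ∀ z : S.hopfCocyclic.cocycles n,
            e (Submodule.Quotient.mk z) =
              Submodule.Quotient.mk ⟨fun q => Ψ.equiv q (z.1 q), hΨ z z.2⟩ := by
  refine ⟨hA.sayd, hA.relativeCocyclic, hA.isCanonical_sayd, hA.isCocyclic_hopfCocyclic,
    hA.isRelative_relativeCocyclic, hA.isRelative_relativeCocyclic.isCocyclic, hA.cocyclicIso,
    hA.coe_ψEquiv, fun n => ⟨fun z hz => (hA.cocyclicIso.totEquiv_mem_cocycles n z).2 hz,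
      hA.cocyclicIso.hcEquiv n, fun z => rfl⟩⟩
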